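/- Let $n\in\mathbb N$, $n\ge 1$, $c>0$, let $\Gamma\in\mathbb R^{n\times n}$ be symmetric positive definite, and put $\phi(x)=\frac1{2c}x^\top\Gamma x$ for $x\in\mathbb R^n$. Let $H=L^2(\mathbb R^n;e^{-\phi})$ be the real Hilbert space with inner product $\langle f,g\rangle_H=\int_{\mathbb R^n}e^{-\phi}fg\,dx$, and let $V=W^{1,2}(\mathbb R^n;e^{-\phi})$ be the space of all $f\in H$ whose weak partial derivatives of first order exist and belong to $H$. On $V$ consider the form $a(v,z)=\sum_{i=1}^n\langle\partial_iv,\partial_iz\rangle_H$, and let $A:\mathcal D(A)\subset V\to H$ be the associated operator: $\mathcal D(A)=\{v\in V:\exists\,y\in H\ \forall z\in V:\ a(v,z)=\langle y,z\rangle_H\}$ and $a(v,z)=\langle Av,z\rangle_H$ for all $v\in\mathcal D(A)$, $z\in V$. Let $v_1,\dots,v_n$ be an orthonormal basis of $\mathbb R^n$ with $\Gamma v_k=\tilde\lambda_kv_k$, and put $\lambda_k=\tilde\lambda_k/c$ and $u_k=\sqrt{\lambda_k/2}\,v_k$. Let $H_m(t)=(-1)^me^{t^2}\frac{d^m}{dt^m}e^{-t^2}$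 be the Hermite polynomials, and for $\alpha\in\mathbb N_0^n$ let $$H_\alpha(x)=\prod_{k=1}^nH_{\alpha_k}(u_k^\top x),\qquad \lambda_\alpha=\sum_{k=1}^n\alpha_k\lambda_k .$$ Then the (complex) spectrum of $A$, that is, the spectrum of the complexification of $A$, is $$\sigma(A)=\{\lambda_\alpha:\alpha\in\mathbb N_0^n\},$$ and $\{H_\alpha:\alpha\in\mathbb N_0^n\}$ is a complete orthogonal system in $H$ consisting of eigenfunctions of $A$: the $H_\alpha$ are nonzero elements of $\mathcal D(A)$, pairwise orthogonal in $H$, their linear span is dense in $H$, and $AH_\alpha=\lambda_\alpha H_\alpha$ for all $\alpha\in\mathbb N_0^n$. Furthermore: (i) For all $x\in\mathbb R^n$ and $\alpha\in\mathbb N_0^n$, $$\nabla\big(e^{-\phi(x)}H_\alpha(x)\big)=-e^{-\phi(x)}\sum_{k=1}^n\Big(\prod_{j\ne k}H_{\alpha_j}(u_j^\top x)\Big)H_{\alpha_k+1}(u_k^\top x)\,u_k .$$ (ii) For $r>0$ let $S_r=\{x\in\mathbb R^n:\phi(x)=r\}$, with surface measure $dS$ (the $(n-1)$-dimensional Hausdorff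 measure) and outward unit normal $\vec n=\nabla\phi/\|\nabla\phi\|$. Every $w\in V$ has a trace on $S_r$, that is, a function $g\in L^2(S_r)$ for which there are $\psi_k\in C_c^\infty(\mathbb R^n)$ with $\psi_k\to w$ in $V$ and $\psi_k|_{S_r}\to g$ in $L^2(S_r)$. For all $w\in V^n$ and $\alpha\in\mathbb N_0^n$, with the values of $w$ on $S_r$ understood as any componentwise trace of $w$, the function $e^{-\phi}H_\alpha\,w\cdot\vec n$ is integrable over $S_r$ for every $r>0$, and $$\lim_{r\to\infty}\int_{S_r}e^{-\phi(x)}H_\alpha(x)\,w(x)\cdot\vec n\;dS=0 .$$ -/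

import Mathlib

open MeasureTheory Filter Topology
open scoped ContDiff ENNReal

noncomputable section

namespace OUForm

/-- Euclidean space `ℝⁿ`. -/
abbrev E (n : ℕ) := EuclideanSpace ℝ (Fin n)

variable {n : ℕ}

/-- The quadratic potential `φ(x) = (1/(2c)) xᵀ Γ x`. -/
def potential (c : ℝ) (Γ : Matrix (Fin n) (Fin n) ℝ) (x : E n) : ℝ :=
  1 / (2 * c) * (x.ofLp ⬝ᵥ Matrix.mulVec Γ x.ofLp)

/-- The measure `e^{-φ(x)} dx` on `ℝⁿ`. -/
def weightedMeasure (c : ℝ) (Γ : Matrix (Fin n) (Fin n) ℝ) : Measure (E n) :=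
  volume.withDensity (fun x => ENNReal.ofReal (Real.exp (-potential c Γ x)))

/-- The real Hilbert space `H = L²(ℝⁿ; e^{-φ})`. -/
abbrev WeightedL2 (c : ℝ) (Γ : Matrix (Fin n) (Fin n) ℝ) := Lp ℝ 2 (weightedMeasure c Γ)

/-! ### Weak derivatives and the weighted Sobolev space -/

/-- `g` is the weak partial derivative `∂f/∂xᵢ` of `f` on `ℝⁿ` (with respect to Lebesgue measure,
tested against smooth compactly supported functions). -/
structure HasWeakPartial (i : Fin n) (f g : E n → ℝ) : Prop where
  locInt : LocallyIntegrable f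
  locInt' : LocallyIntegrable g
  integral_eq : ∀ ψ : E n → ℝ, ContDiff ℝ ∞ ψ → HasCompactSupport ψ →
    ∫ x, f x * fderiv ℝ ψ x (EuclideanSpace.single i 1) = -∫ x, g x * ψ x

lemma test_integrable {f ψ : E n → ℝ} (hf : LocallyIntegrable f) (hψ : Continuous ψ)
    (hs : HasCompactSupport ψ) : Integrable (fun x => f x * ψ x) := by
  have := hf.integrable_smul_right_of_hasCompactSupport hψ hs
  simpa [mul_comm] using this

lemma test_deriv {ψ : E n → ℝ} (hψ : ContDiff ℝ ∞ ψ) (hs : HasCompactSupport ψ) (v : E n) :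
    Continuous (fun x => fderiv ℝ ψ x v) ∧ HasCompactSupport (fun x => fderiv ℝ ψ x v) :=
  ⟨(hψ.continuous_fderiv (by simp)).clm_apply continuous_const, hs.fderiv_apply (𝕜 := ℝ) v⟩

lemma HasWeakPartial.add {i : Fin n} {f g f' g' : E n → ℝ} (h : HasWeakPartial i f g)
    (h' : HasWeakPartial i f' g') : HasWeakPartial i (f + f') (g + g') where
  locInt := h.locInt.add h'.locInt
  locInt' := h.locInt'.add h'.locInt'
  integral_eq ψ hψ hs := by
    obtain ⟨hd, hds⟩ := test_deriv hψ hs (EuclideanSpace.single i 1)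
    simp only [Pi.add_apply, add_mul]
    rw [integral_add (test_integrable h.locInt hd hds) (test_integrable h'.locInt hd hds),
      integral_add (test_integrable h.locInt' hψ.continuous hs)
        (test_integrable h'.locInt' hψ.continuous hs),
      h.integral_eq ψ hψ hs, h'.integral_eq ψ hψ hs]
    ring

lemma HasWeakPartial.smul {i : Fin n} {f g : E n → ℝ} (h : HasWeakPartial i f g) (a : ℝ) :
    HasWeakPartial i (a • f) (a • g) where
  locInt := h.locInt.smul a
  locInt' := h.locInt'.smul a
  integral_eq ψ hψ hs := by
    simp only [Pi.smul_apply, smul_eq_mul, mul_assoc, integral_const_mul]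
    rw [h.integral_eq ψ hψ hs]
    ring

lemma HasWeakPartial.congr {i : Fin n} {f g f' g' : E n → ℝ} (h : HasWeakPartial i f g)
    (hf : f =ᵐ[volume] f') (hg : g =ᵐ[volume] g') : HasWeakPartial i f' g' where
  locInt := h.locInt.congr hf
  locInt' := h.locInt'.congr hg
  integral_eq ψ hψ hs := by
    have h1 : ∫ x, f x * fderiv ℝ ψ x (EuclideanSpace.single i 1) =
        ∫ x, f' x * fderiv ℝ ψ x (EuclideanSpace.single i 1) :=
      integral_congr_ae (hf.mono fun x hx => by simp [hx])
    have h2 : ∫ x, g x * ψ x = ∫ x, g' x * ψ x :=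
      integral_congr_ae (hg.mono fun x hx => by simp [hx])
    rw [← h1, ← h2]
    exact h.integral_eq ψ hψ hs

lemma HasWeakPartial.unique {i : Fin n} {f g g' : E n → ℝ} (h : HasWeakPartial i f g)
    (h' : HasWeakPartial i f g') : g =ᵐ[volume] g' := by
  refine ae_eq_of_integral_contDiff_smul_eq h.locInt' h'.locInt' fun ψ hψ hs => ?_
  have h1 := h.integral_eq ψ hψ hs
  have h2 := h'.integral_eq ψ hψ hs
  simp only [smul_eq_mul, mul_comm (ψ _)]
  linarith

lemma hasWeakPartial_test {i : Fin n} {ψ : E n → ℝ} (hψ : ContDiff ℝ ∞ ψ)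
    (hs : HasCompactSupport ψ) :
    HasWeakPartial i ψ (fun x => fderiv ℝ ψ x (EuclideanSpace.single i 1)) where
  locInt := hψ.continuous.locallyIntegrable
  locInt' := (test_deriv hψ hs _).1.locallyIntegrable
  integral_eq χ hχ hχs := by
    obtain ⟨hd, hds⟩ := test_deriv hψ hs (EuclideanSpace.single i 1)
    obtain ⟨hd', hds'⟩ := test_deriv hχ hχs (EuclideanSpace.single i 1)
    exact integral_mul_fderiv_eq_neg_fderiv_mul_of_integrable
      (test_integrable hd.locallyIntegrable hχ.continuous hχs)
      (test_integrable hψ.continuous.locallyIntegrable hd' hds')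
      (test_integrable hψ.continuous.locallyIntegrable hχ.continuous hχs)
      (fun x _ => hψ.differentiable (by simp) x) (fun x _ => hχ.differentiable (by simp) x)

variable (c : ℝ) (Γ : Matrix (Fin n) (Fin n) ℝ)

lemma continuous_potential : Continuous (potential c Γ) := by
  unfold potential dotProduct Matrix.mulVec dotProduct
  fun_prop

lemma volume_ac : (volume : Measure (E n)) ≪ weightedMeasure c Γ := by
  refine withDensity_absolutelyContinuous' ?_ (ae_of_all _ fun x => ?_)
  · exact (continuous_potential c Γ).neg.rexp.measurable.ennreal_ofReal.aemeasurable
  · simpa using Real.exp_pos _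

instance : IsLocallyFiniteMeasure (weightedMeasure c Γ) :=
  IsLocallyFiniteMeasure.withDensity_ofReal (continuous_potential c Γ).neg.rexp

/-- The weighted Sobolev space `V = W^{1,2}(ℝⁿ; e^{-φ})`: all `f ∈ H` whose weak partial derivatives
exist and belong to `H`. -/
def sobolev : Submodule ℝ (WeightedL2 c Γ) where
  carrier := {f | ∀ i, ∃ g : WeightedL2 c Γ, HasWeakPartial i f g}
  zero_mem' i := ⟨0, by
    have h0 : HasWeakPartial i (0 : E n → ℝ) 0 :=
      ⟨locallyIntegrable_zero, locallyIntegrable_zero, by simp⟩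
    have hz := (volume_ac c Γ).ae_eq (Lp.coeFn_zero ℝ 2 (weightedMeasure c Γ))
    exact h0.congr hz.symm hz.symm⟩
  add_mem' {f f'} hf hf' i := by
    obtain ⟨g, hg⟩ := hf i
    obtain ⟨g', hg'⟩ := hf' i
    exact ⟨g + g', (hg.add hg').congr ((volume_ac c Γ).ae_eq (Lp.coeFn_add f f').symm)
      ((volume_ac c Γ).ae_eq (Lp.coeFn_add g g').symm)⟩
  smul_mem' a f hf i := by
    obtain ⟨g, hg⟩ := hf i
    exact ⟨a • g, (hg.smul a).congr ((volume_ac c Γ).ae_eq (Lp.coeFn_smul a f).symm)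
      ((volume_ac c Γ).ae_eq (Lp.coeFn_smul a g).symm)⟩

variable {c Γ}

lemma weakPartial_unique {i : Fin n} {f g g' : WeightedL2 c Γ} (h : HasWeakPartial i f g)
    (h' : HasWeakPartial i f g') : g = g' := by
  refine Lp.ext ?_
  exact (withDensity_absolutelyContinuous _ _).ae_eq (h.unique h')

lemma weakPartial_choose_eq {i : Fin n} (v : sobolev c Γ) {g : WeightedL2 c Γ}
    (h : HasWeakPartial i (v : WeightedL2 c Γ) g) : (v.2 i).choose = g :=
  weakPartial_unique (v.2 i).choose_spec h

variable (c Γ)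

/-- The weak partial derivative `∂/∂xᵢ : V → H`. -/
def weakPartial (i : Fin n) : sobolev c Γ →ₗ[ℝ] WeightedL2 c Γ where
  toFun v := (v.2 i).choose
  map_add' v w := weakPartial_choose_eq _ <|
    ((v.2 i).choose_spec.add (w.2 i).choose_spec).congr
      ((volume_ac c Γ).ae_eq (Lp.coeFn_add _ _).symm)
      ((volume_ac c Γ).ae_eq (Lp.coeFn_add _ _).symm)
  map_smul' a v := weakPartial_choose_eq _ <|
    ((v.2 i).choose_spec.smul a).congr
      ((volume_ac c Γ).ae_eq (Lp.coeFn_smul _ _).symm)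
      ((volume_ac c Γ).ae_eq (Lp.coeFn_smul _ _).symm)

lemma weakPartial_spec (i : Fin n) (v : sobolev c Γ) :
    HasWeakPartial i (v : WeightedL2 c Γ) (weakPartial c Γ i v) :=
  (v.2 i).choose_spec

/-! ### The form and its operator -/

/-- The form `a(v, w) = ∑ᵢ ⟨∂v/∂xᵢ, ∂w/∂xᵢ⟩_H` on `V`. -/
def form (v w : sobolev c Γ) : ℝ :=
  ∑ i, inner ℝ (weakPartial c Γ i v) (weakPartial c Γ i w)

lemma form_add (v v' z : sobolev c Γ) : form c Γ (v + v') z = form c Γ v z + form c Γ v' z := by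
  simp [form, map_add, inner_add_left, Finset.sum_add_distrib]

lemma form_smul (a : ℝ) (v z : sobolev c Γ) : form c Γ (a • v) z = a * form c Γ v z := by
  simp [form, map_smul, real_inner_smul_left, Finset.mul_sum]

lemma test_memLp {ψ : E n → ℝ} (hψ : Continuous ψ) (hs : HasCompactSupport ψ) :
    MemLp ψ 2 (weightedMeasure c Γ) :=
  hψ.memLp_of_hasCompactSupport hs

lemma test_mem_sobolev {ψ : E n → ℝ} (hψ : ContDiff ℝ ∞ ψ) (hs : HasCompactSupport ψ) :
    (test_memLp c Γ hψ.continuous hs).toLp ψ ∈ sobolev c Γ := fun i => by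
  obtain ⟨hd, hds⟩ := test_deriv hψ hs (EuclideanSpace.single i 1)
  exact ⟨(test_memLp c Γ hd hds).toLp _, (hasWeakPartial_test hψ hs).congr
    ((volume_ac c Γ).ae_eq (MemLp.coeFn_toLp _).symm)
    ((volume_ac c Γ).ae_eq (MemLp.coeFn_toLp _).symm)⟩

/-- `V` is dense in `H`, in the form needed for the operator to be well defined. -/
lemma eq_of_inner_eq {u u' : WeightedL2 c Γ}
    (h : ∀ z : sobolev c Γ, inner ℝ u (z : WeightedL2 c Γ) = inner ℝ u' (z : WeightedL2 c Γ)) :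
    u = u' := by
  rw [← sub_eq_zero]
  have hloc : LocallyIntegrable (u - u' : WeightedL2 c Γ) (weightedMeasure c Γ) :=
    (Lp.memLp (u - u')).locallyIntegrable (by norm_num)
  refine (Lp.eq_zero_iff_ae_eq_zero).2 ?_
  refine ae_eq_zero_of_integral_contDiff_smul_eq_zero hloc fun ψ hψ hs => ?_
  have h1 : inner ℝ (u - u') ((test_memLp c Γ hψ.continuous hs).toLp ψ) = 0 := by
    rw [inner_sub_left, sub_eq_zero]
    exact h ⟨_, test_mem_sobolev c Γ hψ hs⟩
  rw [L2.inner_def] at h1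
  rw [← h1]
  refine integral_congr_ae ?_
  filter_upwards [(test_memLp c Γ hψ.continuous hs).coeFn_toLp] with x hx
  simp [hx]

/-- The domain `D(A) = {v ∈ V | ∃ u ∈ H, ∀ z ∈ V, a(v, z) = ⟨u, z⟩_H}`. -/
def operatorDomain : Submodule ℝ (WeightedL2 c Γ) where
  carrier := {v | ∃ hv : v ∈ sobolev c Γ, ∃ u : WeightedL2 c Γ, ∀ z : sobolev c Γ,
    form c Γ ⟨v, hv⟩ z = inner ℝ u (z : WeightedL2 c Γ)}
  zero_mem' := ⟨zero_mem _, 0, fun z => by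
    have h0 : (⟨0, zero_mem _⟩ : sobolev c Γ) = 0 := rfl
    simp [form, h0]⟩
  add_mem' := by
    rintro v v' ⟨hv, u, hu⟩ ⟨hv', u', hu'⟩
    refine ⟨add_mem hv hv', u + u', fun z => ?_⟩
    rw [inner_add_left, ← hu, ← hu']
    exact form_add c Γ ⟨v, hv⟩ ⟨v', hv'⟩ z
  smul_mem' := by
    rintro a v ⟨hv, u, hu⟩
    refine ⟨Submodule.smul_mem _ a hv, a • u, fun z => ?_⟩
    rw [real_inner_smul_left, ← hu]
    exact form_smul c Γ a ⟨v, hv⟩ z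

lemma operatorDomain_le : operatorDomain c Γ ≤ sobolev c Γ := fun _ hv => hv.1

/-- The operator `A : D(A) ⊂ V → H` associated to the form `a`, i.e. the unique operator with
`a(v, z) = ⟨A v, z⟩_H` for all `v ∈ D(A)` and `z ∈ V`. -/
def formOperator : WeightedL2 c Γ →ₗ.[ℝ] WeightedL2 c Γ where
  domain := operatorDomain c Γ
  toFun :=
    { toFun := fun v => v.2.2.choose
      map_add' := fun v w => eq_of_inner_eq c Γ fun z => by
        rw [inner_add_left, ← (v + w).2.2.choose_spec z, ← v.2.2.choose_spec z,
          ← w.2.2.choose_spec z]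
        exact form_add c Γ ⟨v, v.2.1⟩ ⟨w, w.2.1⟩ z
      map_smul' := fun a v => eq_of_inner_eq c Γ fun z => by
        rw [RingHom.id_apply, real_inner_smul_left, ← (a • v).2.2.choose_spec z,
          ← v.2.2.choose_spec z]
        exact form_smul c Γ a ⟨v, v.2.1⟩ z }

lemma formOperator_spec (v : (formOperator c Γ).domain) (z : sobolev c Γ) :
    form c Γ ⟨v, operatorDomain_le c Γ v.2⟩ z =
      inner ℝ (formOperator c Γ v) (z : WeightedL2 c Γ) :=
  v.2.2.choose_spec z

/-! ### Spectrum of an unbounded operator -/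

/-- For `T` on a real space `X` and `z = a + ib ∈ ℂ`, the value of `z - T` (complexified) at the
element `u + iv` of the complexification of `D(T)`, as a pair (real part, imaginary part). -/
def shift {X : Type*} [AddCommGroup X] [Module ℝ X] (T : X →ₗ.[ℝ] X) (z : ℂ)
    (u v : T.domain) : X × X :=
  (z.re • (u : X) - z.im • (v : X) - T u, z.re • (v : X) + z.im • (u : X) - T v)

/-- The resolvent set (in `ℂ`) of the complexification of an unbounded operator `T` on a real normed
space: `z - T` is a bijection from the complexified domain onto the complexification `X × X` of the
space, with bounded inverse `R`. -/
def opResolventSet {X : Type*} [NormedAddCommGroup X] [NormedSpace ℝ X] (T : X →ₗ.[ℝ] X) : Set ℂ :=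
  {z | ∃ R : X × X →L[ℝ] X × X,
    (∀ f, ∃ u v : T.domain, R f = ((u : X), (v : X)) ∧ shift T z u v = f) ∧
    ∀ u v : T.domain, R (shift T z u v) = ((u : X), (v : X))}

/-- The spectrum, as a subset of `ℂ`, of (the complexification of) an unbounded operator on a real
normed space. -/
def opSpectrum {X : Type*} [NormedAddCommGroup X] [NormedSpace ℝ X] (T : X →ₗ.[ℝ] X) : Set ℂ :=
  (opResolventSet T)ᶜ

/-! ### Hermite functions -/

/-- The (physicists') Hermite polynomial `Hₘ(t) = (-1)ᵐ e^{t²} (dᵐ/dtᵐ) e^{-t²}`. -/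
def hermiteFun (m : ℕ) (t : ℝ) : ℝ :=
  (-1) ^ m * Real.exp (t ^ 2) * iteratedDeriv m (fun s => Real.exp (-s ^ 2)) t

/-- The product `H_α(x) = ∏ₖ H_{αₖ}(uₖᵀ x)`. -/
def hermiteProd (u : Fin n → E n) (α : Fin n → ℕ) (x : E n) : ℝ :=
  ∏ k, hermiteFun (α k) (inner ℝ (u k) x)

/-- `λ_α = ∑ₖ αₖ λₖ`. -/
def eigenvalue (l : Fin n → ℝ) (α : Fin n → ℕ) : ℝ := ∑ k, α k * l k

/-! ### Level sets, surface measure, normal, traces -/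

/-- The level set `S_r = {x | φ(x) = r}`. -/
def levelSet (r : ℝ) : Set (E n) := {x | potential c Γ x = r}

/-- The surface measure on `S_r`: the `(n-1)`-dimensional Hausdorff measure (in the Euclidean
normalization) restricted to `S_r`. -/
def surfaceMeasure (r : ℝ) : Measure (E n) :=
  (Measure.euclideanHausdorffMeasure (n - 1)).restrict (levelSet c Γ r)

/-- The unit vector field `∇φ/‖∇φ‖`; on the boundary `S_r` of `{φ < r}` it is the outward unit
normal. -/
def outwardNormal (x : E n) : E n :=
  ‖gradient (potential c Γ) x‖⁻¹ • gradient (potential c Γ) x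

variable {c Γ}

/-- `g` is (a representative of) the trace on `S_r` of the Sobolev function `w ∈ V`: the value at `w`
of the continuous extension to `V` of the restriction map `ψ ↦ ψ|_{S_r} ∈ L²(S_r)` on smooth
compactly supported functions. -/
structure IsTrace (r : ℝ) (w : sobolev c Γ) (g : E n → ℝ) : Prop where
  memLp : MemLp g 2 (surfaceMeasure c Γ r)
  exists_approx : ∃ ψ : ℕ → E n → ℝ,
    (∀ k, ContDiff ℝ ∞ (ψ k) ∧ HasCompactSupport (ψ k)) ∧
    Tendsto (fun k => eLpNorm (ψ k - ⇑(w : WeightedL2 c Γ)) 2 (weightedMeasure c Γ)) atTop (𝓝 0) ∧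
    (∀ i, Tendsto (fun k => eLpNorm
      ((fun x => fderiv ℝ (ψ k) x (EuclideanSpace.single i 1)) - ⇑(weakPartial c Γ i w)) 2
      (weightedMeasure c Γ)) atTop (𝓝 0)) ∧
    Tendsto (fun k => eLpNorm (ψ k - g) 2 (surfaceMeasure c Γ r)) atTop (𝓝 0)

end OUForm

end

open OUForm

open scoped NNReal

/-! ### One-dimensional Hermite functions -/

/-! In the coordinates ⟨`u k`, x⟩ the potential is a plain sum of squares, so e^{-φ} H_α factors
into one-dimensional functions e^{-s²} H_m(s). Two rules follow: differentiating H_α lowers an index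
(`hasFDerivAt_hermiteProd`), and differentiating e^{-φ} H_α raises one
(`hasFDerivAt_exp_mul_hermiteProd`), which is (i). The raising rule describes the adjoint of ∂ᵢ in H
on Hermite products, first against test functions and then, by cutoffs, against all of V
(`integral_weakPartial_mul`, `inner_weakPartial`). Since the `u k` are orthogonal with squared
length `l k / 2`, lowering followed by raising multiplies H_α by λ_α (`form_hermiteLp`). The same
adjointness yields orthogonality and nonvanishing.

Completeness: a function orthogonal to all H_α has vanishing moments in every direction, so its
weighted Fourier transform vanishes, and the characteristic function determines a finite measure
(`eq_zero_of_inner_hermiteLp`). V is complete in the graph norm, so Riesz representation makes 1 + A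
onto, which identifies D(A) through Hermite coefficients. Off the eigenvalues the resolvent is then
the bounded diagonal operator with entries (z - λ_α)⁻¹ (`mem_opResolventSet`), while an eigenvalue
leaves z - A with a kernel.

For (ii), test functions are dense in V: an element orthogonal to them is, by cutoffs, orthogonal to
every H_α in the graph inner product, hence (1 + λ_α)⟨w, H_α⟩ = 0 (`graphMap_mem_closure`). The
level sets are linear images of spheres, covered by finitely many uniformly Lipschitz graphs; the
fundamental theorem of calculus along lines gives a trace inequality with a constant bounded for r ≥
1 (`exists_trace_inequality`). Inserting the weight e^{-sφ} costs e^{sr/2} in norm. With s = 1 for w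
and s = 1/2 for H_α, the boundary integral is O(e^{-r} e^{r/2} e^{r/4}) = O(e^{-r/4}). -/

lemma contDiff_gauss : ContDiff ℝ ∞ (fun s : ℝ => Real.exp (-s ^ 2)) := by fun_prop

lemma contDiff_iteratedDeriv_gauss (m : ℕ) :
    ContDiff ℝ ∞ (iteratedDeriv m (fun s : ℝ => Real.exp (-s ^ 2))) := by
  rw [iteratedDeriv_eq_iterate]
  exact contDiff_gauss.iterate_deriv m

lemma contDiff_hermiteFun (m : ℕ) : ContDiff ℝ ∞ (hermiteFun m) := by
  unfold hermiteFun
  have := contDiff_iteratedDeriv_gauss m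
  fun_prop

lemma hermiteFun_zero (t : ℝ) : hermiteFun 0 t = 1 := by
  simp [hermiteFun, ← Real.exp_add]

lemma gauss_mul_hermiteFun (m : ℕ) (t : ℝ) : Real.exp (-t ^ 2) * hermiteFun m t =
    (-1) ^ m * iteratedDeriv m (fun s : ℝ => Real.exp (-s ^ 2)) t := by
  have h : Real.exp (-t ^ 2) * Real.exp (t ^ 2) = 1 := by simp [← Real.exp_add]
  unfold hermiteFun
  linear_combination ((-1) ^ m * iteratedDeriv m (fun s : ℝ => Real.exp (-s ^ 2)) t) * h

lemma hasDerivAt_gauss_mul_hermiteFun (m : ℕ) (t : ℝ) :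
    HasDerivAt (fun t => Real.exp (-t ^ 2) * hermiteFun m t)
      (-(Real.exp (-t ^ 2) * hermiteFun (m + 1) t)) t := by
  simp_rw [gauss_mul_hermiteFun]
  have hd : DifferentiableAt ℝ (iteratedDeriv m (fun s : ℝ => Real.exp (-s ^ 2))) t :=
    (contDiff_iteratedDeriv_gauss m).differentiable (by simp) t
  convert! hd.hasDerivAt.const_mul ((-1) ^ m) using 1
  rw [iteratedDeriv_succ]
  ring

/-- Compare two computations of the derivative of e^{-t²} H_m, by the Rodrigues formula and by the
product rule, and cancel the Gaussian. -/
lemma hermiteFun_succ (m : ℕ) (t : ℝ) :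
    hermiteFun (m + 1) t = 2 * t * hermiteFun m t - deriv (hermiteFun m) t := by
  have hd : HasDerivAt (hermiteFun m) (deriv (hermiteFun m) t) t :=
    ((contDiff_hermiteFun m).differentiable (by simp) t).hasDerivAt
  have hg : HasDerivAt (fun t : ℝ => Real.exp (-t ^ 2)) (Real.exp (-t ^ 2) * (-(2 * t))) t := by
    simpa using ((hasDerivAt_pow 2 t).neg).exp
  have h := (hasDerivAt_gauss_mul_hermiteFun m t).unique (hg.mul hd)
  have he := Real.exp_pos (-t ^ 2)
  have : Real.exp (-t ^ 2) * hermiteFun (m + 1) t =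
      Real.exp (-t ^ 2) * (2 * t * hermiteFun m t - deriv (hermiteFun m) t) := by linarith
  exact mul_left_cancel₀ he.ne' this

/-- The truncated `m - 1` is harmless at `m = 0`, because its coefficient vanishes; the same
convention recurs for multi-indices below. -/
lemma hasDerivAt_hermiteFun (m : ℕ) (t : ℝ) :
    HasDerivAt (hermiteFun m) (2 * m * hermiteFun (m - 1) t) t := by
  induction m generalizing t with
  | zero =>
    have : hermiteFun 0 = fun _ => 1 := funext hermiteFun_zero
    simpa [this] using hasDerivAt_const t (1 : ℝ)
  | succ m ih =>
    have he : hermiteFun (m + 1) =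
        fun t => 2 * t * hermiteFun m t - 2 * m * hermiteFun (m - 1) t := by
      funext t
      rw [hermiteFun_succ, (ih t).deriv]
    have hd : HasDerivAt (hermiteFun (m - 1)) (deriv (hermiteFun (m - 1)) t) t :=
      ((contDiff_hermiteFun _).differentiable (by simp) t).hasDerivAt
    rw [he]
    convert! (((hasDerivAt_id t).const_mul 2).mul (ih t)).sub (hd.const_mul (2 * (m : ℝ))) using 1
    rcases m with _ | m
    · simp
    · have := hermiteFun_succ m t
      simp only [Nat.add_sub_cancel, id] at *
      push_cast
      rw [this]
      ring

lemma hermiteFun_rec (m : ℕ) (t : ℝ) :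
    hermiteFun (m + 1) t = 2 * t * hermiteFun m t - 2 * m * hermiteFun (m - 1) t := by
  rw [hermiteFun_succ, (hasDerivAt_hermiteFun m t).deriv]

/-! ### Functions of at most exponential growth -/

/-- `f` is bounded by `C e^{a‖x‖}`. -/
def ExpGrowth {X : Type*} [NormedAddCommGroup X] (f : X → ℝ) : Prop :=
  ∃ C a : ℝ, 0 ≤ C ∧ 0 ≤ a ∧ ∀ x, |f x| ≤ C * Real.exp (a * ‖x‖)

namespace ExpGrowth

variable {X Y : Type*} [NormedAddCommGroup X] [NormedAddCommGroup Y] {f g : X → ℝ}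

lemma of_le (hg : ExpGrowth g) (h : ∀ x, |f x| ≤ |g x|) : ExpGrowth f := by
  obtain ⟨C, a, hC, ha, hb⟩ := hg
  exact ⟨C, a, hC, ha, fun x => (h x).trans (hb x)⟩

lemma const (b : ℝ) : ExpGrowth (fun _ : X => b) :=
  ⟨|b|, 0, abs_nonneg b, le_rfl, fun x => by simp⟩

lemma norm_id : ExpGrowth (fun x : X => ‖x‖) :=
  ⟨1, 1, zero_le_one, zero_le_one, fun x => by
    have := Real.add_one_le_exp ‖x‖
    simp only [abs_norm, one_mul]
    linarith⟩

lemma mul (hf : ExpGrowth f) (hg : ExpGrowth g) : ExpGrowth (fun x => f x * g x) := by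
  obtain ⟨C, a, hC, ha, hb⟩ := hf
  obtain ⟨D, b, hD, hb', hb2⟩ := hg
  refine ⟨C * D, a + b, mul_nonneg hC hD, add_nonneg ha hb', fun x => ?_⟩
  rw [abs_mul, add_mul, Real.exp_add]
  calc |f x| * |g x| ≤ (C * Real.exp (a * ‖x‖)) * (D * Real.exp (b * ‖x‖)) :=
        mul_le_mul (hb x) (hb2 x) (abs_nonneg _) (by positivity)
    _ = _ := by ring

lemma add (hf : ExpGrowth f) (hg : ExpGrowth g) : ExpGrowth (fun x => f x + g x) := by
  obtain ⟨C, a, hC, ha, hb⟩ := hf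
  obtain ⟨D, b, hD, hb', hb2⟩ := hg
  refine ⟨C + D, max a b, add_nonneg hC hD, le_max_of_le_left ha, fun x => ?_⟩
  have h1 : C * Real.exp (a * ‖x‖) ≤ C * Real.exp (max a b * ‖x‖) := by
    gcongr; exact le_max_left _ _
  have h2 : D * Real.exp (b * ‖x‖) ≤ D * Real.exp (max a b * ‖x‖) := by
    gcongr; exact le_max_right _ _
  rw [add_mul]
  exact (abs_add_le _ _).trans (add_le_add ((hb x).trans h1) ((hb2 x).trans h2))

lemma abs (hf : ExpGrowth f) : ExpGrowth (fun x => |f x|) := hf.of_le fun x => by simp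

lemma const_mul (hf : ExpGrowth f) (b : ℝ) : ExpGrowth (fun x => b * f x) := (const b).mul hf

lemma sum {ι : Type*} {f : ι → X → ℝ} (s : Finset ι) (hf : ∀ i ∈ s, ExpGrowth (f i)) :
    ExpGrowth (fun x => ∑ i ∈ s, f i x) := by
  classical
  induction s using Finset.induction_on with
  | empty => simpa using const (0 : ℝ)
  | insert i s hi ih =>
    simp_rw [Finset.sum_insert hi]
    exact (hf i (by simp)).add (ih fun j hj => hf j (by simp [hj]))

lemma prod {ι : Type*} {f : ι → X → ℝ} (s : Finset ι) (hf : ∀ i ∈ s, ExpGrowth (f i)) :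
    ExpGrowth (fun x => ∏ i ∈ s, f i x) := by
  classical
  induction s using Finset.induction_on with
  | empty => simpa using const (1 : ℝ)
  | insert i s hi ih =>
    simp_rw [Finset.prod_insert hi]
    exact (hf i (by simp)).mul (ih fun j hj => hf j (by simp [hj]))

lemma comp_lipschitz (hf : ExpGrowth f) {L : Y → X} {K : ℝ} (hK : 0 ≤ K)
    (hL : ∀ y, ‖L y‖ ≤ K * ‖y‖) : ExpGrowth (fun y => f (L y)) := by
  obtain ⟨C, a, hC, ha, hb⟩ := hf
  refine ⟨C, a * K, hC, mul_nonneg ha hK, fun y => (hb _).trans ?_⟩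
  rw [mul_assoc]
  gcongr
  exact hL y

end ExpGrowth

lemma expGrowth_hermiteFun (m : ℕ) : ExpGrowth (hermiteFun m) := by
  induction m using Nat.strong_induction_on with
  | _ m ih =>
    rcases m with _ | m
    · exact (ExpGrowth.const 1).of_le fun t => by rw [hermiteFun_zero]
    · have hid : ExpGrowth (fun t : ℝ => t) := ExpGrowth.norm_id.of_le fun t => by simp
      refine ((((hid.const_mul 2).mul (ih m (by omega))).add
        ((ih (m - 1) (by omega)).const_mul (-(2 * m)))).of_le fun t => ?_)
      rw [hermiteFun_rec]
      exact le_of_eq (congrArg _ (by ring))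

/-! ### Products of Hermite functions -/

section HermiteProd

variable {n : ℕ} (u : Fin n → E n)

lemma contDiff_hermiteProd (α : Fin n → ℕ) : ContDiff ℝ ∞ (hermiteProd u α) := by
  unfold hermiteProd
  refine contDiff_prod fun k _ => (contDiff_hermiteFun (α k)).comp ?_
  exact contDiff_const.inner ℝ contDiff_id

lemma expGrowth_hermiteProd (α : Fin n → ℕ) : ExpGrowth (hermiteProd u α) := by
  unfold hermiteProd
  exact ExpGrowth.prod _ fun k _ => (expGrowth_hermiteFun (α k)).comp_lipschitz
    (L := fun x : E n => inner ℝ (u k) x) (norm_nonneg (u k)) fun x => norm_inner_le_norm _ _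

lemma hermiteProd_update (α : Fin n → ℕ) (k : Fin n) (m : ℕ) (x : E n) :
    hermiteProd u (Function.update α k m) x =
      (∏ j ∈ Finset.univ.erase k, hermiteFun (α j) (inner ℝ (u j) x)) *
        hermiteFun m (inner ℝ (u k) x) := by
  unfold hermiteProd
  rw [← Finset.prod_erase_mul _ _ (Finset.mem_univ k)]
  congr 1
  · refine Finset.prod_congr rfl fun j hj => ?_
    rw [Function.update_of_ne (Finset.ne_of_mem_erase hj)]
  · simp

lemma hermiteProd_zero (x : E n) : hermiteProd u 0 x = 1 := by
  simp [hermiteProd, hermiteFun_zero]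

lemma hasFDerivAt_inner_right (w x : E n) :
    HasFDerivAt (fun x : E n => inner ℝ w x) (innerSL ℝ w) x :=
  (innerSL ℝ w).hasFDerivAt

/-- The lowering rule: differentiation along `u k` takes α to α - e_k. -/
lemma hasFDerivAt_hermiteProd (α : Fin n → ℕ) (x : E n) :
    HasFDerivAt (hermiteProd u α)
      (∑ k, (2 * α k * hermiteProd u (Function.update α k (α k - 1)) x) • innerSL ℝ (u k)) x := by
  have h := HasFDerivAt.finsetProd (u := Finset.univ)
    (g := fun k (x : E n) => hermiteFun (α k) (inner ℝ (u k) x)) (x := x)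
    (fun k _ => (hasDerivAt_hermiteFun (α k) _).comp_hasFDerivAt x
      (hasFDerivAt_inner_right (u k) x))
  refine (h.congr_fderiv ?_)
  refine Finset.sum_congr rfl fun k _ => ?_
  rw [hermiteProd_update, smul_smul]
  congr 1
  ring

/-- The three-term recurrence, used to show that multiplication by a linear form preserves the span
of the Hermite products. -/
lemma inner_mul_hermiteProd (α : Fin n → ℕ) (k : Fin n) (x : E n) :
    inner ℝ (u k) x * hermiteProd u α x =
      (1 / 2) * hermiteProd u (Function.update α k (α k + 1)) x +
        α k * hermiteProd u (Function.update α k (α k - 1)) x := by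
  have h : hermiteProd u α x = hermiteProd u (Function.update α k (α k)) x := by simp
  rw [h, hermiteProd_update, hermiteProd_update, hermiteProd_update, hermiteFun_rec]
  ring

variable {u} {c : ℝ} {Γ : Matrix (Fin n) (Fin n) ℝ}

lemma exp_potential_mul_hermiteProd (hφ : ∀ x, potential c Γ x = ∑ k, inner ℝ (u k) x ^ 2)
    (α : Fin n → ℕ) (x : E n) : Real.exp (-potential c Γ x) * hermiteProd u α x =
      ∏ k, (Real.exp (-inner ℝ (u k) x ^ 2) * hermiteFun (α k) (inner ℝ (u k) x)) := by
  rw [hφ, ← Finset.sum_neg_distrib, Real.exp_sum, hermiteProd, Finset.prod_mul_distrib]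

/-- The raising rule: the Gaussian splits over the coordinates, and each factor e^{-s²} H_m has
derivative -e^{-s²} H_{m+1}. -/
lemma hasFDerivAt_exp_mul_hermiteProd
    (hφ : ∀ x, potential c Γ x = ∑ k, inner ℝ (u k) x ^ 2) (α : Fin n → ℕ) (x : E n) :
    HasFDerivAt (fun x => Real.exp (-potential c Γ x) * hermiteProd u α x)
      (-(Real.exp (-potential c Γ x) •
        ∑ k, hermiteProd u (Function.update α k (α k + 1)) x • innerSL ℝ (u k))) x := by
  have h := HasFDerivAt.finsetProd (u := Finset.univ)
    (g := fun k (x : E n) => Real.exp (-inner ℝ (u k) x ^ 2) *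
      hermiteFun (α k) (inner ℝ (u k) x)) (x := x)
    (fun k _ => (hasDerivAt_gauss_mul_hermiteFun (α k) _).comp_hasFDerivAt x
      (hasFDerivAt_inner_right (u k) x))
  simp_rw [exp_potential_mul_hermiteProd hφ]
  refine (h.congr_fderiv ?_)
  rw [Finset.smul_sum, ← Finset.sum_neg_distrib]
  refine Finset.sum_congr rfl fun k _ => ?_
  rw [smul_smul, smul_smul, ← neg_smul, exp_potential_mul_hermiteProd hφ,
    ← Finset.prod_erase_mul _ _ (Finset.mem_univ k)]
  congr 1
  simp only [Function.update_self]
  have : ∏ j ∈ Finset.univ.erase k, Real.exp (-inner ℝ (u j) x ^ 2) *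
      hermiteFun (Function.update α k (α k + 1) j) (inner ℝ (u j) x) =
      ∏ j ∈ Finset.univ.erase k, Real.exp (-inner ℝ (u j) x ^ 2) *
        hermiteFun (α j) (inner ℝ (u j) x) :=
    Finset.prod_congr rfl fun j hj => by
      rw [Function.update_of_ne (Finset.ne_of_mem_erase hj)]
  rw [this]
  ring

lemma hasGradientAt_exp_mul_hermiteProd
    (hφ : ∀ x, potential c Γ x = ∑ k, inner ℝ (u k) x ^ 2) (α : Fin n → ℕ) (x : E n) :
    HasGradientAt (fun y => Real.exp (-potential c Γ y) * hermiteProd u α y)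
        (-(Real.exp (-potential c Γ x) • ∑ k,
          ((∏ j ∈ Finset.univ.erase k, hermiteFun (α j) (inner ℝ (u j) x)) *
            hermiteFun (α k + 1) (inner ℝ (u k) x)) • u k)) x := by
  rw [hasGradientAt_iff_hasFDerivAt]
  refine (hasFDerivAt_exp_mul_hermiteProd hφ α x).congr_fderiv ?_
  ext y
  simp only [InnerProductSpace.toDual_apply_apply, inner_neg_left, real_inner_smul_left,
    sum_inner, hermiteProd_update]
  simp

end HermiteProd

/-! ### The potential in the eigenbasis -/

/-- The scaling √(`l k` / 2) is exactly what absorbs the factor 1/(2c) after diagonalizing Γ;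
positive definiteness makes the square roots genuine. -/
lemma potential_eq_sum {n : ℕ} {c : ℝ} (hc : 0 < c) {Γ : Matrix (Fin n) (Fin n) ℝ}
    (hΓ : Γ.PosDef) (v : OrthonormalBasis (Fin n) ℝ (E n)) {lt l : Fin n → ℝ}
    (hv : ∀ k, Matrix.mulVec Γ (v k).ofLp = lt k • (v k).ofLp) (hl : ∀ k, l k = lt k / c)
    {u : Fin n → E n} (hu : ∀ k, u k = √(l k / 2) • v k) :
    (∀ k, 0 < l k) ∧ ∀ x, potential c Γ x = ∑ k, inner ℝ (u k) x ^ 2 := by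
  have hdot : ∀ x y : E n, x.ofLp ⬝ᵥ y.ofLp = inner ℝ x y := fun x y => by
    simp [PiLp.inner_apply, dotProduct, mul_comm]
  have hlt : ∀ k, 0 < lt k := fun k => by
    have hne : (v k).ofLp ≠ 0 := by
      simpa using v.orthonormal.ne_zero k
    have h := hΓ.dotProduct_mulVec_pos hne
    rw [hv] at h
    rw [star_trivial, dotProduct_smul, hdot, real_inner_self_eq_norm_sq, v.orthonormal.1 k] at h
    simpa using h
  have hl0 : ∀ k, 0 < l k := fun k => by rw [hl]; exact div_pos (hlt k) hc
  refine ⟨hl0, fun x => ?_⟩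
  have hx : x.ofLp = ∑ k, inner ℝ (v k) x • (v k).ofLp := by
    conv_lhs => rw [← v.sum_repr' x]
    simp
  have hG : Matrix.mulVec Γ x.ofLp = (∑ k, (inner ℝ (v k) x * lt k) • v k : E n).ofLp := by
    conv_lhs => rw [hx]
    rw [Matrix.mulVec_sum]
    simp [Matrix.mulVec_smul, hv, smul_smul]
  rw [potential, hG, hdot, inner_sum, Finset.mul_sum]
  refine Finset.sum_congr rfl fun k _ => ?_
  rw [hu, real_inner_smul_left, real_inner_smul_right, mul_pow,
    Real.sq_sqrt (by have := hl0 k; positivity), hl, real_inner_comm]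
  field_simp

/-! ### The weighted measure -/

section WeightedMeasure

variable {n : ℕ} {c : ℝ} {Γ : Matrix (Fin n) (Fin n) ℝ}

variable (c Γ) in
lemma measurable_weight :
    Measurable (fun x : E n => ENNReal.ofReal (Real.exp (-potential c Γ x))) :=
  (continuous_potential c Γ).neg.rexp.measurable.ennreal_ofReal

lemma integral_weighted (f : E n → ℝ) :
    ∫ x, f x ∂weightedMeasure c Γ = ∫ x, f x * Real.exp (-potential c Γ x) := by
  rw [weightedMeasure, integral_withDensity_eq_integral_toReal_smul
    (measurable_weight c Γ) (by simp)]
  refine integral_congr_ae (ae_of_all _ fun x => ?_)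
  simp [(Real.exp_pos _).le, mul_comm]

lemma integrable_weighted_iff {f : E n → ℝ} :
    Integrable f (weightedMeasure c Γ) ↔
      Integrable (fun x => f x * Real.exp (-potential c Γ x)) := by
  rw [weightedMeasure, integrable_withDensity_iff
    (measurable_weight c Γ) (by simp)]
  simp [(Real.exp_pos _).le]

lemma lintegral_weighted (f : E n → ℝ≥0∞) :
    ∫⁻ x, f x ∂weightedMeasure c Γ =
      ∫⁻ x, ENNReal.ofReal (Real.exp (-potential c Γ x)) * f x := by
  rw [weightedMeasure, lintegral_withDensity_eq_lintegral_mul_non_measurable _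
    (measurable_weight c Γ) (by simp)]
  simp

/-- On a compact set the inverse weight e^φ is bounded. -/
lemma locallyIntegrable_of_weighted {f : E n → ℝ}
    (hf : LocallyIntegrable f (weightedMeasure c Γ)) : LocallyIntegrable f := by
  rw [locallyIntegrable_iff] at hf ⊢
  intro K hK
  have hc : Continuous (fun x : E n => Real.exp (potential c Γ x)) :=
    (continuous_potential c Γ).rexp
  have h1 := hf K hK
  rw [IntegrableOn, weightedMeasure, restrict_withDensity hK.measurableSet,
    integrable_withDensity_iff
    (measurable_weight c Γ) (by simp)] at h1
  have h2 : IntegrableOn (fun x => f x * Real.exp (-potential c Γ x)) K := by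
    simpa [(Real.exp_pos _).le, IntegrableOn] using h1
  refine (h2.mul_continuousOn hc.continuousOn hK).congr_fun (fun x _ => ?_) hK.measurableSet
  simp [mul_assoc, ← Real.exp_add]

lemma locallyIntegrable_weightedL2 (f : WeightedL2 c Γ) : LocallyIntegrable f :=
  locallyIntegrable_of_weighted ((Lp.memLp f).locallyIntegrable (by norm_num))

lemma integrable_exp_neg_mul_sq_norm {b : ℝ} (hb : 0 < b) :
    Integrable (fun x : E n => Real.exp (-b * ‖x‖ ^ 2)) := by
  have h := (GaussianFourier.integrable_cexp_neg_mul_sq_norm_add (V := E n) (b := (b : ℂ))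
    (by simpa using hb) 0 0).norm
  refine h.congr (ae_of_all _ fun x => ?_)
  simp only [Complex.norm_exp]
  congr 1
  simp [← Complex.ofReal_pow, ← Complex.ofReal_neg, ← Complex.ofReal_mul]

/-- A Gaussian beats e^{a‖x‖}. Every `s > 0` is allowed because the boundary estimate needs H_α in
the larger space with weight e^{-φ/2}. -/
lemma ExpGrowth.integrable_mul_exp {f : E n → ℝ} (hf : ExpGrowth f) (hm : Continuous f)
    {κ s : ℝ} (hκ : 0 < κ) (hs : 0 < s) (hφ : ∀ x, κ * ‖x‖ ^ 2 ≤ potential c Γ x) :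
    Integrable (fun x => f x * Real.exp (-(s * potential c Γ x))) := by
  obtain ⟨C, a, hC, ha, hb⟩ := hf
  have hb0 : 0 < s * κ / 2 := by positivity
  have hg := (integrable_exp_neg_mul_sq_norm (n := n) hb0).const_mul
    (C * Real.exp (a ^ 2 / (2 * (s * κ))))
  have hc := continuous_potential c Γ
  refine hg.mono' (by fun_prop) (ae_of_all _ fun x => ?_)
  rw [norm_mul, Real.norm_eq_abs, Real.norm_of_nonneg (Real.exp_pos _).le, mul_assoc,
    ← Real.exp_add]
  calc |f x| * Real.exp (-(s * potential c Γ x))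
      ≤ (C * Real.exp (a * ‖x‖)) * Real.exp (-(s * potential c Γ x)) := by
        gcongr; exact hb x
    _ = C * Real.exp (a * ‖x‖ - s * potential c Γ x) := by
        rw [mul_assoc, ← Real.exp_add, sub_eq_add_neg]
    _ ≤ _ := by
        gcongr
        have h1 := mul_le_mul_of_nonneg_left (hφ x) hs.le
        -- Completing the square: half of the quadratic decay pays for the linear exponent.
        have h2 : a * ‖x‖ ≤ a ^ 2 / (2 * (s * κ)) + s * κ / 2 * ‖x‖ ^ 2 := by
          rw [← sub_nonneg]
          have : a ^ 2 / (2 * (s * κ)) + s * κ / 2 * ‖x‖ ^ 2 - a * ‖x‖ =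
              (a - s * κ * ‖x‖) ^ 2 / (2 * (s * κ)) := by
            field_simp; ring
          rw [this]; positivity
        nlinarith

lemma ExpGrowth.integrable {f : E n → ℝ} (hf : ExpGrowth f) (hm : Continuous f)
    {κ : ℝ} (hκ : 0 < κ) (hφ : ∀ x, κ * ‖x‖ ^ 2 ≤ potential c Γ x) :
    Integrable f (weightedMeasure c Γ) := by
  rw [integrable_weighted_iff]
  simpa using hf.integrable_mul_exp hm hκ one_pos hφ

lemma ExpGrowth.memLp {f : E n → ℝ} (hf : ExpGrowth f) (hm : Continuous f)
    {κ : ℝ} (hκ : 0 < κ) (hφ : ∀ x, κ * ‖x‖ ^ 2 ≤ potential c Γ x) :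
    MemLp f 2 (weightedMeasure c Γ) := by
  rw [memLp_two_iff_integrable_sq hm.aestronglyMeasurable]
  simpa [sq] using (hf.mul hf).integrable (by fun_prop) hκ hφ

lemma inner_toLp_right (w : WeightedL2 c Γ) {g : E n → ℝ}
    (hg : MemLp g 2 (weightedMeasure c Γ)) :
    inner ℝ w (hg.toLp g) = ∫ x, w x * g x ∂weightedMeasure c Γ := by
  rw [L2.inner_def]
  refine integral_congr_ae ?_
  filter_upwards [hg.coeFn_toLp] with x h2
  simp [h2, mul_comm]

lemma potential_lower_bound {v : OrthonormalBasis (Fin n) ℝ (E n)} {l : Fin n → ℝ}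
    {u : Fin n → E n} (hu : ∀ k, u k = √(l k / 2) • v k) (hl : ∀ k, 0 < l k)
    (hφ : ∀ x, potential c Γ x = ∑ k, inner ℝ (u k) x ^ 2) :
    ∃ κ > 0, ∀ x, κ * ‖x‖ ^ 2 ≤ potential c Γ x := by
  have hκ : ∃ κ > 0, ∀ k, κ ≤ l k / 2 := by
    -- In dimension zero there is no smallest eigenvalue, and any positive constant serves.
    rcases isEmpty_or_nonempty (Fin n) with h | h
    · exact ⟨1, one_pos, fun k => isEmptyElim k⟩
    · obtain ⟨k0, hk0⟩ := Finite.exists_min l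
      exact ⟨l k0 / 2, half_pos (hl k0), fun k => by linarith [hk0 k]⟩
  obtain ⟨κ, hκ0, hκ⟩ := hκ
  refine ⟨κ, hκ0, fun x => ?_⟩
  rw [hφ, ← v.sum_sq_norm_inner_right x, Finset.mul_sum]
  refine Finset.sum_le_sum fun k _ => ?_
  have := hl k
  rw [hu, real_inner_smul_left, mul_pow, Real.sq_sqrt (by positivity), Real.norm_eq_abs, sq_abs]
  exact mul_le_mul_of_nonneg_right (hκ k) (sq_nonneg _)

end WeightedMeasure

/-! ### Cutoff functions and integration by parts -/

/-- Dilate a fixed bump by N + 1. The rate ‖x‖/(N + 1) for χ_N → 1 is crude, but against functions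
of exponential growth the extra factor ‖x‖ is free, and it gives convergence with an explicit rate.
-/
lemma exists_cutoff (n : ℕ) : ∃ (χ : ℕ → E n → ℝ) (C : ℝ), 0 ≤ C ∧ ∀ N,
    ContDiff ℝ ∞ (χ N) ∧ HasCompactSupport (χ N) ∧ (∀ x, |χ N x - 1| ≤ ‖x‖ / (N + 1)) ∧
      ∀ x, ‖fderiv ℝ (χ N) x‖ ≤ C / (N + 1) := by
  let b : ContDiffBump (0 : E n) := ⟨1, 2, one_pos, one_lt_two⟩
  have hb : ContDiff ℝ ∞ b := b.contDiff
  obtain ⟨C, hC⟩ := (b.hasCompactSupport.fderiv (𝕜 := ℝ)).exists_bound_of_continuous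
    (hb.continuous_fderiv (by simp))
  refine ⟨fun N x => b (((N : ℝ) + 1)⁻¹ • x), C, (norm_nonneg _).trans (hC 0), fun N => ?_⟩
  have hN : (0 : ℝ) < (N : ℝ) + 1 := by positivity
  refine ⟨hb.comp (contDiff_const_smul _), b.hasCompactSupport.comp_smul (inv_ne_zero hN.ne'),
    fun x => ?_, fun x => ?_⟩
  · rcases le_or_gt ‖x‖ (N + 1) with h | h
    · have : b (((N : ℝ) + 1)⁻¹ • x) = 1 := by
        apply b.one_of_mem_closedBall
        rw [mem_closedBall_zero_iff, norm_smul, norm_inv, Real.norm_of_nonneg hN.le,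
          inv_mul_le_iff₀ hN]
        simpa [b] using h
      simp only [this, sub_self, abs_zero]
      positivity
    · have h1 : (1 : ℝ) ≤ ‖x‖ / (N + 1) := by rw [le_div_iff₀ hN]; linarith
      refine le_trans ?_ h1
      rw [abs_le]
      constructor <;> linarith [b.nonneg (x := ((N : ℝ) + 1)⁻¹ • x),
        b.le_one (x := ((N : ℝ) + 1)⁻¹ • x)]
  · have h : fderiv ℝ (fun x : E n => b (((N : ℝ) + 1)⁻¹ • x)) x =
        ((N : ℝ) + 1)⁻¹ • fderiv ℝ b (((N : ℝ) + 1)⁻¹ • x) := fderiv_comp_smul _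
    rw [h, norm_smul, norm_inv, Real.norm_of_nonneg hN.le, div_eq_inv_mul]
    gcongr
    exact hC _

section IntegrationByParts

variable {n : ℕ} {c : ℝ} {Γ : Matrix (Fin n) (Fin n) ℝ}

/-- Cauchy–Schwarz makes |w| B integrable, so the error is at most a constant over N + 1. -/
lemma tendsto_integral_mul_of_le {X : Type*} [MeasurableSpace X] {μ : Measure X} {w a B : X → ℝ}
    {aN : ℕ → X → ℝ} (hw : MemLp w 2 μ) (ha : MemLp a 2 μ) (hB : MemLp B 2 μ)
    (hN : ∀ N, MemLp (aN N) 2 μ) (h : ∀ N x, |aN N x - a x| ≤ B x / (N + 1)) :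
    Tendsto (fun N => ∫ x, w x * aN N x ∂μ) atTop (𝓝 (∫ x, w x * a x ∂μ)) := by
  have hwB : Integrable (fun x => |w x| * B x) μ := hw.abs.integrable_mul hB
  have hlim : Tendsto (fun N : ℕ => (∫ x, |w x| * B x ∂μ) * (1 / ((N : ℝ) + 1))) atTop (𝓝 0) := by
    simpa using tendsto_one_div_add_atTop_nhds_zero_nat.const_mul (∫ x, |w x| * B x ∂μ)
  rw [tendsto_iff_norm_sub_tendsto_zero]
  refine squeeze_zero (fun _ => norm_nonneg _) (fun N => ?_) hlim
  have e : ∫ x, w x * aN N x ∂μ - ∫ x, w x * a x ∂μ = ∫ x, w x * (aN N x - a x) ∂μ := by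
    have h1 : Integrable (fun x => w x * aN N x) μ := hw.integrable_mul (hN N)
    have h2 : Integrable (fun x => w x * a x) μ := hw.integrable_mul ha
    rw [← integral_sub h1 h2]
    simp only [mul_sub]
  rw [e, ← integral_mul_const]
  refine norm_integral_le_of_norm_le (hwB.mul_const _) (ae_of_all _ fun x => ?_)
  rw [norm_mul, Real.norm_eq_abs, Real.norm_eq_abs, mul_assoc]
  refine mul_le_mul_of_nonneg_left ((h N x).trans (le_of_eq (by ring))) (abs_nonneg _)

lemma MeasureTheory.MemLp.mul_continuous_compactSupport {f g : E n → ℝ}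
    {μ : Measure (E n)} [IsLocallyFiniteMeasure μ] (hf : Continuous f) (hg : Continuous g)
    (hs : HasCompactSupport f) : MemLp (fun x => f x * g x) 2 μ :=
  (hf.mul hg).memLp_of_hasCompactSupport hs.mul_right

/-- Integration by parts against `e^{-φ}`: if `∂ᵢ(e^{-φ} F) = -e^{-φ} G`, then `G` is the value at
`F` of the adjoint of `∂ᵢ`. -/
lemma integral_weakPartial_mul {κ : ℝ} (hκ : 0 < κ)
    (hφ : ∀ x, κ * ‖x‖ ^ 2 ≤ potential c Γ x) (w : sobolev c Γ) (i : Fin n) {F G : E n → ℝ}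
    (hF : Continuous F) (hFg : ExpGrowth F) (hG : Continuous G) (hGg : ExpGrowth G)
    (hQ : ContDiff ℝ ∞ (fun x => Real.exp (-potential c Γ x) * F x))
    (hd : ∀ x, fderiv ℝ (fun x => Real.exp (-potential c Γ x) * F x) x
      (EuclideanSpace.single i 1) = -(Real.exp (-potential c Γ x) * G x)) :
    ∫ x, weakPartial c Γ i w x * F x ∂weightedMeasure c Γ =
      ∫ x, (w : WeightedL2 c Γ) x * G x ∂weightedMeasure c Γ := by
  obtain ⟨χ, C, hC, hχ⟩ := exists_cutoff n
  have hχc : ∀ N, Continuous (χ N) := fun N => (hχ N).1.continuous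
  have hχd : ∀ N, Continuous (fun x => fderiv ℝ (χ N) x (EuclideanSpace.single i 1)) :=
    fun N => (test_deriv (hχ N).1 (hχ N).2.1 _).1
  have hdb : ∀ N x, |fderiv ℝ (χ N) x (EuclideanSpace.single i 1)| ≤ C / (N + 1) := fun N x => by
    refine ((fderiv ℝ (χ N) x).le_opNorm _).trans ?_
    simpa using (hχ N).2.2.2 x
  have hn : ∀ {f : E n → ℝ}, Continuous f → ExpGrowth f →
      MemLp (fun x => ‖x‖ * |f x|) 2 (weightedMeasure c Γ) := fun hf hg =>
    (ExpGrowth.norm_id.mul hg.abs).memLp (by fun_prop) hκ hφ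
  have h1 := tendsto_integral_mul_of_le (Lp.memLp (weakPartial c Γ i w)) (hFg.memLp hF hκ hφ)
    (hn hF hFg) (aN := fun N x => χ N x * F x)
    (fun N => MemLp.mul_continuous_compactSupport (hχc N) hF (hχ N).2.1)
    (fun N x => by
      have : χ N x * F x - F x = (χ N x - 1) * F x := by ring
      rw [this, abs_mul]
      exact (mul_le_mul_of_nonneg_right ((hχ N).2.2.1 x) (abs_nonneg _)).trans
        (le_of_eq (by ring)))
  -- The summand `C * |F x|` of the majorant accounts for the derivative falling on the cutoff.
  have h2 := tendsto_integral_mul_of_le (Lp.memLp (w : WeightedL2 c Γ)) (hGg.memLp hG hκ hφ)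
    (B := fun x => ‖x‖ * |G x| + C * |F x|)
    ((hn hG hGg).add (((hFg.memLp hF hκ hφ).abs).const_mul C))
    (aN := fun N x => χ N x * G x - fderiv ℝ (χ N) x (EuclideanSpace.single i 1) * F x)
    (fun N => (MemLp.mul_continuous_compactSupport (hχc N) hG (hχ N).2.1).sub
      (MemLp.mul_continuous_compactSupport (hχd N) hF (test_deriv (hχ N).1 (hχ N).2.1 _).2))
    (fun N x => by
      have : χ N x * G x - fderiv ℝ (χ N) x (EuclideanSpace.single i 1) * F x - G x =
        (χ N x - 1) * G x - fderiv ℝ (χ N) x (EuclideanSpace.single i 1) * F x := by ring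
      rw [this]
      refine (abs_sub _ _).trans ?_
      rw [abs_mul, abs_mul]
      refine (add_le_add (mul_le_mul_of_nonneg_right ((hχ N).2.2.1 x) (abs_nonneg _))
        (mul_le_mul_of_nonneg_right (hdb N x) (abs_nonneg _))).trans (le_of_eq (by ring)))
  refine tendsto_nhds_unique h1 (h2.congr fun N => ?_)
  -- The test function is χ_N e^{-φ} F; putting the weight inside it turns the Lebesgue pairing of
  -- the weak derivative into pairings in H.
  have hint := (weakPartial_spec c Γ i w).integral_eq
    (fun x => χ N x * (Real.exp (-potential c Γ x) * F x)) ((hχ N).1.mul hQ)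
    ((hχ N).2.1.mul_right)
  have hder : ∀ x, fderiv ℝ (fun x => χ N x * (Real.exp (-potential c Γ x) * F x)) x
      (EuclideanSpace.single i 1) = -((χ N x * G x - fderiv ℝ (χ N) x
        (EuclideanSpace.single i 1) * F x) * Real.exp (-potential c Γ x)) := fun x => by
    rw [fderiv_fun_mul ((hχ N).1.differentiable (by simp) x) (hQ.differentiable (by simp) x)]
    simp only [add_apply, smul_apply, smul_eq_mul, hd]
    ring
  simp only [hder, mul_neg, integral_neg, neg_inj] at hint
  rw [integral_weighted, integral_weighted]
  simp only [mul_assoc] at hint ⊢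
  rw [hint]
  simp only [mul_comm (F _)]

end IntegrationByParts

/-! ### Smooth functions without compact support -/

section SmoothSobolev

variable {n : ℕ} {c : ℝ} {Γ : Matrix (Fin n) (Fin n) ℝ}

lemma hasWeakPartial_of_contDiff {i : Fin n} {f : E n → ℝ} (hf : ContDiff ℝ ∞ f) :
    HasWeakPartial i f (fun x => fderiv ℝ f x (EuclideanSpace.single i 1)) where
  locInt := hf.continuous.locallyIntegrable
  locInt' := ((hf.continuous_fderiv (by simp)).clm_apply continuous_const).locallyIntegrable
  integral_eq χ hχ hχs := by
    have hd : Continuous (fun x => fderiv ℝ f x (EuclideanSpace.single i 1)) :=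
      (hf.continuous_fderiv (by simp)).clm_apply continuous_const
    obtain ⟨hd', hds'⟩ := test_deriv hχ hχs (EuclideanSpace.single i 1)
    exact integral_mul_fderiv_eq_neg_fderiv_mul_of_integrable
      (test_integrable hd.locallyIntegrable hχ.continuous hχs)
      (test_integrable hf.continuous.locallyIntegrable hd' hds')
      (test_integrable hf.continuous.locallyIntegrable hχ.continuous hχs)
      (fun x _ => hf.differentiable (by simp) x) (fun x _ => hχ.differentiable (by simp) x)

lemma OUForm.HasWeakPartial.toLp {i : Fin n} {f g : E n → ℝ} (h : HasWeakPartial i f g)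
    (hf : MemLp f 2 (weightedMeasure c Γ)) (hg : MemLp g 2 (weightedMeasure c Γ)) :
    HasWeakPartial i (hf.toLp f) (hg.toLp g) :=
  h.congr ((volume_ac c Γ).ae_eq hf.coeFn_toLp.symm) ((volume_ac c Γ).ae_eq hg.coeFn_toLp.symm)

lemma weakPartial_eq {i : Fin n} {w : sobolev c Γ} {g : WeightedL2 c Γ}
    (h : HasWeakPartial i (w : WeightedL2 c Γ) g) : weakPartial c Γ i w = g :=
  weakPartial_choose_eq w h

end SmoothSobolev

/-- Expand e^{iX} in its power series and integrate termwise; the partial sums are dominated by |f|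
e^{|X|}, a product of two L² functions. -/
lemma integral_mul_cexp_eq_zero_of_moments {Ω : Type*} [MeasurableSpace Ω] {μ : Measure Ω}
    {f X : Ω → ℝ} (hf : MemLp f 2 μ) (hX : AEStronglyMeasurable X μ)
    (he : MemLp (fun x => Real.exp |X x|) 2 μ) (h0 : ∀ j : ℕ, ∫ x, f x * X x ^ j ∂μ = 0) :
    ∫ x, (f x : ℂ) * Complex.exp (X x * Complex.I) ∂μ = 0 := by
  have hsum : ∀ x, HasSum (fun j : ℕ => |f x| * (|X x| ^ j / j.factorial))
      (|f x| * Real.exp |X x|) := fun x => by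
    have hx := NormedSpace.expSeries_div_hasSum_exp |X x|
    rw [← Real.exp_eq_exp_ℝ] at hx
    exact hx.mul_left _
  have hm : ∀ j : ℕ, AEStronglyMeasurable
      (fun x => (f x : ℂ) * ((X x * Complex.I) ^ j / j.factorial)) μ := fun j => by
    have h1 : AEStronglyMeasurable (fun x => (f x : ℂ)) μ :=
      Complex.continuous_ofReal.comp_aestronglyMeasurable hf.1
    have h2 : Continuous (fun y : ℝ => ((y : ℂ) * Complex.I) ^ j / j.factorial) := by fun_prop
    exact h1.mul (h2.comp_aestronglyMeasurable hX)
  have hb : ∀ (j : ℕ) x, ‖(f x : ℂ) * ((X x * Complex.I) ^ j / j.factorial)‖ ≤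
      |f x| * (|X x| ^ j / j.factorial) := fun j x => by
    rw [norm_mul, norm_div, norm_pow, norm_mul]
    simp
  have hi : Integrable (fun x => ∑' j : ℕ, |f x| * (|X x| ^ j / j.factorial)) μ := by
    simp_rw [fun x => (hsum x).tsum_eq]
    exact hf.abs.integrable_mul he
  have hl : ∀ x, HasSum (fun j : ℕ => (f x : ℂ) * ((X x * Complex.I) ^ j / j.factorial))
      ((f x : ℂ) * Complex.exp (X x * Complex.I)) := fun x => by
    have hx := NormedSpace.expSeries_div_hasSum_exp (X x * Complex.I)
    rw [← Complex.exp_eq_exp_ℂ] at hx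
    exact hx.mul_left _
  have hs := hasSum_integral_of_dominated_convergence _ hm (fun j => ae_of_all _ (hb j))
    (ae_of_all _ fun x => (hsum x).summable) hi (ae_of_all _ hl)
  have hz : (fun j : ℕ => ∫ x, (f x : ℂ) * ((X x * Complex.I) ^ j / j.factorial) ∂μ) =
      fun _ => 0 := by
    funext j
    have e : ∀ x, (f x : ℂ) * ((X x * Complex.I) ^ j / j.factorial) =
        (Complex.I ^ j / j.factorial) * ((f x * X x ^ j : ℝ) : ℂ) := fun x => by
      push_cast
      ring
    simp_rw [e]
    rw [integral_const_mul, integral_complex_ofReal, h0]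
    simp
  rw [hz] at hs
  exact hs.unique hasSum_zero

/-- An orthonormal eigenbasis `v` of `Γ / c` with eigenvalues `l`, rescaled to `u`, so that
`φ(x) = ∑ₖ ⟨uₖ, x⟩²`. -/
structure EigenData {n : ℕ} (c : ℝ) (Γ : Matrix (Fin n) (Fin n) ℝ)
    (v : OrthonormalBasis (Fin n) ℝ (E n)) (l : Fin n → ℝ) (u : Fin n → E n) : Prop where
  pos : ∀ k, 0 < l k
  u_eq : ∀ k, u k = √(l k / 2) • v k
  potential_eq : ∀ x, potential c Γ x = ∑ k, inner ℝ (u k) x ^ 2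

/-! ### Hermite products in H: eigenvalue equation and orthogonality -/

namespace EigenData

variable {n : ℕ} {c : ℝ} {Γ : Matrix (Fin n) (Fin n) ℝ} {v : OrthonormalBasis (Fin n) ℝ (E n)}
  {l : Fin n → ℝ} {u : Fin n → E n} (h : EigenData c Γ v l u)

include h

lemma lower_bound : ∃ κ > 0, ∀ x, κ * ‖x‖ ^ 2 ≤ potential c Γ x :=
  potential_lower_bound h.u_eq h.pos h.potential_eq

lemma memLp_of_expGrowth {f : E n → ℝ} (hf : ExpGrowth f) (hm : Continuous f) :
    MemLp f 2 (weightedMeasure c Γ) := by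
  obtain ⟨κ, hκ, hφ⟩ := h.lower_bound
  exact hf.memLp hm hκ hφ

lemma memLp (α : Fin n → ℕ) : MemLp (hermiteProd u α) 2 (weightedMeasure c Γ) :=
  h.memLp_of_expGrowth (expGrowth_hermiteProd u α) (contDiff_hermiteProd u α).continuous

/-- `H_α` as an element of `H`. -/
noncomputable def hermiteLp (α : Fin n → ℕ) : WeightedL2 c Γ := (h.memLp α).toLp

/-- Stated in coordinates, since this is how the sums over partial derivatives contract. -/
lemma inner_u (j k : Fin n) : ∑ i, (u j) i * (u k) i = if j = k then l k / 2 else 0 := by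
  have e : ∑ i, (u j) i * (u k) i = inner ℝ (u j) (u k) := by
    simp [PiLp.inner_apply, mul_comm]
  rw [e, h.u_eq, h.u_eq, real_inner_smul_left, real_inner_smul_right,
    orthonormal_iff_ite.1 v.orthonormal]
  split_ifs with hjk
  · subst hjk
    have := h.pos j
    rw [mul_one, Real.mul_self_sqrt (by positivity)]
  · simp

lemma hasWeakPartial_hermiteLp (i : Fin n) (α : Fin n → ℕ) :
    HasWeakPartial i (h.hermiteLp α) (∑ k, (2 * α k * (u k) i) •
      h.hermiteLp (Function.update α k (α k - 1)) : WeightedL2 c Γ) := by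
  have h1 := hasWeakPartial_of_contDiff (i := i) (contDiff_hermiteProd u α)
  refine h1.congr ((volume_ac c Γ).ae_eq (h.memLp α).coeFn_toLp.symm)
    ((volume_ac c Γ).ae_eq ?_)
  have h2 : ∀ᵐ x ∂weightedMeasure c Γ, ∀ k,
      ((2 * α k * (u k) i) • h.hermiteLp (Function.update α k (α k - 1)) : WeightedL2 c Γ) x =
        (2 * α k * (u k) i) * hermiteProd u (Function.update α k (α k - 1)) x := by
    rw [ae_all_iff]
    intro k
    filter_upwards [Lp.coeFn_smul (2 * α k * (u k) i)
      (h.hermiteLp (Function.update α k (α k - 1))), (h.memLp _).coeFn_toLp] with x h3 h4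
    rw [h3, Pi.smul_apply, smul_eq_mul, hermiteLp, h4]
  filter_upwards [h2, Lp.coeFn_finsetSum Finset.univ
    (fun k => (2 * α k * (u k) i) • h.hermiteLp (Function.update α k (α k - 1)))] with x h3 h4
  rw [h4, (hasFDerivAt_hermiteProd u α x).fderiv]
  simp only [Finset.sum_apply, sum_apply, smul_apply, smul_eq_mul, h3, innerSL_apply_apply]
  refine Finset.sum_congr rfl fun k _ => ?_
  rw [EuclideanSpace.inner_single_right]
  simp
  ring

lemma hermiteLp_mem (α : Fin n → ℕ) : h.hermiteLp α ∈ sobolev c Γ :=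
  fun i => ⟨_, h.hasWeakPartial_hermiteLp i α⟩

lemma weakPartial_hermiteLp (i : Fin n) (α : Fin n → ℕ) :
    weakPartial c Γ i ⟨h.hermiteLp α, h.hermiteLp_mem α⟩ =
      ∑ k, (2 * α k * (u k) i) • h.hermiteLp (Function.update α k (α k - 1)) :=
  weakPartial_eq (h.hasWeakPartial_hermiteLp i α)

/-- This is the adjoint of ∂ᵢ on Hermite products: integration by parts against e^{-φ} H_β raises
each index in turn. -/
lemma inner_weakPartial (i : Fin n) (w : sobolev c Γ) (β : Fin n → ℕ) :
    inner ℝ (weakPartial c Γ i w) (h.hermiteLp β) =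
      ∑ j, (u j) i * inner ℝ (w : WeightedL2 c Γ)
        (h.hermiteLp (Function.update β j (β j + 1))) := by
  obtain ⟨κ, hκ, hφ⟩ := h.lower_bound
  have hQ : ContDiff ℝ ∞ (fun x => Real.exp (-potential c Γ x) * hermiteProd u β x) := by
    simp_rw [exp_potential_mul_hermiteProd h.potential_eq]
    refine contDiff_prod fun k _ => ?_
    have hi : ContDiff ℝ ∞ (fun x : E n => inner ℝ (u k) x) := contDiff_const.inner ℝ contDiff_id
    exact (hi.pow 2).neg.exp.mul ((contDiff_hermiteFun _).comp hi)
  have hc : ∀ α, Continuous (hermiteProd u α) := fun α => (contDiff_hermiteProd u α).continuous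
  have hm : ∀ j, Integrable (fun x => (w : WeightedL2 c Γ) x * ((u j) i *
      hermiteProd u (Function.update β j (β j + 1)) x)) (weightedMeasure c Γ) := fun j =>
    (Lp.memLp (w : WeightedL2 c Γ)).integrable_mul ((h.memLp _).const_mul _)
  have hkey := integral_weakPartial_mul hκ hφ w i (F := hermiteProd u β)
    (G := fun x => ∑ j, (u j) i * hermiteProd u (Function.update β j (β j + 1)) x)
    (hc β) (expGrowth_hermiteProd u β) (continuous_finsetSum _ fun j _ => (hc _).const_mul _)
    (ExpGrowth.sum _ fun j _ => (expGrowth_hermiteProd u _).const_mul _) hQ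
    (fun x => by
      rw [(hasFDerivAt_exp_mul_hermiteProd h.potential_eq β x).fderiv]
      simp only [neg_apply, sum_apply, smul_apply, smul_eq_mul, innerSL_apply_apply,
        EuclideanSpace.inner_single_right]
      congr 2
      exact Finset.sum_congr rfl fun j _ => by simp [mul_comm])
  simp only [hermiteLp, inner_toLp_right]
  rw [hkey]
  simp only [Finset.mul_sum]
  rw [integral_finsetSum _ fun j _ => hm j]
  refine Finset.sum_congr rfl fun j _ => ?_
  rw [← integral_const_mul]
  exact integral_congr_ae (ae_of_all _ fun x => by ring)

/-- The derivative along `u k` raises only the index k, since the `u j` are orthogonal. -/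
lemma sum_inner_weakPartial (k : Fin n) (w : sobolev c Γ) (β : Fin n → ℕ) :
    ∑ i, (u k) i * inner ℝ (weakPartial c Γ i w) (h.hermiteLp β) =
      l k / 2 * inner ℝ (w : WeightedL2 c Γ) (h.hermiteLp (Function.update β k (β k + 1))) := by
  simp_rw [h.inner_weakPartial, Finset.mul_sum]
  rw [Finset.sum_comm]
  simp_rw [← mul_assoc, ← Finset.sum_mul, h.inner_u]
  simp only [ite_mul, zero_mul]
  rw [Finset.sum_ite_eq]
  simp

/-- For each k, lowering contributes `2 * α k` and raising back contributes `l k / 2`; the product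
is the k-th summand of λ_α. -/
lemma form_hermiteLp (α : Fin n → ℕ) (w : sobolev c Γ) :
    form c Γ ⟨h.hermiteLp α, h.hermiteLp_mem α⟩ w =
      eigenvalue l α * inner ℝ (h.hermiteLp α) (w : WeightedL2 c Γ) := by
  have e1 : form c Γ ⟨h.hermiteLp α, h.hermiteLp_mem α⟩ w =
      ∑ k, 2 * α k * ∑ i, (u k) i * inner ℝ (weakPartial c Γ i w)
        (h.hermiteLp (Function.update α k (α k - 1))) := by
    simp only [form, weakPartial_hermiteLp, sum_inner, real_inner_smul_left, Finset.mul_sum]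
    rw [Finset.sum_comm]
    refine Finset.sum_congr rfl fun k _ => Finset.sum_congr rfl fun i _ => ?_
    rw [real_inner_comm]
    ring
  rw [e1, eigenvalue, Finset.sum_mul]
  refine Finset.sum_congr rfl fun k _ => ?_
  rw [h.sum_inner_weakPartial]
  -- When `α k = 0`, truncated lowering followed by raising does not return to α, but the
  -- coefficient is zero.
  rcases Nat.eq_zero_or_pos (α k) with h0 | h0
  · simp [h0]
  · have : Function.update (Function.update α k (α k - 1)) k
        (Function.update α k (α k - 1) k + 1) = α := by
      simp [Nat.sub_add_cancel h0]
    rw [this, real_inner_comm]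
    ring

/-- Raising the k-th index is adjoint to lowering it, up to the factor `2 * γ k`. Obtained by
computing ⟨∂_{u_k} H_γ, H_β⟩ in two ways and cancelling `l k / 2`. -/
lemma inner_hermiteLp_succ (γ β : Fin n → ℕ) (k : Fin n) :
    inner ℝ (h.hermiteLp γ) (h.hermiteLp (Function.update β k (β k + 1))) =
      2 * γ k * inner ℝ (h.hermiteLp (Function.update γ k (γ k - 1))) (h.hermiteLp β) := by
  have e := h.sum_inner_weakPartial k ⟨h.hermiteLp γ, h.hermiteLp_mem γ⟩ β
  simp only [weakPartial_hermiteLp, sum_inner, real_inner_smul_left, Finset.mul_sum] at e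
  rw [Finset.sum_comm] at e
  have e2 : ∀ j, ∑ i, (u k) i * (2 * γ j * (u j) i * inner ℝ
      (h.hermiteLp (Function.update γ j (γ j - 1))) (h.hermiteLp β)) =
      (∑ i, (u k) i * (u j) i) * (2 * γ j * inner ℝ
      (h.hermiteLp (Function.update γ j (γ j - 1))) (h.hermiteLp β)) := fun j => by
    rw [Finset.sum_mul]
    exact Finset.sum_congr rfl fun i _ => by ring
  simp only [e2, h.inner_u, ite_mul, zero_mul, Finset.sum_ite_eq, Finset.mem_univ, if_true] at e
  exact (mul_left_cancel₀ (half_pos (h.pos k)).ne' e).symm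

/-- Symmetry of A alone would not suffice, as different multi-indices may share an eigenvalue.
Instead, at an index k where γ and δ differ, lower both sides: with X = ⟨H_{γ-e_k}, H_{δ-e_k}⟩ the
inner product equals both 2γ_k X and 2δ_k X, so X = 0. -/
lemma inner_hermiteLp_of_ne {γ δ : Fin n → ℕ} (hne : γ ≠ δ) :
    inner ℝ (h.hermiteLp γ) (h.hermiteLp δ) = 0 := by
  obtain ⟨k, hk⟩ := Function.ne_iff.1 hne
  have key : ∀ {γ δ : Fin n → ℕ}, 0 < δ k →
      inner ℝ (h.hermiteLp γ) (h.hermiteLp δ) = 2 * γ k * inner ℝ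
        (h.hermiteLp (Function.update γ k (γ k - 1)))
        (h.hermiteLp (Function.update δ k (δ k - 1))) := fun {γ δ} hpos => by
    rw [← h.inner_hermiteLp_succ]
    simp [Nat.sub_add_cancel hpos]
  rcases Nat.eq_zero_or_pos (δ k) with h0 | h0
  · rw [real_inner_comm, key (by omega), h0]
    simp
  · rcases Nat.eq_zero_or_pos (γ k) with h1 | h1
    · rw [key h0, h1]
      simp
    · have a := key (γ := γ) h0
      have b := key (γ := δ) h1
      rw [real_inner_comm, real_inner_comm (h.hermiteLp (Function.update γ k (γ k - 1)))] at b
      have hd : (γ k : ℝ) - δ k ≠ 0 := sub_ne_zero.2 (by exact_mod_cast hk)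
      have : ((γ k : ℝ) - δ k) * inner ℝ (h.hermiteLp (Function.update γ k (γ k - 1)))
        (h.hermiteLp (Function.update δ k (δ k - 1))) = 0 := by linarith
      rw [a, (mul_eq_zero.1 this).resolve_left hd, mul_zero]

/-- Induction on |α|: if α = β + e_k, adjointness gives ‖H_α‖² = 2α_k ‖H_β‖². The base case is the
constant function 1. -/
lemma hermiteLp_ne_zero (α : Fin n → ℕ) : h.hermiteLp α ≠ 0 := by
  induction hm : ∑ k, α k generalizing α with
  | zero =>
    have h0 : α = 0 := by
      funext k
      exact Finset.sum_eq_zero_iff.1 hm k (Finset.mem_univ k)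
    intro h1
    have h2 := (volume_ac c Γ).ae_eq ((h.memLp α).coeFn_toLp.symm.trans
      ((Lp.eq_zero_iff_ae_eq_zero).1 h1))
    obtain ⟨x, hx⟩ := h2.exists
    rw [h0, hermiteProd_zero] at hx
    simp at hx
  | succ m ih =>
    obtain ⟨k, -, hk⟩ := Finset.exists_ne_zero_of_sum_ne_zero (hm.trans_ne m.succ_ne_zero)
    set β := Function.update α k (α k - 1) with hβ
    have hαβ : α = Function.update β k (β k + 1) := by
      simp [hβ, Nat.sub_add_cancel (Nat.pos_of_ne_zero hk)]
    have hs : ∑ j, β j = m := by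
      rw [hβ, Finset.sum_update_of_mem (Finset.mem_univ k)]
      rw [← Finset.add_sum_erase _ _ (Finset.mem_univ k)] at hm
      rw [← Finset.erase_eq]
      have := Nat.pos_of_ne_zero hk
      omega
    have hne := ih β hs
    intro h0
    have e := h.inner_hermiteLp_succ α β k
    rw [← hαβ, h0, inner_zero_left, ← hβ, real_inner_self_eq_norm_sq] at e
    have : (0 : ℝ) < α k := by exact_mod_cast Nat.pos_of_ne_zero hk
    have := norm_pos_iff.2 hne
    have : 0 < 2 * (α k : ℝ) * ‖h.hermiteLp β‖ ^ 2 := by positivity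
    linarith

/-! ### Completeness of the Hermite functions -/

/-- Any linear form is a combination of the ⟨`u k`, x⟩, and multiplication by each of these
preserves the span by the three-term recurrence. -/
lemma inner_pow_mem_span (t : E n) (j : ℕ) :
    (fun x : E n => inner ℝ t x ^ j) ∈ Submodule.span ℝ (Set.range (hermiteProd u)) := by
  have ht : ∀ x, inner ℝ t x = ∑ k, (inner ℝ (v k) t / √(l k / 2)) * inner ℝ (u k) x := by
    intro x
    conv_lhs => rw [← v.sum_repr' t]
    rw [sum_inner]
    refine Finset.sum_congr rfl fun k _ => ?_
    have : 0 < √(l k / 2) := Real.sqrt_pos.2 (half_pos (h.pos k))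
    rw [h.u_eq, real_inner_smul_left, real_inner_smul_left]
    field_simp
  have hu : ∀ k, ∀ g ∈ Submodule.span ℝ (Set.range (hermiteProd u)),
      (fun x => inner ℝ (u k) x * g x) ∈ Submodule.span ℝ (Set.range (hermiteProd u)) := by
    intro k g hg
    induction hg using Submodule.span_induction with
    | mem g hg =>
      obtain ⟨α, rfl⟩ := hg
      have e : (fun x => inner ℝ (u k) x * hermiteProd u α x) =
          (1 / 2 : ℝ) • hermiteProd u (Function.update α k (α k + 1)) +
            (α k : ℝ) • hermiteProd u (Function.update α k (α k - 1)) := by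
        funext x
        simpa using inner_mul_hermiteProd u α k x
      rw [e]
      exact add_mem (Submodule.smul_mem _ _ (Submodule.subset_span ⟨_, rfl⟩))
        (Submodule.smul_mem _ _ (Submodule.subset_span ⟨_, rfl⟩))
    | zero =>
      simp only [Pi.zero_apply, mul_zero]
      exact Submodule.zero_mem _
    | add g g' _ _ h1 h2 => simpa [mul_add] using! add_mem h1 h2
    | smul a g _ h1 => simpa [mul_left_comm] using! Submodule.smul_mem _ a h1
  induction j with
  | zero =>
    refine Submodule.subset_span ⟨0, ?_⟩
    funext x
    simp [hermiteProd_zero]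
  | succ j ih =>
    have e : (fun x : E n => inner ℝ t x ^ (j + 1)) = ∑ k, (inner ℝ (v k) t / √(l k / 2)) •
        (fun x => inner ℝ (u k) x * (fun x : E n => inner ℝ t x ^ j) x) := by
      funext x
      rw [pow_succ', Finset.sum_apply]
      nth_rewrite 1 [ht x]
      rw [Finset.sum_mul]
      exact Finset.sum_congr rfl fun k _ => by simp [mul_assoc]
    rw [e]
    exact Submodule.sum_mem _ fun k _ => Submodule.smul_mem _ _ (hu k _ ih)

lemma integral_mul_pow_eq_zero {f : WeightedL2 c Γ}
    (hf : ∀ α, inner ℝ f (h.hermiteLp α) = 0) (t : E n) (j : ℕ) :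
    ∫ x, f x * inner ℝ t x ^ j ∂weightedMeasure c Γ = 0 := by
  have key : ∀ g ∈ Submodule.span ℝ (Set.range (hermiteProd u)),
      MemLp g 2 (weightedMeasure c Γ) ∧ ∫ x, f x * g x ∂weightedMeasure c Γ = 0 := by
    intro g hg
    induction hg using Submodule.span_induction with
    | mem g hg =>
      obtain ⟨α, rfl⟩ := hg
      refine ⟨h.memLp α, ?_⟩
      rw [← inner_toLp_right f (h.memLp α)]
      exact hf α
    | zero => exact ⟨MemLp.zero, by simp⟩
    | add g g' _ _ h1 h2 =>
      refine ⟨h1.1.add h2.1, ?_⟩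
      have i1 : Integrable (fun x => f x * g x) (weightedMeasure c Γ) :=
        (Lp.memLp f).integrable_mul h1.1
      have i2 : Integrable (fun x => f x * g' x) (weightedMeasure c Γ) :=
        (Lp.memLp f).integrable_mul h2.1
      simp only [Pi.add_apply, mul_add]
      rw [integral_add i1 i2, h1.2, h2.2, add_zero]
    | smul a g _ h1 =>
      refine ⟨h1.1.const_smul a, ?_⟩
      simp only [Pi.smul_apply, smul_eq_mul, mul_left_comm _ a]
      rw [integral_const_mul, h1.2, mul_zero]
  exact (key _ (h.inner_pow_mem_span t j)).2

lemma integral_mul_cexp_eq_zero {f : WeightedL2 c Γ}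
    (hf : ∀ α, inner ℝ f (h.hermiteLp α) = 0) (t : E n) :
    ∫ x, (f x : ℂ) * Complex.exp (inner ℝ x t * Complex.I) ∂weightedMeasure c Γ = 0 := by
  have hexp : ExpGrowth (fun x : E n => Real.exp |inner ℝ t x|) :=
    ⟨1, ‖t‖, zero_le_one, norm_nonneg t, fun x => by
      rw [abs_of_pos (Real.exp_pos _), one_mul]
      exact Real.exp_le_exp.2 (abs_real_inner_le_norm t x)⟩
  have hmexp : MemLp (fun x : E n => Real.exp |inner ℝ t x|) 2 (weightedMeasure c Γ) :=
    h.memLp_of_expGrowth hexp (by fun_prop)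
  have := integral_mul_cexp_eq_zero_of_moments (X := fun x : E n => inner ℝ t x) (Lp.memLp f)
    (by fun_prop) hmexp (h.integral_mul_pow_eq_zero hf t)
  simpa only [real_inner_comm] using this

/-- The positive and negative parts of f, as densities for the weighted measure, define finite
measures with the same characteristic function. So they coincide, and f vanishes almost everywhere.
-/
theorem eq_zero_of_inner_hermiteLp {f : WeightedL2 c Γ}
    (hf : ∀ α, inner ℝ f (h.hermiteLp α) = 0) : f = 0 := by
  have hfin : IsFiniteMeasure (weightedMeasure c Γ) := by
    obtain ⟨κ, hκ, hφ⟩ := h.lower_bound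
    have := (ExpGrowth.const (X := E n) 1).integrable continuous_const hκ hφ
    rwa [integrable_const_iff_isFiniteMeasure one_ne_zero] at this
  have hfi : Integrable f (weightedMeasure c Γ) := (Lp.memLp f).integrable (by norm_num)
  have hm : AEMeasurable (fun x => f x) (weightedMeasure c Γ) := (Lp.aestronglyMeasurable f).aemeasurable
  have hm' : AEMeasurable (fun x => -f x) (weightedMeasure c Γ) := hm.neg
  have hfi' : Integrable (fun x => -f x) (weightedMeasure c Γ) := hfi.neg
  have := isFiniteMeasure_withDensity_ofReal hfi.2
  have := isFiniteMeasure_withDensity_ofReal hfi'.2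
  have hE : ∀ t : E n, Continuous (fun x : E n => Complex.exp (inner ℝ x t * Complex.I)) :=
    fun t => by fun_prop
  have key : (weightedMeasure c Γ).withDensity (fun x => ENNReal.ofReal (f x)) =
      (weightedMeasure c Γ).withDensity (fun x => ENNReal.ofReal (-f x)) := by
    refine Measure.ext_of_charFun ?_
    funext t
    have hb : ∀ x : E n, ‖Complex.exp (inner ℝ x t * Complex.I)‖ ≤ 1 := fun x => by
      rw [Complex.norm_exp_ofReal_mul_I]
    have hI : ∀ {g : E n → ℝ}, Integrable g (weightedMeasure c Γ) → Integrable (fun x =>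
        (g x).toNNReal • Complex.exp (inner ℝ x t * Complex.I)) (weightedMeasure c Γ) := by
      intro g hg
      refine (hg.real_toNNReal.ofReal (𝕜 := ℂ)).mul_bdd (c := 1)
        (hE t).aestronglyMeasurable (ae_of_all _ hb)
    simp only [charFun_apply]
    have hw : ∀ {g : E n → ℝ}, AEMeasurable g (weightedMeasure c Γ) →
        ∫ x, Complex.exp (inner ℝ x t * Complex.I)
          ∂(weightedMeasure c Γ).withDensity (fun x => ENNReal.ofReal (g x)) =
        ∫ x, (g x).toNNReal • Complex.exp (inner ℝ x t * Complex.I) ∂weightedMeasure c Γ :=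
      fun hg => integral_withDensity_eq_integral_smul₀ hg.real_toNNReal _
    rw [hw hm, hw hm', ← sub_eq_zero, ← integral_sub (hI hfi) (hI hfi'),
      ← h.integral_mul_cexp_eq_zero hf t]
    refine integral_congr_ae (ae_of_all _ fun x => ?_)
    simp only [NNReal.smul_def, Real.coe_toNNReal', Complex.real_smul]
    rcases le_total 0 (f x) with h0 | h0 <;> simp [h0]
  have hae := (withDensity_eq_iff hm.ennreal_ofReal hm'.ennreal_ofReal ?_).1 key
  · refine (Lp.eq_zero_iff_ae_eq_zero).2 ?_
    filter_upwards [hae] with x hx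
    rcases le_total 0 (f x) with h0 | h0
    · have : ENNReal.ofReal (-f x) = 0 := ENNReal.ofReal_of_nonpos (by linarith)
      rw [this, ENNReal.ofReal_eq_zero] at hx
      exact le_antisymm hx h0
    · have : ENNReal.ofReal (f x) = 0 := ENNReal.ofReal_of_nonpos h0
      rw [this, eq_comm, ENNReal.ofReal_eq_zero] at hx
      exact le_antisymm h0 (by simpa using hx)
  · have := measure_lt_top ((weightedMeasure c Γ).withDensity fun x => ENNReal.ofReal (f x))
      Set.univ
    rw [withDensity_apply _ MeasurableSet.univ, Measure.restrict_univ] at this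
    exact this.ne

end EigenData

/-! ### The graph of the gradient -/

section Graph

variable {n : ℕ} (c : ℝ) (Γ : Matrix (Fin n) (Fin n) ℝ)

/-- The space `H × Hⁿ` in which `V` embeds through `w ↦ (w, ∇w)`. -/
abbrev GraphSpace := PiLp 2 (fun _ : Option (Fin n) => WeightedL2 c Γ)

/-- The embedding `w ↦ (w, ∇w)` of `V`. -/
noncomputable def graphMap : sobolev c Γ →ₗ[ℝ] GraphSpace c Γ where
  toFun w := WithLp.toLp 2 fun o => o.elim (w : WeightedL2 c Γ) fun i => weakPartial c Γ i w
  map_add' w z := by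
    ext1 o
    cases o <;> simp
  map_smul' a w := by
    ext1 o
    cases o <;> simp

variable {c Γ}

@[simp] lemma graphMap_none (w : sobolev c Γ) : graphMap c Γ w none = (w : WeightedL2 c Γ) := rfl

@[simp] lemma graphMap_some (w : sobolev c Γ) (i : Fin n) :
    graphMap c Γ w (some i) = weakPartial c Γ i w := rfl

lemma inner_graphMap (w z : sobolev c Γ) : inner ℝ (graphMap c Γ w) (graphMap c Γ z) =
    inner ℝ (w : WeightedL2 c Γ) (z : WeightedL2 c Γ) + form c Γ w z := by
  simp [PiLp.inner_apply, Fintype.sum_option, form]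

lemma form_comm (w z : sobolev c Γ) : form c Γ w z = form c Γ z w :=
  Finset.sum_congr rfl fun _ _ => real_inner_comm _ _

/-- The factor e^φ undoes the weight. Thus Lebesgue pairings with test functions are continuous
functionals on H, which makes the weak-derivative relation closed. -/
lemma integral_mul_test_eq_inner (f : WeightedL2 c Γ) {g : E n → ℝ} (hg : Continuous g)
    (hs : HasCompactSupport g) :
    ∫ x, f x * g x = inner ℝ f ((test_memLp c Γ ((continuous_potential c Γ).rexp.mul hg)
      hs.mul_left).toLp (fun x => Real.exp (potential c Γ x) * g x)) := by
  rw [inner_toLp_right, integral_weighted]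
  refine integral_congr_ae (ae_of_all _ fun x => ?_)
  have : Real.exp (potential c Γ x) * Real.exp (-potential c Γ x) = 1 := by
    simp [← Real.exp_add]
  linear_combination -(f x * g x) * this

lemma mem_range_graphMap_iff {x : GraphSpace c Γ} :
    x ∈ LinearMap.range (graphMap c Γ) ↔ ∀ i (ψ : E n → ℝ), ContDiff ℝ ∞ ψ →
      HasCompactSupport ψ → ∫ y, x none y * fderiv ℝ ψ y (EuclideanSpace.single i 1) =
        -∫ y, x (some i) y * ψ y := by
  constructor
  · rintro ⟨w, rfl⟩ i
    exact (weakPartial_spec c Γ i w).integral_eq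
  · intro hx
    have hw : ∀ i, HasWeakPartial i (x none) (x (some i)) := fun i =>
      ⟨locallyIntegrable_weightedL2 _, locallyIntegrable_weightedL2 _, hx i⟩
    refine ⟨⟨x none, fun i => ⟨_, hw i⟩⟩, ?_⟩
    ext1 o
    cases o with
    | none => rfl
    | some i => exact weakPartial_eq (hw i)

/-- The range is cut out by equations between continuous functionals, one for each coordinate and
test function. Hence V is complete in the graph norm. -/
lemma isClosed_range_graphMap :
    IsClosed (LinearMap.range (graphMap c Γ) : Set (GraphSpace c Γ)) := by
  have : (LinearMap.range (graphMap c Γ) : Set (GraphSpace c Γ)) =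
      {x | ∀ i (ψ : E n → ℝ), ContDiff ℝ ∞ ψ →
      HasCompactSupport ψ → ∫ y, x none y * fderiv ℝ ψ y (EuclideanSpace.single i 1) =
        -∫ y, x (some i) y * ψ y} := Set.ext fun x => mem_range_graphMap_iff
  rw [this]
  simp only [Set.ofPred_forall]
  refine isClosed_iInter fun i => isClosed_iInter fun ψ => isClosed_iInter fun hψ =>
    isClosed_iInter fun hs => ?_
  obtain ⟨hd, hds⟩ := test_deriv hψ hs (EuclideanSpace.single i 1)
  simp only [integral_mul_test_eq_inner _ hd hds,
    integral_mul_test_eq_inner _ hψ.continuous hs]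
  have hc : ∀ o, Continuous (fun x : GraphSpace c Γ => x o) := fun o =>
    PiLp.continuous_apply 2 _ o
  exact isClosed_eq ((hc _).inner continuous_const) ((hc _).inner continuous_const).neg

instance : CompleteSpace (LinearMap.range (graphMap c Γ)) :=
  isClosed_range_graphMap.completeSpace_coe

/-- The operator `1 + A` is onto. -/
lemma exists_formOperator_eq_sub (y : WeightedL2 c Γ) :
    ∃ w : (formOperator c Γ).domain, formOperator c Γ w = y - w := by
  -- Riesz representation by projection: if (w, ∇w) is the projection of (y, 0) onto the graph, then
  -- ⟨w, z⟩ + a(w, z) = ⟨y, z⟩ for all z in V.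
  let Y : GraphSpace c Γ := WithLp.toLp 2 fun o => o.elim y fun _ => 0
  obtain ⟨w, hw⟩ : (LinearMap.range (graphMap c Γ)).starProjection Y ∈
    LinearMap.range (graphMap c Γ) := Submodule.starProjection_apply_mem _ _
  have hform : ∀ z : sobolev c Γ, form c Γ w z =
      inner ℝ (y - (w : WeightedL2 c Γ)) (z : WeightedL2 c Γ) := fun z => by
    have h1 := Submodule.sub_starProjection_mem_orthogonal (K := LinearMap.range (graphMap c Γ)) Y
    rw [← hw] at h1
    have h2 := (Submodule.mem_orthogonal' _ _).1 h1 _ ⟨z, rfl⟩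
    rw [inner_sub_left, inner_graphMap] at h2
    have h3 : inner ℝ Y (graphMap c Γ z) = inner ℝ y (z : WeightedL2 c Γ) := by
      simp [PiLp.inner_apply, Fintype.sum_option, Y]
    rw [h3] at h2
    rw [inner_sub_left]
    linarith
  have hdom : (w : WeightedL2 c Γ) ∈ (formOperator c Γ).domain := ⟨w.2, _, hform⟩
  refine ⟨⟨w, hdom⟩, eq_of_inner_eq c Γ fun z => ?_⟩
  rw [← formOperator_spec]
  exact hform z

variable (c Γ) in
/-- The graph of the gradient on test functions. -/
noncomputable def testGraph : Submodule ℝ (GraphSpace c Γ) where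
  carrier := {x | ∃ (ψ : E n → ℝ) (hψ : ContDiff ℝ ∞ ψ) (hs : HasCompactSupport ψ),
    x = graphMap c Γ ⟨_, test_mem_sobolev c Γ hψ hs⟩}
  zero_mem' := ⟨0, contDiff_const, HasCompactSupport.zero, by
    rw [← map_zero (graphMap c Γ)]
    congr 1⟩
  add_mem' := by
    rintro _ _ ⟨ψ, hψ, hs, rfl⟩ ⟨χ, hχ, ht, rfl⟩
    refine ⟨ψ + χ, hψ.add hχ, hs.add ht, ?_⟩
    rw [← map_add]
    congr 1
  smul_mem' := by
    rintro a _ ⟨ψ, hψ, hs, rfl⟩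
    refine ⟨a • ψ, hψ.const_smul a, hs.smul_left (f := fun _ => a), ?_⟩
    rw [← map_smul]
    congr 1

lemma testGraph_le : testGraph c Γ ≤ LinearMap.range (graphMap c Γ) := by
  rintro _ ⟨ψ, hψ, hs, rfl⟩
  exact ⟨_, rfl⟩

lemma weakPartial_test {ψ : E n → ℝ} (hψ : ContDiff ℝ ∞ ψ) (hs : HasCompactSupport ψ)
    (i : Fin n) : weakPartial c Γ i ⟨_, test_mem_sobolev c Γ hψ hs⟩ =
      (test_memLp c Γ (test_deriv hψ hs (EuclideanSpace.single i 1)).1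
        (test_deriv hψ hs (EuclideanSpace.single i 1)).2).toLp _ :=
  weakPartial_eq ((hasWeakPartial_test hψ hs).toLp (test_memLp c Γ hψ.continuous hs) _)

end Graph

/-! ### Density of test functions in V -/

section HermiteProdDeriv

variable {n : ℕ} (u : Fin n → E n)

lemma expGrowth_fderiv_hermiteProd (α : Fin n → ℕ) (y : E n) :
    ExpGrowth (fun x => fderiv ℝ (hermiteProd u α) x y) := by
  have e : (fun x => fderiv ℝ (hermiteProd u α) x y) = fun x => ∑ k,
      (2 * α k * inner ℝ (u k) y) * hermiteProd u (Function.update α k (α k - 1)) x := by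
    funext x
    rw [(hasFDerivAt_hermiteProd u α x).fderiv]
    simp only [sum_apply, smul_apply, smul_eq_mul, innerSL_apply_apply]
    exact Finset.sum_congr rfl fun k _ => by ring
  rw [e]
  exact ExpGrowth.sum _ fun k _ => (expGrowth_hermiteProd u _).const_mul _

lemma continuous_fderiv_hermiteProd (α : Fin n → ℕ) (y : E n) :
    Continuous (fun x => fderiv ℝ (hermiteProd u α) x y) :=
  ((contDiff_hermiteProd u α).continuous_fderiv (by simp)).clm_apply continuous_const

end HermiteProdDeriv

namespace EigenData

variable {n : ℕ} {c : ℝ} {Γ : Matrix (Fin n) (Fin n) ℝ} {v : OrthonormalBasis (Fin n) ℝ (E n)}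
  {l : Fin n → ℝ} {u : Fin n → E n} (h : EigenData c Γ v l u)

include h

lemma memLp_fderiv_hermiteProd (α : Fin n → ℕ) (y : E n) :
    MemLp (fun x => fderiv ℝ (hermiteProd u α) x y) 2 (weightedMeasure c Γ) :=
  h.memLp_of_expGrowth (expGrowth_fderiv_hermiteProd u α y) (continuous_fderiv_hermiteProd u α y)

lemma weakPartial_hermiteLp_eq_toLp (i : Fin n) (α : Fin n → ℕ) :
    weakPartial c Γ i ⟨h.hermiteLp α, h.hermiteLp_mem α⟩ =
      (h.memLp_fderiv_hermiteProd α (EuclideanSpace.single i 1)).toLp _ :=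
  weakPartial_eq ((hasWeakPartial_of_contDiff (contDiff_hermiteProd u α)).toLp (h.memLp α) _)

/-- H_α is not compactly supported, but χ_N H_α is a test function, and its graph pairings with z
converge to those of H_α. -/
lemma inner_graphMap_hermiteLp_of_orthogonal {z : sobolev c Γ}
    (hz : graphMap c Γ z ∈ (testGraph c Γ)ᗮ) (α : Fin n → ℕ) :
    inner ℝ (graphMap c Γ z) (graphMap c Γ ⟨h.hermiteLp α, h.hermiteLp_mem α⟩) = 0 := by
  obtain ⟨χ, C, hC, hχ⟩ := exists_cutoff n
  set F := hermiteProd u α with hF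
  have hFs : ContDiff ℝ ∞ F := contDiff_hermiteProd u α
  have hFg : ExpGrowth F := expGrowth_hermiteProd u α
  let d : Fin n → (E n → ℝ) → E n → ℝ := fun i f x => fderiv ℝ f x (EuclideanSpace.single i 1)
  have hdb : ∀ i N x, |d i (χ N) x| ≤ C / (N + 1) := fun i N x => by
    refine ((fderiv ℝ (χ N) x).le_opNorm _).trans ?_
    simpa using (hχ N).2.2.2 x
  have hψ : ∀ N, ContDiff ℝ ∞ (fun x => χ N x * F x) := fun N => (hχ N).1.mul hFs
  have hψs : ∀ N, HasCompactSupport (fun x => χ N x * F x) := fun N => (hχ N).2.1.mul_right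
  have hdψ : ∀ i N x, d i (fun x => χ N x * F x) x = χ N x * d i F x + d i (χ N) x * F x :=
    fun i N x => by
      simp only [d]
      rw [fderiv_fun_mul ((hχ N).1.differentiable (by simp) x) (hFs.differentiable (by simp) x)]
      simp only [add_apply, smul_apply, smul_eq_mul]
      ring
  have hdFm : ∀ i, MemLp (d i F) 2 (weightedMeasure c Γ) := fun i =>
    h.memLp_fderiv_hermiteProd α _
  have hn : ∀ {f : E n → ℝ}, Continuous f → ExpGrowth f →
      MemLp (fun x => ‖x‖ * |f x|) 2 (weightedMeasure c Γ) := fun hf hg =>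
    h.memLp_of_expGrowth (ExpGrowth.norm_id.mul hg.abs) (by fun_prop)
  have h1 := tendsto_integral_mul_of_le (Lp.memLp (z : WeightedL2 c Γ)) (h.memLp α)
    (hn hFs.continuous hFg) (aN := fun N x => χ N x * F x)
    (fun N => test_memLp c Γ (hψ N).continuous (hψs N))
    (fun N x => by
      have : χ N x * F x - F x = (χ N x - 1) * F x := by ring
      rw [← hF, this, abs_mul]
      exact (mul_le_mul_of_nonneg_right ((hχ N).2.2.1 x) (abs_nonneg _)).trans
        (le_of_eq (by ring)))
  have h2 : ∀ i, Tendsto (fun N => ∫ x, weakPartial c Γ i z x * d i (fun x => χ N x * F x) x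
      ∂weightedMeasure c Γ) atTop
        (𝓝 (∫ x, weakPartial c Γ i z x * d i F x ∂weightedMeasure c Γ)) := fun i => by
    refine tendsto_integral_mul_of_le (Lp.memLp (weakPartial c Γ i z)) (hdFm i)
      (B := fun x => ‖x‖ * |d i F x| + C * |F x|)
      ((hn (continuous_fderiv_hermiteProd u α _) (expGrowth_fderiv_hermiteProd u α _)).add
        ((h.memLp α).abs.const_mul C))
      (fun N => test_memLp c Γ (test_deriv (hψ N) (hψs N) _).1 (test_deriv (hψ N) (hψs N) _).2)
      (fun N x => ?_)
    have : d i (fun x => χ N x * F x) x - d i F x =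
        (χ N x - 1) * d i F x + d i (χ N) x * F x := by rw [hdψ]; ring
    rw [this]
    refine (abs_add_le _ _).trans ?_
    rw [abs_mul, abs_mul]
    exact (add_le_add (mul_le_mul_of_nonneg_right ((hχ N).2.2.1 x) (abs_nonneg _))
      (mul_le_mul_of_nonneg_right (hdb i N x) (abs_nonneg _))).trans (le_of_eq (by ring))
  have h3 := h1.add (tendsto_finsetSum Finset.univ fun i _ => h2 i)
  have e0 : inner ℝ (graphMap c Γ z) (graphMap c Γ ⟨h.hermiteLp α, h.hermiteLp_mem α⟩) =
      ∫ x, (z : WeightedL2 c Γ) x * F x ∂weightedMeasure c Γ +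
        ∑ i, ∫ x, weakPartial c Γ i z x * d i F x ∂weightedMeasure c Γ := by
    rw [inner_graphMap, form]
    simp only [weakPartial_hermiteLp_eq_toLp, inner_toLp_right]
    rw [hermiteLp, inner_toLp_right]
  rw [e0]
  refine tendsto_nhds_unique h3 (tendsto_const_nhds.congr fun N => ?_)
  have h4 := (Submodule.mem_orthogonal' _ _).1 hz _ ⟨_, hψ N, hψs N, rfl⟩
  rw [inner_graphMap, form] at h4
  simp only [weakPartial_test (hψ N) (hψs N), inner_toLp_right] at h4
  exact h4.symm

lemma eigenvalue_nonneg (α : Fin n → ℕ) : 0 ≤ eigenvalue l α :=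
  Finset.sum_nonneg fun k _ => mul_nonneg (Nat.cast_nonneg _) (h.pos k).le

/-- Test functions are dense in `V`. -/
lemma graphMap_mem_closure (w : sobolev c Γ) :
    graphMap c Γ w ∈ (testGraph c Γ).topologicalClosure := by
  set K := (testGraph c Γ).topologicalClosure with hK
  have hKc : CompleteSpace K := (testGraph c Γ).isClosed_topologicalClosure.completeSpace_coe
  have hle : K ≤ LinearMap.range (graphMap c Γ) :=
    Submodule.topologicalClosure_minimal _ testGraph_le isClosed_range_graphMap
  have hmem : K.starProjection (graphMap c Γ w) ∈ K := Submodule.starProjection_apply_mem _ _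
  obtain ⟨p, hp⟩ := hle hmem
  have ho := Submodule.sub_starProjection_mem_orthogonal (K := K) (graphMap c Γ w)
  rw [← hp, ← map_sub] at ho
  have ho' : graphMap c Γ (w - p) ∈ (testGraph c Γ)ᗮ :=
    Submodule.orthogonal_le (Submodule.le_topologicalClosure _) ho
  -- The graph pairing of `w - p` with H_α is (1 + λ_α) times their pairing in H, and 1 + λ_α > 0;
  -- completeness then applies.
  have hz : ((w - p : sobolev c Γ) : WeightedL2 c Γ) = 0 := by
    refine h.eq_zero_of_inner_hermiteLp fun α => ?_
    have h1 := h.inner_graphMap_hermiteLp_of_orthogonal ho' α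
    rw [real_inner_comm, inner_graphMap, h.form_hermiteLp, real_inner_comm] at h1
    have h2 := h.eigenvalue_nonneg α
    have h3 : (1 + eigenvalue l α) * inner ℝ ((w - p : sobolev c Γ) : WeightedL2 c Γ)
      (h.hermiteLp α) = 0 := by
        rw [real_inner_comm (h.hermiteLp α)] at h1 ⊢
        linarith
    exact (mul_eq_zero.1 h3).resolve_left (by positivity)
  have hwp : w = p := sub_eq_zero.1 (Subtype.ext hz)
  rw [hwp, hp]
  exact hmem

lemma exists_test_approx (w : sobolev c Γ) : ∃ ψ : ℕ → E n → ℝ,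
    (∀ k, ContDiff ℝ ∞ (ψ k) ∧ HasCompactSupport (ψ k)) ∧
    Tendsto (fun k => eLpNorm (ψ k - ⇑(w : WeightedL2 c Γ)) 2 (weightedMeasure c Γ)) atTop (𝓝 0) ∧
    (∀ i, Tendsto (fun k => eLpNorm
      ((fun x => fderiv ℝ (ψ k) x (EuclideanSpace.single i 1)) - ⇑(weakPartial c Γ i w)) 2
      (weightedMeasure c Γ)) atTop (𝓝 0)) := by
  have hcl := h.graphMap_mem_closure w
  rw [← SetLike.mem_coe, Submodule.topologicalClosure_coe, mem_closure_iff_seq_limit] at hcl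
  obtain ⟨x, hx, hlim⟩ := hcl
  choose ψ hψ hs hxψ using hx
  have hlim' : ∀ o, Tendsto (fun k => x k o) atTop (𝓝 (graphMap c Γ w o)) := fun o =>
    ((PiLp.continuous_apply 2 _ o).tendsto _).comp hlim
  refine ⟨ψ, fun k => ⟨hψ k, hs k⟩, ?_, fun i => ?_⟩
  · have := (Lp.tendsto_Lp_iff_tendsto_eLpNorm' _ _).1 (hlim' none)
    refine this.congr fun k => eLpNorm_congr_ae ?_
    rw [hxψ k]
    exact (MemLp.coeFn_toLp (test_memLp c Γ (hψ k).continuous (hs k))).sub (ae_eq_refl _)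
  · have := (Lp.tendsto_Lp_iff_tendsto_eLpNorm' _ _).1 (hlim' (some i))
    refine this.congr fun k => eLpNorm_congr_ae ?_
    rw [hxψ k, graphMap_some, weakPartial_test (hψ k) (hs k)]
    exact (MemLp.coeFn_toLp _).sub (ae_eq_refl _)

end EigenData

/-! ### Diagonal operators -/

lemma HilbertBasis.exists_diagonal {ι X : Type*} [NormedAddCommGroup X] [InnerProductSpace ℝ X]
    (b : HilbertBasis ι ℝ X) {m : ι → ℝ} {M : ℝ} (hm : ∀ i, |m i| ≤ M) :
    ∃ D : X →L[ℝ] X, ∀ f i, b.repr (D f) i = m i * b.repr f i := by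
  -- The absolute value of `M` covers an empty index set, where `M` may be negative.
  have hM : ∀ (f : lp (fun _ : ι => ℝ) 2) i, ‖m i * f i‖ ≤ ‖(|M| * f i)‖ := fun f i => by
    rw [norm_mul, norm_mul, Real.norm_eq_abs (m i), Real.norm_eq_abs |M|, abs_abs]
    exact mul_le_mul_of_nonneg_right ((hm i).trans (le_abs_self M)) (norm_nonneg _)
  have hmem : ∀ f : lp (fun _ : ι => ℝ) 2, Memℓp (fun i => m i * f i) 2 := fun f =>
    (Memℓp.const_mul (lp.memℓp f) |M|).mono' (hM f)
  let D : lp (fun _ : ι => ℝ) 2 →ₗ[ℝ] lp (fun _ : ι => ℝ) 2 :=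
    { toFun := fun f => ⟨fun i => m i * f i, hmem f⟩
      map_add' := fun f g => by
        ext i
        exact mul_add _ _ _
      map_smul' := fun a f => by
        ext i
        simp [mul_left_comm] }
  have hD : ∀ f, ‖D f‖ ≤ |M| * ‖f‖ := fun f => by
    have := lp.norm_mono (p := 2) (by norm_num) (x := D f) (y := |M| • f) fun i => by
      simpa [D] using hM f i
    refine this.trans ((lp.norm_const_smul_le (by norm_num) _ _).trans (le_of_eq ?_))
    rw [Real.norm_eq_abs, abs_abs]
  refine ⟨(b.repr.symm : lp (fun _ : ι => ℝ) 2 →L[ℝ] X) ∘L (D.mkContinuous |M| hD) ∘L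
    (b.repr : X →L[ℝ] lp (fun _ : ι => ℝ) 2), fun f i => ?_⟩
  simp [D]

/-! ### The Hermite basis and the spectrum -/

namespace EigenData

variable {n : ℕ} {c : ℝ} {Γ : Matrix (Fin n) (Fin n) ℝ} {v : OrthonormalBasis (Fin n) ℝ (E n)}
  {l : Fin n → ℝ} {u : Fin n → E n} (h : EigenData c Γ v l u)

include h

lemma orthogonal_span_eq_bot :
    (Submodule.span ℝ (Set.range fun α => h.hermiteLp α))ᗮ = ⊥ := by
  rw [Submodule.eq_bot_iff]
  intro f hf
  refine h.eq_zero_of_inner_hermiteLp fun α => ?_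
  exact (Submodule.mem_orthogonal' _ _).1 hf _ (Submodule.subset_span ⟨α, rfl⟩)

lemma span_dense :
    (Submodule.span ℝ (Set.range fun α => h.hermiteLp α)).topologicalClosure = ⊤ :=
  (Submodule.topologicalClosure_eq_top_iff).2 h.orthogonal_span_eq_bot

lemma mem_domain (α : Fin n → ℕ) : h.hermiteLp α ∈ (formOperator c Γ).domain :=
  ⟨h.hermiteLp_mem α, eigenvalue l α • h.hermiteLp α, fun z => by
    rw [real_inner_smul_left]
    exact h.form_hermiteLp α z⟩

lemma formOperator_hermiteLp (α : Fin n → ℕ) :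
    formOperator c Γ ⟨h.hermiteLp α, h.mem_domain α⟩ = eigenvalue l α • h.hermiteLp α :=
  eq_of_inner_eq c Γ fun z => by
    rw [← formOperator_spec, real_inner_smul_left]
    exact h.form_hermiteLp α z

lemma orthonormal_hermiteLp :
    Orthonormal ℝ fun α => ‖h.hermiteLp α‖⁻¹ • h.hermiteLp α := by
  refine ⟨fun α => ?_, fun α β hαβ => ?_⟩
  · rw [norm_smul, norm_inv, norm_norm,
      inv_mul_cancel₀ (norm_ne_zero_iff.2 (h.hermiteLp_ne_zero α))]
  · change inner ℝ (‖h.hermiteLp α‖⁻¹ • h.hermiteLp α) (‖h.hermiteLp β‖⁻¹ • h.hermiteLp β) = 0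
    rw [real_inner_smul_left, real_inner_smul_right, h.inner_hermiteLp_of_ne hαβ]
    simp

/-- The Hilbert basis of normalized Hermite functions. -/
noncomputable def hermiteBasis : HilbertBasis (Fin n → ℕ) ℝ (WeightedL2 c Γ) :=
  HilbertBasis.mkOfOrthogonalEqBot (v := fun α => ‖h.hermiteLp α‖⁻¹ • h.hermiteLp α)
    h.orthonormal_hermiteLp
    (by
      rw [← h.orthogonal_span_eq_bot]
      refine congrArg _ (le_antisymm (Submodule.span_le.2 ?_) (Submodule.span_le.2 ?_))
      · rintro _ ⟨α, rfl⟩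
        exact Submodule.smul_mem _ _ (Submodule.subset_span ⟨α, rfl⟩)
      · rintro _ ⟨α, rfl⟩
        have := Submodule.smul_mem (Submodule.span ℝ (Set.range fun α =>
          ‖h.hermiteLp α‖⁻¹ • h.hermiteLp α)) ‖h.hermiteLp α‖ (Submodule.subset_span ⟨α, rfl⟩)
        rwa [smul_smul, mul_inv_cancel₀ (norm_ne_zero_iff.2 (h.hermiteLp_ne_zero α)),
          one_smul] at this)

lemma hermiteBasis_repr (f : WeightedL2 c Γ) (α : Fin n → ℕ) :
    h.hermiteBasis.repr f α = ‖h.hermiteLp α‖⁻¹ * inner ℝ (h.hermiteLp α) f := by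
  rw [HilbertBasis.repr_apply_apply, hermiteBasis, HilbertBasis.coe_mkOfOrthogonalEqBot,
    real_inner_smul_left]

lemma ext_repr {f g : WeightedL2 c Γ}
    (hfg : ∀ α, h.hermiteBasis.repr f α = h.hermiteBasis.repr g α) : f = g :=
  h.hermiteBasis.repr.injective (lp.ext (funext hfg))

/-- By symmetry of the form, A can be moved onto H_α: on coefficients it acts as multiplication by
λ_α. -/
lemma repr_formOperator (w : (formOperator c Γ).domain) (α : Fin n → ℕ) :
    h.hermiteBasis.repr (formOperator c Γ w) α =
      eigenvalue l α * h.hermiteBasis.repr (w : WeightedL2 c Γ) α := by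
  have h1 := formOperator_spec c Γ w ⟨h.hermiteLp α, h.hermiteLp_mem α⟩
  have h2 := h.form_hermiteLp α ⟨w, operatorDomain_le c Γ w.2⟩
  rw [h.hermiteBasis_repr, h.hermiteBasis_repr, real_inner_comm, ← h1, form_comm, h2]
  ring

/-- `D(A)` contains all `f` for which `(λ_α f_α)` is square summable. -/
lemma mem_domain_of_repr {f g : WeightedL2 c Γ}
    (hfg : ∀ α, h.hermiteBasis.repr g α = (1 + eigenvalue l α) * h.hermiteBasis.repr f α) :
    ∃ hf : f ∈ (formOperator c Γ).domain, formOperator c Γ ⟨f, hf⟩ = g - f := by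
  -- Solve (1 + A)w = g; comparing coefficients forces w = f, which places f in the domain.
  obtain ⟨w, hw⟩ := exists_formOperator_eq_sub g
  have e : (w : WeightedL2 c Γ) = f := h.ext_repr fun α => by
    have h1 := h.repr_formOperator w α
    rw [hw, map_sub, lp.coeFn_sub, Pi.sub_apply, hfg] at h1
    have h2 : 0 < 1 + eigenvalue l α := by linarith [h.eigenvalue_nonneg α]
    refine mul_left_cancel₀ h2.ne' ?_
    linarith
  subst e
  exact ⟨w.2, hw⟩

lemma finite_eigenvalue_le (B : ℝ) : {α : Fin n → ℕ | eigenvalue l α ≤ B}.Finite := by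
  refine (Set.finite_Iic fun k => ⌊B / l k⌋₊).subset fun α hα k => Nat.le_floor ?_
  rw [le_div_iff₀ (h.pos k)]
  have hα' : eigenvalue l α ≤ B := hα
  refine le_trans ?_ hα'
  exact Finset.single_le_sum (f := fun k => (α k : ℝ) * l k)
    (fun j _ => mul_nonneg (Nat.cast_nonneg _) (h.pos j).le) (Finset.mem_univ k)

lemma exists_resolvent_bound (z : ℂ) (hz : ∀ α, z ≠ ((eigenvalue l α : ℝ) : ℂ)) :
    ∃ M, ∀ α, (1 + eigenvalue l α) * ‖(z - eigenvalue l α)⁻¹‖ ≤ M := by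
  obtain ⟨M, hM⟩ := ((h.finite_eigenvalue_le (2 * ‖z‖ + 1)).image
    fun α => (1 + eigenvalue l α) * ‖(z - eigenvalue l α)⁻¹‖).bddAbove
  -- Only finitely many λ_α are at most 2|z| + 1, giving `M`. Beyond this threshold |z - λ| ≥ λ -
  -- |z| ≥ (1 + λ)/2, giving 2.
  refine ⟨max M 2, fun α => ?_⟩
  rcases le_or_gt (eigenvalue l α) (2 * ‖z‖ + 1) with hα | hα
  · exact le_max_of_le_left (hM ⟨α, hα, rfl⟩)
  · refine le_max_of_le_right ?_
    have h0 := h.eigenvalue_nonneg α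
    have h1 : ‖((eigenvalue l α : ℝ) : ℂ)‖ - ‖z‖ ≤ ‖z - eigenvalue l α‖ := by
      rw [norm_sub_rev]
      exact norm_sub_norm_le _ _
    rw [Complex.norm_real, Real.norm_of_nonneg h0] at h1
    have h2 : 0 < ‖z - eigenvalue l α‖ := norm_pos_iff.2 (sub_ne_zero.2 (hz α))
    rw [norm_inv, ← div_eq_mul_inv, div_le_iff₀ h2]
    linarith

/-- On f + ig the resolvent is multiplication of coefficients by r_α = (z - λ_α)⁻¹. Split into real
and imaginary parts this is (Pf - Qg, Qf + Pg), with P and Q diagonal with entries Re r_α and Im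
r_α. -/
lemma mem_opResolventSet {z : ℂ} (hz : ∀ α, z ≠ ((eigenvalue l α : ℝ) : ℂ)) :
    z ∈ opResolventSet (formOperator c Γ) := by
  obtain ⟨M, hM⟩ := h.exists_resolvent_bound z hz
  set b := h.hermiteBasis with hb
  let r : (Fin n → ℕ) → ℂ := fun α => (z - eigenvalue l α)⁻¹
  have hr : ∀ α, ‖r α‖ ≤ M := fun α => by
    refine le_trans ?_ (hM α)
    nlinarith [h.eigenvalue_nonneg α, norm_nonneg (r α)]
  have hbd : ∀ (p : ℂ → ℝ), (∀ w, |p w| ≤ ‖w‖) → (∀ α, |p (r α)| ≤ M) ∧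
      ∀ α, |(1 + eigenvalue l α) * p (r α)| ≤ M := fun p hp => by
    refine ⟨fun α => (hp _).trans (hr α), fun α => ?_⟩
    rw [abs_mul, abs_of_nonneg (by linarith [h.eigenvalue_nonneg α])]
    exact (mul_le_mul_of_nonneg_left (hp _) (by linarith [h.eigenvalue_nonneg α])).trans (hM α)
  -- The primed operators carry the extra factor 1 + λ_α; they represent (1 + A)P and (1 + A)Q and
  -- certify that the values lie in D(A).
  obtain ⟨P, hP⟩ := b.exists_diagonal (hbd Complex.re Complex.abs_re_le_norm).1
  obtain ⟨P', hP'⟩ := b.exists_diagonal (hbd Complex.re Complex.abs_re_le_norm).2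
  obtain ⟨Q, hQ⟩ := b.exists_diagonal (hbd Complex.im Complex.abs_im_le_norm).1
  obtain ⟨Q', hQ'⟩ := b.exists_diagonal (hbd Complex.im Complex.abs_im_le_norm).2
  have hzr : ∀ α, (z.re - eigenvalue l α) * (r α).re - z.im * (r α).im = 1 ∧
      (z.re - eigenvalue l α) * (r α).im + z.im * (r α).re = 0 := fun α => by
    have e : (z - eigenvalue l α) * r α = 1 := mul_inv_cancel₀ (sub_ne_zero.2 (hz α))
    have e1 := congrArg Complex.re e
    have e2 := congrArg Complex.im e
    simp only [Complex.mul_re, Complex.mul_im, Complex.sub_re, Complex.sub_im, Complex.ofReal_re,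
      Complex.ofReal_im, Complex.one_re, Complex.one_im, sub_zero] at e1 e2
    exact ⟨e1, e2⟩
  refine ⟨((P ∘L .fst ℝ _ _) - (Q ∘L .snd ℝ _ _)).prod ((Q ∘L .fst ℝ _ _) + (P ∘L .snd ℝ _ _)),
    fun ⟨f, g⟩ => ?_, fun w y => ?_⟩
  · obtain ⟨d1, e1⟩ := h.mem_domain_of_repr (f := P f - Q g) (g := P' f - Q' g) fun α => by
      simp only [map_sub, lp.coeFn_sub, Pi.sub_apply, ← hb, hP, hP', hQ, hQ']
      ring
    obtain ⟨d2, e2⟩ := h.mem_domain_of_repr (f := Q f + P g) (g := Q' f + P' g) fun α => by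
      simp only [map_add, lp.coeFn_add, Pi.add_apply, ← hb, hP, hP', hQ, hQ']
      ring
    refine ⟨⟨_, d1⟩, ⟨_, d2⟩, by simp, ?_⟩
    rw [shift, e1, e2]
    refine Prod.ext (h.ext_repr fun α => ?_) (h.ext_repr fun α => ?_)
    · obtain ⟨a1, a2⟩ := hzr α
      simp only [map_sub, map_add, map_smul, lp.coeFn_sub, lp.coeFn_add, lp.coeFn_smul,
        Pi.sub_apply, Pi.add_apply, Pi.smul_apply, smul_eq_mul, ← hb, hP, hP', hQ, hQ']
      linear_combination (b.repr f α) * a1 - (b.repr g α) * a2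
    · obtain ⟨a1, a2⟩ := hzr α
      simp only [map_sub, map_add, map_smul, lp.coeFn_sub, lp.coeFn_add, lp.coeFn_smul,
        Pi.sub_apply, Pi.add_apply, Pi.smul_apply, smul_eq_mul, ← hb, hP, hP', hQ, hQ']
      linear_combination (b.repr g α) * a1 + (b.repr f α) * a2
  · refine Prod.ext (h.ext_repr fun α => ?_) (h.ext_repr fun α => ?_)
    · obtain ⟨a1, a2⟩ := hzr α
      simp only [shift, ContinuousLinearMap.prod_apply, sub_apply, add_apply,
        ContinuousLinearMap.comp_apply, ContinuousLinearMap.coe_fst', ContinuousLinearMap.coe_snd',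
        map_sub, map_add, map_smul, lp.coeFn_sub, lp.coeFn_add, lp.coeFn_smul,
        Pi.sub_apply, Pi.add_apply, Pi.smul_apply, smul_eq_mul, ← hb, hP, hQ]
      rw [hb, h.repr_formOperator, h.repr_formOperator]
      linear_combination (b.repr (w : WeightedL2 c Γ) α) * a1 - (b.repr (y : WeightedL2 c Γ) α) * a2
    · obtain ⟨a1, a2⟩ := hzr α
      simp only [shift, ContinuousLinearMap.prod_apply, sub_apply, add_apply,
        ContinuousLinearMap.comp_apply, ContinuousLinearMap.coe_fst', ContinuousLinearMap.coe_snd',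
        map_sub, map_add, map_smul, lp.coeFn_sub, lp.coeFn_add, lp.coeFn_smul,
        Pi.sub_apply, Pi.add_apply, Pi.smul_apply, smul_eq_mul, ← hb, hP, hQ]
      rw [hb, h.repr_formOperator, h.repr_formOperator]
      linear_combination (b.repr (y : WeightedL2 c Γ) α) * a1 + (b.repr (w : WeightedL2 c Γ) α) * a2

theorem opSpectrum_eq : opSpectrum (formOperator c Γ) =
    {z : ℂ | ∃ α : Fin n → ℕ, z = ((eigenvalue l α : ℝ) : ℂ)} := by
  refine Set.Subset.antisymm (fun z hz => ?_) ?_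
  · by_contra hne
    exact hz (h.mem_opResolventSet (not_exists.1 hne))
  · rintro z ⟨α, rfl⟩ ⟨R, -, hR⟩
    -- A left inverse of z - A would send 0 to H_α.
    have e := hR ⟨_, h.mem_domain α⟩ 0
    have hs : shift (formOperator c Γ) (eigenvalue l α : ℂ) ⟨_, h.mem_domain α⟩ 0 = 0 := by
      rw [shift, h.formOperator_hermiteLp]
      simp
    rw [hs, map_zero] at e
    exact h.hermiteLp_ne_zero α (congrArg Prod.fst e).symm

end EigenData

/-! ### Inserting a coordinate -/

section InsertCoord

variable {m : ℕ}

/-- The point of `ℝ^{m+1}` with `i`-th coordinate `t` and remaining coordinates `y`. -/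
noncomputable def insertCoord (i : Fin (m + 1)) (t : ℝ) (y : E m) : E (m + 1) :=
  WithLp.toLp 2 (Fin.insertNth i t y.ofLp)

lemma norm_sq_insertCoord (i : Fin (m + 1)) (t : ℝ) (y : E m) :
    ‖insertCoord i t y‖ ^ 2 = t ^ 2 + ‖y‖ ^ 2 := by
  rw [EuclideanSpace.norm_sq_eq, EuclideanSpace.norm_sq_eq, Fin.sum_univ_succAbove _ i]
  simp [insertCoord]

lemma insertCoord_sub (i : Fin (m + 1)) (t t' : ℝ) (y y' : E m) :
    insertCoord i t y - insertCoord i t' y' = insertCoord i (t - t') (y - y') := by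
  ext j
  refine Fin.succAboveCases i ?_ (fun k => ?_) j <;> simp [insertCoord]

lemma insertCoord_eq (i : Fin (m + 1)) (t : ℝ) (y : E m) :
    insertCoord i t y = t • EuclideanSpace.single i 1 + insertCoord i 0 y := by
  ext j
  refine Fin.succAboveCases i ?_ (fun k => ?_) j <;> simp [insertCoord]

lemma continuous_insertCoord (i : Fin (m + 1)) :
    Continuous (fun p : ℝ × E m => insertCoord i p.1 p.2) := by
  refine (PiLp.continuous_toLp 2 _).comp ?_
  exact Continuous.finInsertNth i continuous_fst
    ((PiLp.continuous_ofLp 2 _).comp continuous_snd)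

lemma exists_insertCoord (i : Fin (m + 1)) (z : E (m + 1)) :
    ∃ y : E m, z = insertCoord i (z i) y := by
  refine ⟨WithLp.toLp 2 fun k => z (i.succAbove k), ?_⟩
  ext j
  refine Fin.succAboveCases i ?_ (fun k => ?_) j <;> simp [insertCoord]

lemma lintegral_insertCoord (i : Fin (m + 1)) {F : E (m + 1) → ℝ≥0∞} (hF : Measurable F) :
    ∫⁻ z, F z = ∫⁻ y : E m, ∫⁻ t : ℝ, F (insertCoord i t y) := by
  have e1 := (PiLp.volume_preserving_toLp (Fin (m + 1))).lintegral_comp hF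
  have hF1 : Measurable fun x : Fin (m + 1) → ℝ => F (WithLp.toLp 2 x) :=
    hF.comp (PiLp.continuous_toLp 2 _).measurable
  have e2 := ((volume_preserving_piFinSuccAbove (fun _ : Fin (m + 1) => ℝ) i).symm).lintegral_comp
    hF1
  have hF2 : Measurable fun p : ℝ × (Fin m → ℝ) => F (WithLp.toLp 2 (Fin.insertNth i p.1 p.2)) := by
    refine hF1.comp (Continuous.measurable ?_)
    exact Continuous.finInsertNth i continuous_fst continuous_snd
  have e3 := lintegral_prod_symm (μ := (volume : Measure ℝ))
    (ν := (volume : Measure (Fin m → ℝ))) _ hF2.aemeasurable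
  have hF3 : Measurable fun y : E m => ∫⁻ t : ℝ, F (insertCoord i t y) := by
    refine Measurable.lintegral_prod_left' (f := fun p : ℝ × E m => F (insertCoord i p.1 p.2)) ?_
    exact hF.comp (continuous_insertCoord i).measurable
  have e4 := (PiLp.volume_preserving_toLp (Fin m)).lintegral_comp hF3
  rw [← e1, ← e2, ← e4]
  exact e3

end InsertCoord

/-! ### A one-dimensional trace inequality -/

/-- Integrate the derivative of (t/s) p(t), which is 0 at t = 0 and p(s) at t = s. On the segment
|t/s| ≤ 1 and 1/|s| ≤ 1/δ. The symmetric interval treats both signs of s at once. -/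
lemma ofReal_le_lintegral_of_hasDerivAt {p p' : ℝ → ℝ} (hp : ∀ t, HasDerivAt p (p' t) t)
    (hc : Continuous p') (h0 : ∀ t, 0 ≤ p t) {δ s : ℝ} (hδ : 0 < δ) (hs : δ ≤ |s|) :
    ENNReal.ofReal (p s) ≤
      ∫⁻ t in Set.Icc (-|s|) |s|, ENNReal.ofReal (p t / δ + |p' t|) := by
  have hs0 : s ≠ 0 := fun h => by simp [h] at hs; linarith
  have hpc : Continuous p := continuous_iff_continuousAt.2 fun t => (hp t).continuousAt
  have hder : ∀ t ∈ Set.uIcc 0 s, HasDerivAt (fun t => t / s * p t) (1 / s * p t + t / s * p' t) t :=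
    fun t _ => ((hasDerivAt_id t).div_const s).mul (hp t)
  have hftc := intervalIntegral.integral_eq_sub_of_hasDerivAt hder
    (Continuous.intervalIntegrable (by fun_prop) _ _)
  have e : ‖p s‖ₑ = ‖∫ t in Set.uIoc 0 s, (1 / s * p t + t / s * p' t)‖ₑ := by
    have h1 : p s = ∫ t in (0 : ℝ)..s, (1 / s * p t + t / s * p' t) := by
      rw [hftc]
      field_simp
      simp
    have h2 := congrArg ENNReal.ofReal (intervalIntegral.norm_integral_eq_norm_integral_uIoc
      (μ := volume) (a := 0) (b := s) (fun t => 1 / s * p t + t / s * p' t))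
    rw [ofReal_norm, ofReal_norm, ← h1] at h2
    exact h2
  rw [← Real.enorm_of_nonneg (h0 s), e]
  refine (enorm_integral_le_lintegral_enorm _).trans ?_
  have hsub : Set.uIoc 0 s ⊆ Set.Icc (-|s|) |s| := fun t ht => by
    rcases le_total 0 s with h | h
    · rw [Set.uIoc_of_le h] at ht
      rw [abs_of_nonneg h]
      exact ⟨by linarith [ht.1], ht.2⟩
    · rw [Set.uIoc_of_ge h] at ht
      rw [abs_of_nonpos h]
      exact ⟨by linarith [ht.1], by linarith [ht.2]⟩
  refine (lintegral_mono_set hsub).trans (setLIntegral_mono' measurableSet_Icc fun t ht => ?_)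
  rw [← ofReal_norm]
  refine ENNReal.ofReal_le_ofReal ((norm_add_le _ _).trans (add_le_add ?_ ?_))
  · rw [norm_mul, norm_div, norm_one, Real.norm_of_nonneg (h0 t), Real.norm_eq_abs,
      one_div_mul_eq_div]
    exact div_le_div_of_nonneg_left (h0 t) hδ hs
  · rw [norm_mul, norm_div, Real.norm_eq_abs, Real.norm_eq_abs, Real.norm_eq_abs]
    refine mul_le_of_le_one_left (abs_nonneg _) (div_le_one_of_le₀ (abs_le.2 ht) (abs_nonneg _))

/-! ### The Hausdorff measure of Lipschitz graphs -/

lemma euclideanHausdorffMeasure_image_le {X Y : Type*} [MetricSpace X] [MeasurableSpace X]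
    [BorelSpace X] [MetricSpace Y] [MeasurableSpace Y] [BorelSpace Y] {K : ℝ≥0} {f : X → Y}
    {s : Set X} (hf : LipschitzOnWith K f s) (d : ℕ) :
    Measure.euclideanHausdorffMeasure d (f '' s) ≤
      (K : ℝ≥0∞) ^ d * Measure.euclideanHausdorffMeasure d s := by
  have h := hf.hausdorffMeasure_image_le (d := d) (Nat.cast_nonneg d)
  rw [ENNReal.rpow_natCast] at h
  rw [Measure.euclideanHausdorffMeasure_def, Measure.euclideanHausdorffMeasure_def,
    Measure.smul_apply, Measure.smul_apply, mul_smul_comm]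
  gcongr

/-- Hausdorff measure on the image is dominated by K^m times the pushforward of Lebesgue measure, so
an upper bound needs neither injectivity nor an area formula. -/
lemma lintegral_image_le {m : ℕ} {Y : Type*} [MetricSpace Y] [MeasurableSpace Y] [BorelSpace Y]
    {K : ℝ≥0} {T : E m → Y} {D : Set (E m)} (hT : LipschitzOnWith K T D) (hTm : Measurable T) {f : Y → ℝ≥0∞} (hf : Measurable f) :
    ∫⁻ x in T '' D, f x ∂Measure.euclideanHausdorffMeasure m ≤
      (K : ℝ≥0∞) ^ m * ∫⁻ y in D, f (T y) := by
  have hle : (Measure.euclideanHausdorffMeasure m).restrict (T '' D) ≤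
      (K : ℝ≥0∞) ^ m • (Measure.map T (volume.restrict D)) := by
    refine Measure.le_iff.2 fun s hs => ?_
    rw [Measure.restrict_apply hs, Measure.smul_apply, Measure.map_apply hTm hs,
      Measure.restrict_apply (hTm hs), smul_eq_mul,
      ← EuclideanSpace.euclideanHausdorffMeasure_eq_volume]
    refine le_trans (measure_mono ?_) (euclideanHausdorffMeasure_image_le
      (hT.mono Set.inter_subset_right) m)
    rintro _ ⟨hx, y, hy, rfl⟩
    exact ⟨y, ⟨hx, hy⟩, rfl⟩
  refine (lintegral_mono' hle le_rfl).trans ?_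
  rw [lintegral_smul_measure, lintegral_map hf hTm, smul_eq_mul]

/-! ### The trace inequality on ellipsoids -/

/-- `ψ² + |∇ψ|²`. -/
noncomputable def energyDensity {n : ℕ} (ψ : E n → ℝ) (x : E n) : ℝ :=
  ψ x ^ 2 + ∑ j, fderiv ℝ ψ x (EuclideanSpace.single j 1) ^ 2

section Energy

variable {n : ℕ} {ψ : E n → ℝ}

lemma energyDensity_nonneg (x : E n) : 0 ≤ energyDensity ψ x := by
  unfold energyDensity; positivity

lemma continuous_energyDensity (hψ : ContDiff ℝ ∞ ψ) : Continuous (energyDensity ψ) := by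
  have h1 := hψ.continuous
  have h2 : ∀ j : Fin n, Continuous (fun x => fderiv ℝ ψ x (EuclideanSpace.single j 1)) :=
    fun j => (hψ.continuous_fderiv (by simp)).clm_apply continuous_const
  unfold energyDensity
  fun_prop

lemma sq_fderiv_apply_le (x w : E n) : fderiv ℝ ψ x w ^ 2 ≤ ‖w‖ ^ 2 * energyDensity ψ x := by
  have hw : fderiv ℝ ψ x w = ∑ j, w j * fderiv ℝ ψ x (EuclideanSpace.single j 1) := by
    have : w = ∑ j, w j • EuclideanSpace.single j (1 : ℝ) := by
      ext i
      simp [Finset.sum_apply, Pi.single_apply]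
    conv_lhs => rw [this, map_sum]
    simp only [map_smul, smul_eq_mul]
  have hn : ‖w‖ ^ 2 = ∑ j, w j ^ 2 := by
    simp [EuclideanSpace.norm_sq_eq]
  rw [hw, hn]
  refine (Finset.sum_mul_sq_le_sq_mul_sq _ _ _).trans (mul_le_mul_of_nonneg_left ?_ (by positivity))
  unfold energyDensity
  nlinarith [sq_nonneg (ψ x)]

end Energy

section Patch

variable {m : ℕ}

/-- The graph parametrization of the part of the sphere of radius `R` where `σ xᵢ > 0`. -/
noncomputable def spherePatch (i : Fin (m + 1)) (σ R : ℝ) (y : E m) : E (m + 1) :=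
  insertCoord i (σ * √(R ^ 2 - ‖y‖ ^ 2)) y

/-- The domain on which the height of `spherePatch` is at least `R / √(m+1)`. -/
def patchDomain (m : ℕ) (R : ℝ) : Set (E m) := {y | ‖y‖ ^ 2 ≤ R ^ 2 - R ^ 2 / (m + 1)}

lemma continuous_spherePatch (i : Fin (m + 1)) (σ R : ℝ) :
    Continuous (spherePatch i σ R) := by
  have : Continuous (fun y : E m => (σ * √(R ^ 2 - ‖y‖ ^ 2), y)) := by fun_prop
  exact (continuous_insertCoord i).comp this

lemma isCompact_patchDomain (R : ℝ) : IsCompact (patchDomain m R) := by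
  refine Metric.isCompact_of_isClosed_isBounded ?_ ?_
  · exact isClosed_le (by fun_prop) continuous_const
  · refine (Metric.isBounded_closedBall (x := (0 : E m)) (r := |R|)).subset fun y hy => ?_
    rw [mem_closedBall_zero_iff]
    refine abs_le_of_sq_le_sq' ?_ (abs_nonneg _) |>.2
    rw [sq_abs]
    have : 0 ≤ R ^ 2 / ((m : ℝ) + 1) := by positivity
    have hy' : ‖y‖ ^ 2 ≤ R ^ 2 - R ^ 2 / (m + 1) := hy
    linarith

lemma height_le {R : ℝ} {y : E m} (hy : y ∈ patchDomain m R) :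
    R / √(m + 1) ≤ √(R ^ 2 - ‖y‖ ^ 2) := by
  refine Real.le_sqrt_of_sq_le ?_
  have hy' : ‖y‖ ^ 2 ≤ R ^ 2 - R ^ 2 / (m + 1) := hy
  rw [div_pow, Real.sq_sqrt (by positivity)]
  linarith

/-- For heights s, s' one has |s - s'|(s + s') = |‖y‖² - ‖y'‖²| ≤ 2R‖y - y'‖, while s + s' ≥
2R/√(m+1). So the height has Lipschitz constant √(m+1) and the graph √(m+2), independently of R. -/
lemma lipschitzOnWith_spherePatch (i : Fin (m + 1)) {σ R : ℝ} (hσ : |σ| = 1) (hR : 0 < R) :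
    LipschitzOnWith ⟨√(m + 2), Real.sqrt_nonneg _⟩ (spherePatch i σ R) (patchDomain m R) := by
  refine LipschitzOnWith.of_dist_le_mul fun y hy y' hy' => ?_
  rw [dist_eq_norm, dist_eq_norm, spherePatch, spherePatch, insertCoord_sub]
  change _ ≤ √(m + 2) * _
  have hnn : 0 ≤ √((m : ℝ) + 2) * ‖y - y'‖ := by positivity
  refine abs_le_of_sq_le_sq' ?_ hnn |>.2
  rw [norm_sq_insertCoord, mul_pow, Real.sq_sqrt (by positivity)]
  have hs := height_le hy
  have hs' := height_le hy'
  set s := √(R ^ 2 - ‖y‖ ^ 2) with hsd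
  set s' := √(R ^ 2 - ‖y'‖ ^ 2) with hsd'
  set δ := R / √((m : ℝ) + 1) with hδd
  have hm : (0 : ℝ) < (m : ℝ) + 1 := by positivity
  have hδ : 0 < δ := div_pos hR (Real.sqrt_pos.2 hm)
  have hδ2 : ((m : ℝ) + 1) * δ ^ 2 = R ^ 2 := by
    rw [hδd, div_pow, Real.sq_sqrt hm.le]
    field_simp
  have h1 : s ^ 2 = R ^ 2 - ‖y‖ ^ 2 :=
    Real.sq_sqrt (Real.sqrt_pos.1 (hδ.trans_le hs)).le
  have h1' : s' ^ 2 = R ^ 2 - ‖y'‖ ^ 2 :=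
    Real.sq_sqrt (Real.sqrt_pos.1 (hδ.trans_le hs')).le
  have hyR : ‖y‖ ≤ R := abs_le_of_sq_le_sq' (by nlinarith [sq_nonneg s]) hR.le |>.2
  have hyR' : ‖y'‖ ≤ R := abs_le_of_sq_le_sq' (by nlinarith [sq_nonneg s']) hR.le |>.2
  have h2 : |s - s'| * (2 * δ) ≤ ‖y - y'‖ * (2 * R) := by
    calc |s - s'| * (2 * δ) ≤ |s - s'| * (s + s') := by gcongr; linarith
      _ = |‖y'‖ - ‖y‖| * (‖y‖ + ‖y'‖) := by
        rw [← abs_of_nonneg (show 0 ≤ s + s' by linarith), ← abs_mul,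
          ← abs_of_nonneg (show 0 ≤ ‖y‖ + ‖y'‖ by positivity), ← abs_mul]
        congr 1
        linarith
      _ ≤ ‖y - y'‖ * (2 * R) := by
        refine mul_le_mul ?_ (by linarith) (by positivity) (norm_nonneg _)
        rw [abs_sub_comm]
        exact abs_norm_sub_norm_le y y'
  have h3 : (s - s') ^ 2 * δ ^ 2 ≤ ‖y - y'‖ ^ 2 * R ^ 2 := by
    have h4 : |s - s'| * δ ≤ ‖y - y'‖ * R := by linarith
    have := pow_le_pow_left₀ (by positivity) h4 2
    rwa [mul_pow, mul_pow, sq_abs] at this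
  have h5 : (s - s') ^ 2 ≤ (m + 1) * ‖y - y'‖ ^ 2 := by
    rw [← hδ2] at h3
    have : 0 < δ ^ 2 := by positivity
    nlinarith
  have h6 : (σ * s - σ * s') ^ 2 = (s - s') ^ 2 := by
    rw [← mul_sub, mul_pow, ← sq_abs σ, hσ]
    ring
  rw [h6]
  linarith

/-- Pigeonhole: some coordinate carries at least the average R²/(m+1) of the squared norm. -/
lemma mem_image_spherePatch {R : ℝ} {z : E (m + 1)} (hz : ‖z‖ ^ 2 = R ^ 2) :
    ∃ i, ∃ σ ∈ ({1, -1} : Finset ℝ), z ∈ spherePatch i σ R '' patchDomain m R := by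
  have hm : (0 : ℝ) < (m : ℝ) + 1 := by positivity
  obtain ⟨i, hi⟩ : ∃ i, R ^ 2 / (m + 1) ≤ z i ^ 2 := by
    by_contra! hlt
    have h1 : ‖z‖ ^ 2 = ∑ i, z i ^ 2 := by simp [EuclideanSpace.norm_sq_eq]
    have h2 : ∑ i, z i ^ 2 < ∑ _i : Fin (m + 1), R ^ 2 / ((m : ℝ) + 1) :=
      Finset.sum_lt_sum_of_nonempty Finset.univ_nonempty fun i _ => hlt i
    rw [← h1, hz] at h2
    simp only [Finset.sum_const, Finset.card_univ, Fintype.card_fin, nsmul_eq_mul] at h2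
    push_cast at h2
    rw [mul_div_cancel₀ _ hm.ne'] at h2
    exact lt_irrefl _ h2
  obtain ⟨y, hy⟩ := exists_insertCoord i z
  have hn : z i ^ 2 + ‖y‖ ^ 2 = R ^ 2 := by
    rw [← hz]
    conv_rhs => rw [hy]
    rw [norm_sq_insertCoord]
  have hyD : y ∈ patchDomain m R := by
    change ‖y‖ ^ 2 ≤ R ^ 2 - R ^ 2 / (m + 1)
    linarith
  have hsq : √(R ^ 2 - ‖y‖ ^ 2) = |z i| := by
    rw [← Real.sqrt_sq_eq_abs]
    congr 1
    linarith
  rcases le_total 0 (z i) with h0 | h0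
  · refine ⟨i, 1, by simp, y, hyD, ?_⟩
    rw [spherePatch, hsq, abs_of_nonneg h0, one_mul]
    exact hy.symm
  · refine ⟨i, -1, by simp, y, hyD, ?_⟩
    rw [spherePatch, hsq, abs_of_nonpos h0, neg_one_mul, neg_neg]
    exact hy.symm

/-- The trace inequality on a single patch of an ellipsoid. -/
lemma lintegral_patch_le (L : E (m + 1) →L[ℝ] E (m + 1)) (i : Fin (m + 1)) {σ R : ℝ}
    (hσ : |σ| = 1) (hR : 0 < R) {ψ : E (m + 1) → ℝ} (hψ : ContDiff ℝ ∞ ψ) :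
    ∫⁻ x in (fun y => L (spherePatch i σ R y)) '' patchDomain m R, ENNReal.ofReal (ψ x ^ 2)
        ∂Measure.euclideanHausdorffMeasure m ≤
      ((‖L‖₊ * ⟨√(m + 2), Real.sqrt_nonneg _⟩ : ℝ≥0) : ℝ≥0∞) ^ m *
        (ENNReal.ofReal ((√(m + 1) + 1 + ‖L‖ ^ 2) * (1 + 1 / R)) *
          ∫⁻ z in {z | ‖z‖ ≤ R}, ENNReal.ofReal (energyDensity ψ (L z))) := by
  have hTc : Continuous (fun y => L (spherePatch i σ R y)) :=
    L.continuous.comp (continuous_spherePatch i σ R)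
  have hψm : Measurable (fun x => ENNReal.ofReal (ψ x ^ 2)) :=
    (hψ.continuous.pow 2).measurable.ennreal_ofReal
  refine (lintegral_image_le (L.lipschitz.comp_lipschitzOnWith
    (lipschitzOnWith_spherePatch i hσ hR)) hTc.measurable hψm).trans ?_
  gcongr
  set e : E (m + 1) → ℝ≥0∞ := fun z => ENNReal.ofReal (energyDensity ψ (L z)) with he
  set B := {z : E (m + 1) | ‖z‖ ≤ R} with hB
  have hBm : MeasurableSet B := (isClosed_le continuous_norm continuous_const).measurableSet
  have hem : Measurable e :=
    ((continuous_energyDensity hψ).comp L.continuous).measurable.ennreal_ofReal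
  -- The term √(m+1)/R comes from p/δ with δ = R/√(m+1); the term 1 + ‖L‖² comes from |2ψ ∂ψ| ≤ ψ² +
  -- |∂ψ|².
  set A := (√((m : ℝ) + 1) + 1 + ‖L‖ ^ 2) * (1 + 1 / R) with hA
  have hsm : 1 ≤ √((m : ℝ) + 1) := Real.one_le_sqrt.2 (by simp)
  have hA0 : 0 ≤ A := by positivity
  rw [← lintegral_indicator hBm, lintegral_insertCoord i (hem.indicator hBm),
    ← lintegral_const_mul' _ _ ENNReal.ofReal_ne_top]
  refine (setLIntegral_mono' (isCompact_patchDomain R).isClosed.measurableSet fun y hy => ?_).trans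
    (setLIntegral_le_lintegral _ _)
  rw [← lintegral_const_mul' _ _ ENNReal.ofReal_ne_top]
  set s := σ * √(R ^ 2 - ‖y‖ ^ 2) with hs
  have hsa : |s| = √(R ^ 2 - ‖y‖ ^ 2) := by
    rw [hs, abs_mul, hσ, one_mul, abs_of_nonneg (Real.sqrt_nonneg _)]
  have hδs := height_le hy
  have hδ : 0 < R / √((m : ℝ) + 1) := by positivity
  have hd : ∀ t, HasDerivAt (fun t => ψ (L (insertCoord i t y)) ^ 2)
      (2 * ψ (L (insertCoord i t y)) *
        fderiv ℝ ψ (L (insertCoord i t y)) (L (EuclideanSpace.single i 1))) t := fun t => by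
    have h1 : HasDerivAt (fun t : ℝ => L (insertCoord i t y)) (L (EuclideanSpace.single i 1)) t := by
      have h2 : HasDerivAt (fun t : ℝ => insertCoord i t y) (EuclideanSpace.single i 1) t := by
        have h4 := ((hasDerivAt_id t).smul_const (EuclideanSpace.single i (1 : ℝ))).add_const
          (insertCoord i 0 y)
        rw [one_smul] at h4
        exact h4.congr_of_eventuallyEq (Eventually.of_forall fun t => insertCoord_eq i t y)
      exact L.hasFDerivAt.comp_hasDerivAt t h2
    have h3 := ((hψ.differentiable (by simp) (L (insertCoord i t y))).hasFDerivAt.comp_hasDerivAt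
      t h1).fun_pow 2
    simpa using h3
  have hline : Continuous (fun t => L (insertCoord i t y)) :=
    L.continuous.comp ((continuous_insertCoord i).comp (Continuous.prodMk continuous_id
      continuous_const))
  have hcont : Continuous (fun t => 2 * ψ (L (insertCoord i t y)) *
        fderiv ℝ ψ (L (insertCoord i t y)) (L (EuclideanSpace.single i 1))) :=
    (continuous_const.mul (hψ.continuous.comp hline)).mul
      (((hψ.continuous_fderiv (by simp)).comp hline).clm_apply continuous_const)
  -- The one-dimensional inequality is applied to ψ² along the vertical segment below the patch and
  -- its mirror image, which stays in the ball.
  refine (ofReal_le_lintegral_of_hasDerivAt hd hcont (fun t => sq_nonneg _) hδ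
    (hδs.trans_eq hsa.symm)).trans ?_
  rw [← lintegral_indicator measurableSet_Icc]
  refine lintegral_mono fun t => ?_
  by_cases ht : t ∈ Set.Icc (-|s|) |s|
  · have hmem : insertCoord i t y ∈ B := by
      have h1 : t ^ 2 ≤ R ^ 2 - ‖y‖ ^ 2 := by
        have h2 := pow_le_pow_left₀ (abs_nonneg t) (abs_le.2 ht) 2
        rw [hsa, sq_abs, Real.sq_sqrt (Real.sqrt_pos.1 (hδ.trans_le hδs)).le] at h2
        exact h2
      refine abs_le_of_sq_le_sq' ?_ hR.le |>.2
      rw [norm_sq_insertCoord]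
      linarith
    rw [Set.indicator_of_mem ht, Set.indicator_of_mem hmem, he, ← ENNReal.ofReal_mul hA0]
    refine ENNReal.ofReal_le_ofReal ?_
    set x := L (insertCoord i t y) with hx
    set w := L (EuclideanSpace.single i (1 : ℝ)) with hw
    have hwn : ‖w‖ ≤ ‖L‖ := by simpa using L.le_opNorm (EuclideanSpace.single i (1 : ℝ))
    have h1 : ψ x ^ 2 ≤ energyDensity ψ x := by
      unfold energyDensity
      exact le_add_of_nonneg_right (by positivity)
    have h2 : fderiv ℝ ψ x w ^ 2 ≤ ‖L‖ ^ 2 * energyDensity ψ x :=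
      (sq_fderiv_apply_le x w).trans (by
        gcongr
        exact energyDensity_nonneg x)
    have h3 : |2 * ψ x * fderiv ℝ ψ x w| ≤ ψ x ^ 2 + fderiv ℝ ψ x w ^ 2 := by
      rw [abs_le]
      constructor <;> nlinarith [sq_nonneg (ψ x + fderiv ℝ ψ x w), sq_nonneg (ψ x - fderiv ℝ ψ x w)]
    have h4 : ψ x ^ 2 / (R / √((m : ℝ) + 1)) ≤ √((m : ℝ) + 1) * (1 / R) * energyDensity ψ x := by
      have : ψ x ^ 2 / (R / √((m : ℝ) + 1)) = √((m : ℝ) + 1) * (1 / R) * ψ x ^ 2 := by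
        field_simp
      rw [this]
      gcongr
    have h5 := energyDensity_nonneg (ψ := ψ) x
    have h6 : 0 < 1 / R := by positivity
    calc ψ x ^ 2 / (R / √((m : ℝ) + 1)) + |2 * ψ x * fderiv ℝ ψ x w|
        ≤ √((m : ℝ) + 1) * (1 / R) * energyDensity ψ x +
          (energyDensity ψ x + ‖L‖ ^ 2 * energyDensity ψ x) := by linarith
      _ ≤ A * energyDensity ψ x := by
        rw [hA]
        have : 0 ≤ (√((m : ℝ) + 1) + (1 + ‖L‖ ^ 2) * (1 / R)) * energyDensity ψ x := by positivity
        linarith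
  · rw [Set.indicator_of_notMem ht]
    exact zero_le

end Patch

lemma eLpNorm_two_eq_lintegral_sq {X : Type*} [MeasurableSpace X] {μ : Measure X} (f : X → ℝ) :
    eLpNorm f 2 μ = (∫⁻ x, ENNReal.ofReal (f x ^ 2) ∂μ) ^ (1 / 2 : ℝ) := by
  rw [eLpNorm_eq_lintegral_rpow_enorm_toReal (by norm_num) (by norm_num)]
  norm_num
  congr 1
  refine lintegral_congr fun x => ?_
  rw [← ofReal_norm, ← ENNReal.ofReal_pow (norm_nonneg _), Real.norm_eq_abs, sq_abs]

lemma eLpNorm_two_sq {X : Type*} [MeasurableSpace X] {μ : Measure X} (f : X → ℝ) :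
    eLpNorm f 2 μ ^ 2 = ∫⁻ x, ENNReal.ofReal (f x ^ 2) ∂μ := by
  rw [eLpNorm_two_eq_lintegral_sq, ← ENNReal.rpow_natCast, ← ENNReal.rpow_mul]
  norm_num

/-! ### Level sets of the potential and weighted trace estimates -/

namespace EigenData

variable {n : ℕ} {c : ℝ} {Γ : Matrix (Fin n) (Fin n) ℝ} {v : OrthonormalBasis (Fin n) ℝ (E n)}
  {l : Fin n → ℝ} {u : Fin n → E n} (h : EigenData c Γ v l u)

include h

/-- L inverts x ↦ (⟨`u k`, x⟩)_k, so it carries the sphere of radius √r onto the level set of height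
r. -/
lemma exists_ellipsoid_map : ∃ L : E n →L[ℝ] E n, (∀ z, potential c Γ (L z) = ‖z‖ ^ 2) ∧
    ∀ x, ∃ z, L z = x := by
  have hs : ∀ k, 0 < √(l k / 2) := fun k => Real.sqrt_pos.2 (half_pos (h.pos k))
  let L : E n →ₗ[ℝ] E n :=
    { toFun := fun z => ∑ k, z k • ((√(l k / 2))⁻¹ • v k)
      map_add' := fun z w => by simp [add_smul, Finset.sum_add_distrib]
      map_smul' := fun a z => by simp [mul_smul, Finset.smul_sum] }
  have hL : ∀ k z, inner ℝ (u k) (L z) = z k := fun k z => by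
    change inner ℝ (u k) (∑ j, z j • ((√(l j / 2))⁻¹ • v j)) = z k
    rw [inner_sum, Finset.sum_eq_single k]
    · rw [h.u_eq, real_inner_smul_left, real_inner_smul_right, real_inner_smul_right,
        real_inner_self_eq_norm_sq, v.orthonormal.1 k]
      have := (hs k).ne'
      field_simp
    · intro j _ hj
      rw [h.u_eq, real_inner_smul_left, real_inner_smul_right, real_inner_smul_right,
        v.orthonormal.2 hj.symm]
      simp
    · simp
  refine ⟨LinearMap.toContinuousLinearMap L, fun z => ?_, fun x => ?_⟩
  · rw [h.potential_eq, EuclideanSpace.norm_sq_eq]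
    refine Finset.sum_congr rfl fun k _ => ?_
    rw [LinearMap.coe_toContinuousLinearMap', hL, Real.norm_eq_abs, sq_abs]
  · refine ⟨WithLp.toLp 2 fun k => inner ℝ (u k) x, ?_⟩
    rw [LinearMap.coe_toContinuousLinearMap']
    conv_rhs => rw [← v.sum_repr' x]
    change ∑ k, inner ℝ (u k) x • ((√(l k / 2))⁻¹ • v k) = _
    refine Finset.sum_congr rfl fun k _ => ?_
    rw [h.u_eq, real_inner_smul_left, smul_smul]
    congr 1
    have := (hs k).ne'
    field_simp

lemma contDiff_potential : ContDiff ℝ ∞ (potential c Γ) := by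
  have : potential c Γ = fun x => ∑ k, inner ℝ (u k) x ^ 2 := funext h.potential_eq
  rw [this]
  exact ContDiff.sum fun k _ => (contDiff_const.inner ℝ contDiff_id).pow 2

omit h in
lemma measurableSet_levelSet (r : ℝ) : MeasurableSet (levelSet c Γ r) :=
  (isClosed_eq (continuous_potential c Γ) continuous_const).measurableSet

/-- The trace inequality on the level sets of `φ`. -/
theorem exists_trace_inequality (hn : 0 < n) : ∃ C : ℝ≥0∞, C ≠ ⊤ ∧ ∀ r, 0 < r →
    ∀ ψ : E n → ℝ, ContDiff ℝ ∞ ψ →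
      ∫⁻ x, ENNReal.ofReal (ψ x ^ 2) ∂surfaceMeasure c Γ r ≤ C * ENNReal.ofReal (1 + 1 / √r) *
        ∫⁻ x in {x | potential c Γ x ≤ r}, ENNReal.ofReal (energyDensity ψ x) := by
  obtain ⟨m, rfl⟩ := Nat.exists_eq_add_one.2 hn
  obtain ⟨L, hLφ, hLs⟩ := h.exists_ellipsoid_map
  have hdet : LinearMap.det (L : E (m + 1) →ₗ[ℝ] E (m + 1)) ≠ 0 := by
    have hsurj : Function.Surjective (L : E (m + 1) →ₗ[ℝ] E (m + 1)) := hLs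
    have hbij : Function.Bijective (L : E (m + 1) →ₗ[ℝ] E (m + 1)) :=
      ⟨LinearMap.injective_iff_surjective.2 hsurj, hsurj⟩
    exact (LinearEquiv.isUnit_det' (LinearEquiv.ofBijective _ hbij)).ne_zero
  set q : ℝ≥0∞ := ENNReal.ofReal |(LinearMap.det (L : E (m + 1) →ₗ[ℝ] E (m + 1)))⁻¹| with hq
  set K : ℝ≥0∞ := ((‖L‖₊ * ⟨√(m + 2), Real.sqrt_nonneg _⟩ : ℝ≥0) : ℝ≥0∞) ^ m with hK
  set A : ℝ := √(m + 1) + 1 + ‖L‖ ^ 2 with hA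
  have hA0 : 0 ≤ A := by positivity
  -- One patch for each coordinate and sign.
  let ι := Fin (m + 1) × ({1, -1} : Finset ℝ)
  refine ⟨Fintype.card ι * (K * (ENNReal.ofReal A * q)), ?_, fun r hr ψ hψ => ?_⟩
  · refine ENNReal.mul_ne_top (by simp) (ENNReal.mul_ne_top ?_
      (ENNReal.mul_ne_top ENNReal.ofReal_ne_top ENNReal.ofReal_ne_top))
    exact ENNReal.pow_ne_top ENNReal.coe_ne_top
  have hR : 0 < √r := Real.sqrt_pos.2 hr
  have hR2 : √r ^ 2 = r := Real.sq_sqrt hr.le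
  let S : ι → Set (E (m + 1)) := fun p =>
    (fun y => L (spherePatch p.1 p.2 (√r) y)) '' patchDomain m (√r)
  have hcover : levelSet c Γ r ⊆ ⋃ p, S p := fun x hx => by
    obtain ⟨z, rfl⟩ := hLs x
    have hz : ‖z‖ ^ 2 = √r ^ 2 := by
      rw [hR2, ← hLφ]
      exact hx
    obtain ⟨i, σ, hσ, y, hy, rfl⟩ := mem_image_spherePatch hz
    exact Set.mem_iUnion.2 ⟨(i, ⟨σ, hσ⟩), y, hy, rfl⟩
  set e : E (m + 1) → ℝ≥0∞ := fun x => ENNReal.ofReal (energyDensity ψ x) with he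
  have hem : Measurable e := (continuous_energyDensity hψ).measurable.ennreal_ofReal
  set U := {x : E (m + 1) | potential c Γ x ≤ r} with hU
  have hUm : MeasurableSet U :=
    (isClosed_le (continuous_potential c Γ) continuous_const).measurableSet
  -- Linear change of variables: the Jacobian `q` does not depend on r.
  have hJ : ∫⁻ z in {z | ‖z‖ ≤ √r}, e (L z) = q * ∫⁻ x in U, e x := by
    have hpre : {z : E (m + 1) | ‖z‖ ≤ √r} = L ⁻¹' U := by
      ext z
      change ‖z‖ ≤ √r ↔ potential c Γ (L z) ≤ r
      rw [hLφ]
      exact Real.le_sqrt (norm_nonneg z) hr.le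
    rw [hpre, ← setLIntegral_map hUm hem L.continuous.measurable]
    have hmap := Measure.map_linearMap_addHaar_eq_smul_addHaar
      (volume : Measure (E (m + 1))) hdet
    change ∫⁻ x in U, e x ∂(Measure.map (L : E (m + 1) →ₗ[ℝ] E (m + 1)) volume) = _
    rw [hmap, Measure.restrict_smul, lintegral_smul_measure, smul_eq_mul]
  have hpatch : ∀ p : ι, ∫⁻ x in S p, ENNReal.ofReal (ψ x ^ 2)
      ∂Measure.euclideanHausdorffMeasure m ≤
        K * (ENNReal.ofReal A * q) * ENNReal.ofReal (1 + 1 / √r) * ∫⁻ x in U, e x := by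
    rintro ⟨i, σ, hσ⟩
    have hσ1 : |σ| = 1 := by
      rcases Finset.mem_insert.1 hσ with h1 | h1
      · simp [h1]
      · simp [Finset.mem_singleton.1 h1]
    refine (lintegral_patch_le L i hσ1 hR hψ).trans (le_of_eq ?_)
    rw [hJ, ENNReal.ofReal_mul hA0]
    ring
  rw [surfaceMeasure]
  calc ∫⁻ x in levelSet c Γ r, ENNReal.ofReal (ψ x ^ 2) ∂Measure.euclideanHausdorffMeasure m
      ≤ ∫⁻ x in ⋃ p, S p, ENNReal.ofReal (ψ x ^ 2) ∂Measure.euclideanHausdorffMeasure m :=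
        lintegral_mono_set hcover
    _ ≤ ∑' p, ∫⁻ x in S p, ENNReal.ofReal (ψ x ^ 2) ∂Measure.euclideanHausdorffMeasure m :=
        lintegral_iUnion_le _ _
    _ ≤ ∑ _p : ι, K * (ENNReal.ofReal A * q) * ENNReal.ofReal (1 + 1 / √r) * ∫⁻ x in U, e x := by
        rw [tsum_fintype]
        exact Finset.sum_le_sum fun p _ => hpatch p
    _ = _ := by
        rw [Finset.sum_const, nsmul_eq_mul, Finset.card_univ]
        ring

/-- The trace inequality in terms of `e^{-sφ}`-weighted norms. -/
lemma exists_eLpNorm_trace_le (hn : 0 < n) : ∃ D : ℝ → ℝ≥0∞, (∀ r, D r ≠ ⊤) ∧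
    (∃ D₁ : ℝ≥0∞, D₁ ≠ ⊤ ∧ ∀ r, 1 ≤ r → D r ≤ D₁) ∧ ∀ r, 0 < r → ∀ s, 0 ≤ s →
    ∀ ψ : E n → ℝ, ContDiff ℝ ∞ ψ → eLpNorm ψ 2 (surfaceMeasure c Γ r) ≤
      D r * ENNReal.ofReal (Real.exp (s * r / 2)) *
        (∫⁻ x, ENNReal.ofReal (Real.exp (-(s * potential c Γ x))) *
          ENNReal.ofReal (energyDensity ψ x)) ^ (1 / 2 : ℝ) := by
  obtain ⟨C, hC, htr⟩ := h.exists_trace_inequality hn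
  refine ⟨fun r => (C * ENNReal.ofReal (1 + 1 / √r)) ^ (1 / 2 : ℝ), fun r => ?_,
    ⟨(C * ENNReal.ofReal 2) ^ (1 / 2 : ℝ), ?_, fun r hr => ?_⟩, fun r hr s hs ψ hψ => ?_⟩
  · exact ENNReal.rpow_ne_top_of_nonneg (by norm_num) (ENNReal.mul_ne_top hC ENNReal.ofReal_ne_top)
  · exact ENNReal.rpow_ne_top_of_nonneg (by norm_num) (ENNReal.mul_ne_top hC ENNReal.ofReal_ne_top)
  · have h1 : 1 ≤ √r := Real.one_le_sqrt.2 hr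
    have h2 : 1 / √r ≤ 1 := (div_le_one (by linarith)).2 h1
    refine ENNReal.rpow_le_rpow (mul_le_mul_right (ENNReal.ofReal_le_ofReal ?_) C) (by norm_num)
    linarith
  · have hexp : ENNReal.ofReal (Real.exp (s * r / 2)) =
        (ENNReal.ofReal (Real.exp (s * r))) ^ (1 / 2 : ℝ) := by
      rw [ENNReal.ofReal_rpow_of_pos (Real.exp_pos _), ← Real.exp_mul]
      congr 2
      ring
    rw [eLpNorm_two_eq_lintegral_sq, hexp, ← ENNReal.mul_rpow_of_nonneg _ _ (by norm_num),
      ← ENNReal.mul_rpow_of_nonneg _ _ (by norm_num)]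
    refine ENNReal.rpow_le_rpow ((htr r hr ψ hψ).trans ?_) (by norm_num)
    rw [mul_assoc (C * _)]
    gcongr
    rw [← lintegral_const_mul' _ _ ENNReal.ofReal_ne_top]
    -- Where φ ≤ r and s ≥ 0, one has 1 ≤ e^{sr} e^{-sφ}.
    refine (setLIntegral_mono' (isClosed_le (continuous_potential c Γ)
      continuous_const).measurableSet fun x hx => ?_).trans (setLIntegral_le_lintegral _ _)
    rw [← mul_assoc, ← ENNReal.ofReal_mul (Real.exp_pos _).le, ← Real.exp_add]
    refine le_mul_of_one_le_left' ?_
    rw [ENNReal.one_le_ofReal]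
    refine Real.one_le_exp ?_
    have hx' : potential c Γ x ≤ r := hx
    nlinarith [mul_le_mul_of_nonneg_left hx' hs]

end EigenData

/-- The norm of a smooth function in `V`. -/
noncomputable def sobolevNorm {n : ℕ} (c : ℝ) (Γ : Matrix (Fin n) (Fin n) ℝ) (ψ : E n → ℝ) : ℝ≥0∞ :=
  eLpNorm ψ 2 (weightedMeasure c Γ) + ∑ i, eLpNorm (fun x => fderiv ℝ ψ x
    (EuclideanSpace.single i 1)) 2 (weightedMeasure c Γ)

lemma lintegral_energyDensity_le {n : ℕ} {c : ℝ} {Γ : Matrix (Fin n) (Fin n) ℝ} {ψ : E n → ℝ}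
    (hψ : ContDiff ℝ ∞ ψ) :
    (∫⁻ x, ENNReal.ofReal (Real.exp (-potential c Γ x)) *
      ENNReal.ofReal (energyDensity ψ x)) ^ (1 / 2 : ℝ) ≤ sobolevNorm c Γ ψ := by
  have hd : ∀ j : Fin n, Continuous (fun x => fderiv ℝ ψ x (EuclideanSpace.single j 1)) :=
    fun j => (hψ.continuous_fderiv (by simp)).clm_apply continuous_const
  have e : ∫⁻ x, ENNReal.ofReal (Real.exp (-potential c Γ x)) *
      ENNReal.ofReal (energyDensity ψ x) = eLpNorm ψ 2 (weightedMeasure c Γ) ^ 2 +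
        ∑ i, eLpNorm (fun x => fderiv ℝ ψ x (EuclideanSpace.single i 1)) 2
          (weightedMeasure c Γ) ^ 2 := by
    rw [← lintegral_weighted]
    simp only [eLpNorm_two_sq]
    have hm : ∀ i ∈ (Finset.univ : Finset (Fin n)), Measurable fun x =>
      ENNReal.ofReal (fderiv ℝ ψ x (EuclideanSpace.single i 1) ^ 2) :=
        fun i _ => ((hd i).pow 2).measurable.ennreal_ofReal
    have hm0 : Measurable fun x => ENNReal.ofReal (ψ x ^ 2) :=
      (hψ.continuous.pow 2).measurable.ennreal_ofReal
    rw [← lintegral_finsetSum _ hm, ← lintegral_add_left hm0]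
    refine lintegral_congr fun x => ?_
    rw [energyDensity, ENNReal.ofReal_add (sq_nonneg _) (Finset.sum_nonneg fun i _ => sq_nonneg _),
      ENNReal.ofReal_sum_of_nonneg fun i _ => sq_nonneg _]
  have hle : eLpNorm ψ 2 (weightedMeasure c Γ) ^ 2 +
        ∑ i, eLpNorm (fun x => fderiv ℝ ψ x (EuclideanSpace.single i 1)) 2
          (weightedMeasure c Γ) ^ 2 ≤ sobolevNorm c Γ ψ ^ 2 := by
    have h1 := Finset.sum_sq_le_sq_sum_of_nonneg (s := Finset.univ)
      (f := fun o : Option (Fin n) => o.elim (eLpNorm ψ 2 (weightedMeasure c Γ))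
        fun i => eLpNorm (fun x => fderiv ℝ ψ x (EuclideanSpace.single i 1)) 2
          (weightedMeasure c Γ)) fun _ _ => zero_le
    simpa [Fintype.sum_option, sobolevNorm] using h1
  rw [e]
  refine (ENNReal.rpow_le_rpow hle (by norm_num)).trans (le_of_eq ?_)
  rw [← ENNReal.rpow_natCast, ← ENNReal.rpow_mul]
  norm_num

/-! ### Traces -/

section TraceLimit

variable {n : ℕ} {c : ℝ} {Γ : Matrix (Fin n) (Fin n) ℝ}

lemma eLpNorm_le_add_eLpNorm_sub {X : Type*} [MeasurableSpace X] {μ : Measure X} {f g : X → ℝ}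
    (hf : AEStronglyMeasurable f μ) (hg : AEStronglyMeasurable g μ) :
    eLpNorm f 2 μ ≤ eLpNorm (f - g) 2 μ + eLpNorm g 2 μ := by
  have h := eLpNorm_add_le (p := 2) (hf.sub hg) hg (by norm_num)
  rwa [sub_add_cancel] at h

lemma eLpNorm_sub_le_add {X : Type*} [MeasurableSpace X] {μ : Measure X} {f g k : X → ℝ}
    (hf : AEStronglyMeasurable f μ) (hg : AEStronglyMeasurable g μ)
    (hk : AEStronglyMeasurable k μ) :
    eLpNorm (f - g) 2 μ ≤ eLpNorm (f - k) 2 μ + eLpNorm (g - k) 2 μ := by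
  have h := eLpNorm_sub_le (p := 2) (hf.sub hk) (hg.sub hk) (by norm_num)
  rwa [sub_sub_sub_cancel_right] at h

variable (c Γ) in
/-- The `V`-distance of a smooth function `ψ` and `w ∈ V`. -/
noncomputable def sobolevDist (ψ : E n → ℝ) (w : sobolev c Γ) : ℝ≥0∞ :=
  eLpNorm (ψ - ⇑(w : WeightedL2 c Γ)) 2 (weightedMeasure c Γ) + ∑ i, eLpNorm
    ((fun x => fderiv ℝ ψ x (EuclideanSpace.single i 1)) - ⇑(weakPartial c Γ i w)) 2
      (weightedMeasure c Γ)

variable (c Γ) in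
/-- The norm of `w ∈ V`. -/
noncomputable def sobolevNormV (w : sobolev c Γ) : ℝ≥0∞ :=
  eLpNorm (w : WeightedL2 c Γ) 2 (weightedMeasure c Γ) + ∑ i, eLpNorm (weakPartial c Γ i w) 2
      (weightedMeasure c Γ)

lemma sobolevNormV_ne_top (w : sobolev c Γ) : sobolevNormV c Γ w ≠ ⊤ :=
  ENNReal.add_ne_top.2 ⟨Lp.eLpNorm_ne_top _, ENNReal.sum_ne_top.2 fun _ _ => Lp.eLpNorm_ne_top _⟩

lemma continuous_partial {ψ : E n → ℝ} (hψ : ContDiff ℝ ∞ ψ) (i : Fin n) :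
    Continuous (fun x => fderiv ℝ ψ x (EuclideanSpace.single i 1)) :=
  (hψ.continuous_fderiv (by simp)).clm_apply continuous_const

lemma sobolevNorm_le {ψ : E n → ℝ} (hψ : ContDiff ℝ ∞ ψ) (w : sobolev c Γ) :
    sobolevNorm c Γ ψ ≤ sobolevDist c Γ ψ w + sobolevNormV c Γ w := by
  rw [sobolevNorm, sobolevDist, sobolevNormV, add_add_add_comm, ← Finset.sum_add_distrib]
  exact add_le_add (eLpNorm_le_add_eLpNorm_sub hψ.continuous.aestronglyMeasurable
    (Lp.aestronglyMeasurable _)) (Finset.sum_le_sum fun i _ => eLpNorm_le_add_eLpNorm_sub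
      (continuous_partial hψ i).aestronglyMeasurable (Lp.aestronglyMeasurable _))

lemma sobolevNorm_sub_le {ψ χ : E n → ℝ} (hψ : ContDiff ℝ ∞ ψ) (hχ : ContDiff ℝ ∞ χ)
    (w : sobolev c Γ) :
    sobolevNorm c Γ (ψ - χ) ≤ sobolevDist c Γ ψ w + sobolevDist c Γ χ w := by
  rw [sobolevNorm, sobolevDist, sobolevDist, add_add_add_comm, ← Finset.sum_add_distrib]
  refine add_le_add (eLpNorm_sub_le_add hψ.continuous.aestronglyMeasurable
    hχ.continuous.aestronglyMeasurable
    (Lp.aestronglyMeasurable _)) (Finset.sum_le_sum fun i _ => ?_)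
  have e : (fun x => fderiv ℝ (ψ - χ) x (EuclideanSpace.single i 1)) =
      (fun x => fderiv ℝ ψ x (EuclideanSpace.single i 1)) -
        fun x => fderiv ℝ χ x (EuclideanSpace.single i 1) := by
    funext x
    rw [fderiv_sub (hψ.differentiable (by simp) x) (hχ.differentiable (by simp) x)]
    rfl
  rw [e]
  exact eLpNorm_sub_le_add (continuous_partial hψ i).aestronglyMeasurable
    (continuous_partial hχ i).aestronglyMeasurable (Lp.aestronglyMeasurable _)

lemma tendsto_sobolevDist {ψ : ℕ → E n → ℝ} {w : sobolev c Γ}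
    (h1 : Tendsto (fun k => eLpNorm (ψ k - ⇑(w : WeightedL2 c Γ)) 2 (weightedMeasure c Γ))
      atTop (𝓝 0))
    (h2 : ∀ i, Tendsto (fun k => eLpNorm
      ((fun x => fderiv ℝ (ψ k) x (EuclideanSpace.single i 1)) - ⇑(weakPartial c Γ i w)) 2
      (weightedMeasure c Γ)) atTop (𝓝 0)) :
    Tendsto (fun k => sobolevDist c Γ (ψ k) w) atTop (𝓝 0) := by
  have := h1.add (tendsto_finsetSum Finset.univ fun i _ => h2 i)
  simpa using! this

lemma sobolevDist_test_ne_top {ψ : E n → ℝ} (hψ : ContDiff ℝ ∞ ψ) (hs : HasCompactSupport ψ)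
    (w : sobolev c Γ) : sobolevDist c Γ ψ w ≠ ⊤ := by
  refine ENNReal.add_ne_top.2 ⟨?_, ENNReal.sum_ne_top.2 fun i _ => ?_⟩
  · exact ((test_memLp c Γ hψ.continuous hs).sub (Lp.memLp _)).eLpNorm_ne_top
  · exact ((test_memLp c Γ (test_deriv hψ hs _).1 (test_deriv hψ hs _).2).sub
      (Lp.memLp _)).eLpNorm_ne_top

/-- Existence of traces from a trace inequality and density of test functions. -/
lemma exists_isTrace_of_le {r : ℝ} {D : ℝ≥0∞} (hD : D ≠ ⊤)
    (htr : ∀ ψ : E n → ℝ, ContDiff ℝ ∞ ψ →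
      eLpNorm ψ 2 (surfaceMeasure c Γ r) ≤ D * sobolevNorm c Γ ψ) {w : sobolev c Γ}
    (happ : ∃ ψ : ℕ → E n → ℝ,
      (∀ k, ContDiff ℝ ∞ (ψ k) ∧ HasCompactSupport (ψ k)) ∧
      Tendsto (fun k => eLpNorm (ψ k - ⇑(w : WeightedL2 c Γ)) 2 (weightedMeasure c Γ))
        atTop (𝓝 0) ∧
      (∀ i, Tendsto (fun k => eLpNorm
        ((fun x => fderiv ℝ (ψ k) x (EuclideanSpace.single i 1)) - ⇑(weakPartial c Γ i w)) 2
        (weightedMeasure c Γ)) atTop (𝓝 0))) : ∃ g, IsTrace r w g := by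
  obtain ⟨ψ, hψ, h1, h2⟩ := happ
  have hdist := tendsto_sobolevDist h1 h2
  have hm : ∀ k, MemLp (ψ k) 2 (surfaceMeasure c Γ r) := fun k => by
    refine ⟨(hψ k).1.continuous.aestronglyMeasurable, (htr _ (hψ k).1).trans_lt ?_⟩
    refine ENNReal.mul_lt_top hD.lt_top ((sobolevNorm_le (hψ k).1 w).trans_lt ?_)
    exact (ENNReal.add_ne_top.2 ⟨sobolevDist_test_ne_top (hψ k).1 (hψ k).2 w,
      sobolevNormV_ne_top w⟩).lt_top
  -- The trace inequality applied to differences turns convergence in V into a Cauchy sequence in L²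
  -- of the level set.
  have hcauchy : CauchySeq fun k => (hm k).toLp (ψ k) := by
    rw [Lp.cauchySeq_Lp_iff_cauchySeq_eLpNorm]
    have hlim : Tendsto (fun p : ℕ × ℕ => D * (sobolevDist c Γ (ψ p.1) w +
        sobolevDist c Γ (ψ p.2) w)) atTop (𝓝 0) := by
      have ha : Tendsto (fun p : ℕ × ℕ => sobolevDist c Γ (ψ p.1) w) atTop (𝓝 0) :=
        hdist.comp (by rw [← prod_atTop_atTop_eq]; exact tendsto_fst)
      have hb : Tendsto (fun p : ℕ × ℕ => sobolevDist c Γ (ψ p.2) w) atTop (𝓝 0) :=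
        hdist.comp (by rw [← prod_atTop_atTop_eq]; exact tendsto_snd)
      have := ENNReal.Tendsto.const_mul (ha.add hb) (Or.inr hD)
      simpa using this
    refine tendsto_of_tendsto_of_tendsto_of_le_of_le tendsto_const_nhds hlim
      (fun _ => zero_le) fun p => ?_
    have e : eLpNorm (⇑((hm p.1).toLp (ψ p.1)) - ⇑((hm p.2).toLp (ψ p.2))) 2
        (surfaceMeasure c Γ r) = eLpNorm (ψ p.1 - ψ p.2) 2 (surfaceMeasure c Γ r) :=
      eLpNorm_congr_ae ((hm p.1).coeFn_toLp.sub (hm p.2).coeFn_toLp)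
    change eLpNorm (⇑((hm p.1).toLp (ψ p.1)) - ⇑((hm p.2).toLp (ψ p.2))) 2
        (surfaceMeasure c Γ r) ≤ _
    rw [e]
    refine (htr _ ((hψ p.1).1.sub (hψ p.2).1)).trans ?_
    gcongr
    exact sobolevNorm_sub_le (hψ p.1).1 (hψ p.2).1 w
  obtain ⟨G, hG⟩ := cauchySeq_tendsto_of_complete hcauchy
  refine ⟨G, Lp.memLp G, ψ, hψ, h1, h2, ?_⟩
  refine ((Lp.tendsto_Lp_iff_tendsto_eLpNorm' _ _).1 hG).congr fun k => eLpNorm_congr_ae ?_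
  exact (hm k).coeFn_toLp.sub (ae_eq_refl _)

/-- The inequality passes to the limit along any approximating sequence, so it holds for every trace
and not only for a constructed one. -/
lemma OUForm.IsTrace.eLpNorm_le {r : ℝ} {D : ℝ≥0∞} (hD : D ≠ ⊤)
    (htr : ∀ ψ : E n → ℝ, ContDiff ℝ ∞ ψ →
      eLpNorm ψ 2 (surfaceMeasure c Γ r) ≤ D * sobolevNorm c Γ ψ) {w : sobolev c Γ}
    {g : E n → ℝ} (hg : IsTrace r w g) :
    eLpNorm g 2 (surfaceMeasure c Γ r) ≤ D * sobolevNormV c Γ w := by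
  obtain ⟨ψ, hψ, h1, h2, h3⟩ := hg.exists_approx
  have hdist := tendsto_sobolevDist h1 h2
  have hlim : Tendsto (fun k => eLpNorm (ψ k - g) 2 (surfaceMeasure c Γ r) +
      D * (sobolevDist c Γ (ψ k) w + sobolevNormV c Γ w)) atTop
        (𝓝 (0 + D * (0 + sobolevNormV c Γ w))) :=
    h3.add (ENNReal.Tendsto.const_mul (hdist.add tendsto_const_nhds) (Or.inr hD))
  rw [zero_add, zero_add] at hlim
  refine ge_of_tendsto' hlim fun k => ?_
  have hk := (hψ k).1.continuous.aestronglyMeasurable (μ := surfaceMeasure c Γ r)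
  have h4 := eLpNorm_le_add_eLpNorm_sub hg.memLp.1 hk
  rw [eLpNorm_sub_comm] at h4
  refine h4.trans ?_
  gcongr
  refine (htr _ (hψ k).1).trans ?_
  gcongr
  exact sobolevNorm_le (hψ k).1 w

end TraceLimit

namespace EigenData

variable {n : ℕ} {c : ℝ} {Γ : Matrix (Fin n) (Fin n) ℝ} {v : OrthonormalBasis (Fin n) ℝ (E n)}
  {l : Fin n → ℝ} {u : Fin n → E n} (h : EigenData c Γ v l u)

include h

lemma measurable_outwardNormal : Measurable (outwardNormal c Γ) := by
  have hg : Continuous (gradient (potential c Γ)) := by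
    have : gradient (potential c Γ) = fun x =>
      (InnerProductSpace.toDual ℝ (E n)).symm (fderiv ℝ (potential c Γ) x) := rfl
    rw [this]
    exact (LinearIsometryEquiv.continuous _).comp (h.contDiff_potential.continuous_fderiv (by simp))
  exact (hg.norm.measurable.inv).smul hg.measurable

omit h in
lemma abs_outwardNormal_apply_le (x : E n) (j : Fin n) : |outwardNormal c Γ x j| ≤ 1 := by
  refine (PiLp.norm_apply_le (outwardNormal c Γ x) j).trans ?_
  rw [outwardNormal, norm_smul, norm_inv, norm_norm]
  -- This includes a vanishing gradient, where the inverse of zero is zero.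
  exact inv_mul_le_one

/-- The weight of the `j`-th component in the boundary integrand. -/
lemma eLpNorm_weight_le {r : ℝ} (α : Fin n → ℕ) (j : Fin n) :
    AEStronglyMeasurable (fun x => Real.exp (-potential c Γ x) * hermiteProd u α x *
      outwardNormal c Γ x j) (surfaceMeasure c Γ r) ∧
    eLpNorm (fun x => Real.exp (-potential c Γ x) * hermiteProd u α x * outwardNormal c Γ x j) 2
      (surfaceMeasure c Γ r) ≤ ENNReal.ofReal (Real.exp (-r)) *
        eLpNorm (hermiteProd u α) 2 (surfaceMeasure c Γ r) := by
  have hc1 := (contDiff_hermiteProd u α).continuous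
  have hc2 := continuous_potential c Γ
  have hn : Measurable fun x => outwardNormal c Γ x j :=
    (PiLp.continuous_apply 2 _ j).measurable.comp h.measurable_outwardNormal
  refine ⟨((hc2.neg.rexp.mul hc1).measurable.mul hn).aestronglyMeasurable, ?_⟩
  have hle : ∀ᵐ x ∂surfaceMeasure c Γ r, ‖Real.exp (-potential c Γ x) * hermiteProd u α x *
      outwardNormal c Γ x j‖ ≤ Real.exp (-r) * ‖hermiteProd u α x‖ := by
    filter_upwards [ae_restrict_mem (measurableSet_levelSet r)] with x hx
    have hx' : potential c Γ x = r := hx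
    rw [hx', norm_mul, norm_mul, Real.norm_of_nonneg (Real.exp_pos _).le]
    exact mul_le_of_le_one_right (by positivity) (abs_outwardNormal_apply_le x j)
  exact eLpNorm_le_mul_eLpNorm_of_ae_le_mul hle 2

/-- Cauchy–Schwarz on the level set, where the weight is the constant e^{-r}. Using the same weight
e^{-φ} for both factors would only cancel this; H_α also has finite energy for e^{-φ/2}, and the
smaller loss there leaves decay. -/
theorem trace_and_boundary_limit (hn : 0 < n) (w : Fin n → sobolev c Γ) :
    (∀ r, 0 < r → ∀ j, ∃ g, IsTrace r (w j) g) ∧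
      ∀ g : ℝ → Fin n → EuclideanSpace ℝ (Fin n) → ℝ,
        (∀ r, 0 < r → ∀ j, IsTrace r (w j) (g r j)) → ∀ α : Fin n → ℕ,
          (∀ r, 0 < r → Integrable (fun x => Real.exp (-potential c Γ x) * hermiteProd u α x *
            inner ℝ (WithLp.toLp 2 fun j => g r j x) (outwardNormal c Γ x))
            (surfaceMeasure c Γ r)) ∧
          Tendsto (fun r => ∫ x, Real.exp (-potential c Γ x) * hermiteProd u α x *
            inner ℝ (WithLp.toLp 2 fun j => g r j x) (outwardNormal c Γ x)
            ∂(surfaceMeasure c Γ r)) atTop (𝓝 0) := by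
  obtain ⟨D, hD, ⟨D₁, hD₁, hDD₁⟩, htr⟩ := h.exists_eLpNorm_trace_le hn
  have htr1 : ∀ r, 0 < r → ∀ ψ : E n → ℝ, ContDiff ℝ ∞ ψ → eLpNorm ψ 2 (surfaceMeasure c Γ r) ≤
      (D r * ENNReal.ofReal (Real.exp (r / 2))) * sobolevNorm c Γ ψ := fun r hr ψ hψ => by
    have h1 := htr r hr 1 zero_le_one ψ hψ
    simp only [one_mul] at h1
    refine h1.trans ?_
    gcongr
    exact lintegral_energyDensity_le hψ
  have hDr : ∀ r, D r * ENNReal.ofReal (Real.exp (r / 2)) ≠ ⊤ := fun r =>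
    ENNReal.mul_ne_top (hD r) ENNReal.ofReal_ne_top
  refine ⟨fun r hr j => exists_isTrace_of_le (hDr r) (htr1 r hr) (h.exists_test_approx (w j)),
    fun g hg α => ?_⟩
  set J : ℝ≥0∞ := (∫⁻ x, ENNReal.ofReal (Real.exp (-(1 / 2 * potential c Γ x))) *
    ENNReal.ofReal (energyDensity (hermiteProd u α) x)) ^ (1 / 2 : ℝ) with hJ
  have hJt : J ≠ ⊤ := by
    obtain ⟨κ, hκ, hφ⟩ := h.lower_bound
    have hE : ExpGrowth (energyDensity (hermiteProd u α)) := by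
      unfold energyDensity
      simp only [sq]
      exact ((expGrowth_hermiteProd u α).mul (expGrowth_hermiteProd u α)).add
        (ExpGrowth.sum _ fun j _ => (expGrowth_fderiv_hermiteProd u α _).mul
          (expGrowth_fderiv_hermiteProd u α _))
    have hi := hE.integrable_mul_exp (continuous_energyDensity (contDiff_hermiteProd u α))
      hκ (s := 1 / 2) (by norm_num) hφ
    refine ENNReal.rpow_ne_top_of_nonneg (by norm_num) (ne_of_lt ?_)
    refine lt_of_eq_of_lt (lintegral_congr fun x => ?_) hi.lintegral_lt_top
    rw [← ENNReal.ofReal_mul (Real.exp_pos _).le, mul_comm]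
  have hH : ∀ r, 0 < r → eLpNorm (hermiteProd u α) 2 (surfaceMeasure c Γ r) ≤
      D r * ENNReal.ofReal (Real.exp (r / 4)) * J := fun r hr => by
    have h1 := htr r hr (1 / 2) (by norm_num) _ (contDiff_hermiteProd u α)
    rwa [show 1 / 2 * r / 2 = r / 4 by ring] at h1
  have hexp : ∀ r x, Real.exp (-potential c Γ x) * hermiteProd u α x *
      inner ℝ (WithLp.toLp 2 fun j => g r j x) (outwardNormal c Γ x) =
        ∑ j, Real.exp (-potential c Γ x) * hermiteProd u α x * outwardNormal c Γ x j *
          g r j x := fun r x => by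
    simp only [PiLp.inner_apply, Finset.mul_sum]
    refine Finset.sum_congr rfl fun j _ => ?_
    simp
    ring
  have hmem : ∀ r, 0 < r → ∀ j, MemLp (fun x => Real.exp (-potential c Γ x) *
      hermiteProd u α x * outwardNormal c Γ x j) 2 (surfaceMeasure c Γ r) := fun r hr j => by
    obtain ⟨m1, m2⟩ := h.eLpNorm_weight_le (r := r) α j
    refine ⟨m1, m2.trans_lt (ENNReal.mul_lt_top ENNReal.ofReal_lt_top ((hH r hr).trans_lt ?_))⟩
    exact (ENNReal.mul_ne_top (ENNReal.mul_ne_top (hD r) ENNReal.ofReal_ne_top) hJt).lt_top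
  have hint : ∀ r, 0 < r → ∀ j, Integrable (fun x => Real.exp (-potential c Γ x) *
      hermiteProd u α x * outwardNormal c Γ x j * g r j x) (surfaceMeasure c Γ r) :=
    fun r hr j => (hmem r hr j).integrable_mul (hg r hr j).memLp
  refine ⟨fun r hr => ?_, ?_⟩
  · simp_rw [hexp]
    exact integrable_finsetSum _ fun j _ => hint r hr j
  set N : ℝ≥0∞ := ∑ j, D₁ * J * (D₁ * sobolevNormV c Γ (w j)) with hN
  have hNt : N ≠ ⊤ := ENNReal.sum_ne_top.2 fun j _ => ENNReal.mul_ne_top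
    (ENNReal.mul_ne_top hD₁ hJt) (ENNReal.mul_ne_top hD₁ (sobolevNormV_ne_top _))
  have hbound : ∀ r, 1 ≤ r → ‖∫ x, Real.exp (-potential c Γ x) * hermiteProd u α x *
      inner ℝ (WithLp.toLp 2 fun j => g r j x) (outwardNormal c Γ x)
        ∂(surfaceMeasure c Γ r)‖ₑ ≤ ENNReal.ofReal (Real.exp (-(r / 4))) * N := fun r hr => by
    have hr0 : 0 < r := by linarith
    simp_rw [hexp]
    rw [integral_finsetSum _ fun j _ => hint r hr0 j]
    refine (enorm_sum_le _ _).trans ?_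
    rw [hN, Finset.mul_sum]
    refine Finset.sum_le_sum fun j _ => ?_
    refine (enorm_integral_le_lintegral_enorm _).trans ?_
    have h1 := eLpNorm_smul_le_mul_eLpNorm (p := 2) (q := 2) (r := 1) (hg r hr0 j).memLp.1
      (hmem r hr0 j).1
    rw [eLpNorm_one_eq_lintegral_enorm] at h1
    refine h1.trans ?_
    -- The three factors are the weight, the trace bound for H_α (s = 1/2) and the trace bound for w
    -- (s = 1).
    have h2 : Real.exp (-(r / 4)) = Real.exp (-r) * Real.exp (r / 4) * Real.exp (r / 2) := by
      rw [← Real.exp_add, ← Real.exp_add]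
      congr 1
      ring
    rw [h2, ENNReal.ofReal_mul (by positivity), ENNReal.ofReal_mul (by positivity)]
    calc _ ≤ (ENNReal.ofReal (Real.exp (-r)) * (D r * ENNReal.ofReal (Real.exp (r / 4)) * J)) *
          (D r * ENNReal.ofReal (Real.exp (r / 2)) * sobolevNormV c Γ (w j)) := by
          refine mul_le_mul' (((h.eLpNorm_weight_le (r := r) α j).2).trans ?_)
            ((hg r hr0 j).eLpNorm_le (hDr r) (htr1 r hr0))
          gcongr
          exact hH r hr0
      _ ≤ (ENNReal.ofReal (Real.exp (-r)) * (D₁ * ENNReal.ofReal (Real.exp (r / 4)) * J)) *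
          (D₁ * ENNReal.ofReal (Real.exp (r / 2)) * sobolevNormV c Γ (w j)) := by
          gcongr <;> exact hDD₁ r hr
      _ = _ := by ring
  have hlim : Tendsto (fun r : ℝ => ENNReal.ofReal (Real.exp (-(r / 4))) * N) atTop (𝓝 0) := by
    have h1 : Tendsto (fun r : ℝ => Real.exp (-(r / 4))) atTop (𝓝 0) :=
      Real.tendsto_exp_neg_atTop_nhds_zero.comp (tendsto_id.atTop_div_const (by norm_num))
    have h2 := ENNReal.Tendsto.mul_const (ENNReal.tendsto_ofReal h1) (Or.inr hNt)
    simpa using h2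
  rw [tendsto_zero_iff_enorm_tendsto_zero]
  exact tendsto_of_tendsto_of_tendsto_of_le_of_le' tendsto_const_nhds hlim
    (Eventually.of_forall fun _ => zero_le) ((eventually_ge_atTop 1).mono hbound)

end EigenData

theorem proposition2p3 {n : ℕ} (hn : 0 < n) {c : ℝ} (hc : 0 < c)
    (Γ : Matrix (Fin n) (Fin n) ℝ) (hΓ : Γ.PosDef)
    -- an orthonormal basis of eigenvectors of `Γ`, with the eigenvalues
    (v : OrthonormalBasis (Fin n) ℝ (EuclideanSpace ℝ (Fin n))) (lt : Fin n → ℝ)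
    (hv : ∀ k, Matrix.mulVec Γ (v k).ofLp = lt k • (v k).ofLp)
    -- `λₖ` and `uₖ`
    (l : Fin n → ℝ) (hl : ∀ k, l k = lt k / c)
    (u : Fin n → EuclideanSpace ℝ (Fin n)) (hu : ∀ k, u k = √(l k / 2) • v k) :
    -- spectrum of `A`
    opSpectrum (formOperator c Γ) =
      {z : ℂ | ∃ α : Fin n → ℕ, z = ((eigenvalue l α : ℝ) : ℂ)} ∧
    -- complete orthogonal system of eigenfunctions
    (∃ hH : ∀ α : Fin n → ℕ, MemLp (hermiteProd u α) 2 (weightedMeasure c Γ),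
      (∀ α, (hH α).toLp ≠ 0) ∧
      (Pairwise fun α β => inner ℝ (hH α).toLp (hH β).toLp = 0) ∧
      (Submodule.span ℝ (Set.range fun α => (hH α).toLp)).topologicalClosure = ⊤ ∧
      ∀ α, ∃ hα : (hH α).toLp ∈ (formOperator c Γ).domain,
        formOperator c Γ ⟨(hH α).toLp, hα⟩ = eigenvalue l α • (hH α).toLp) ∧
    -- (i) gradient formula
    (∀ (α : Fin n → ℕ) (x : EuclideanSpace ℝ (Fin n)),
      HasGradientAt (fun y => Real.exp (-potential c Γ y) * hermiteProd u α y)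
        (-(Real.exp (-potential c Γ x) • ∑ k,
          ((∏ j ∈ Finset.univ.erase k, hermiteFun (α j) (inner ℝ (u j) x)) *
            hermiteFun (α k + 1) (inner ℝ (u k) x)) • u k)) x) ∧
    -- (ii) traces on the level sets exist, and the boundary integrals vanish in the limit
    (∀ w : Fin n → sobolev c Γ,
      (∀ r, 0 < r → ∀ j, ∃ g, IsTrace r (w j) g) ∧
      ∀ g : ℝ → Fin n → EuclideanSpace ℝ (Fin n) → ℝ,
        (∀ r, 0 < r → ∀ j, IsTrace r (w j) (g r j)) → ∀ α : Fin n → ℕ,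
          (∀ r, 0 < r → Integrable (fun x => Real.exp (-potential c Γ x) * hermiteProd u α x *
            inner ℝ (WithLp.toLp 2 fun j => g r j x) (outwardNormal c Γ x))
            (surfaceMeasure c Γ r)) ∧
          Tendsto (fun r => ∫ x, Real.exp (-potential c Γ x) * hermiteProd u α x *
            inner ℝ (WithLp.toLp 2 fun j => g r j x) (outwardNormal c Γ x)
            ∂(surfaceMeasure c Γ r)) atTop (𝓝 0)) := by
  obtain ⟨hpos, hφ⟩ := potential_eq_sum hc hΓ v hv hl hu
  have h : EigenData c Γ v l u := ⟨hpos, hu, hφ⟩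
  exact ⟨h.opSpectrum_eq, ⟨h.memLp, h.hermiteLp_ne_zero, fun _ _ hne => h.inner_hermiteLp_of_ne hne,
    h.span_dense, fun α => ⟨h.mem_domain α, h.formOperator_hermiteLp α⟩⟩,
    hasGradientAt_exp_mul_hermiteProd hφ, h.trace_and_boundary_limit hn⟩
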